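/- Let $M$ be a surface (a smooth $2$-manifold without boundary), $\varphi:M\to M$ a $C^2$-diffeomorphism and $\Lambda\subset M$ a horseshoe of $\varphi$: a non-empty compact invariant hyperbolic set of saddle type, with splitting $T_\Lambda M=E^s\oplus E^u$, that is transitive (it has a dense forward orbit), locally maximal and not reduced to a periodic orbit. Let $\{R_a\}_{a\in\mathcal A}$ be a geometrical Markov partition of $\Lambda$: a finite family of pairwise disjoint rectangles $R_a\simeq I^s_a\times I^u_a$ that meet $\Lambda$, whose sides lie in stable and unstable manifolds of points of $\Lambda$, and such that $\Lambda$ is the maximal invariant set of $\bigcup_a R_a$. The identifications $R_a\simeq I^s_a\times I^u_a$ extend to $C^{1+\varepsilon}$-diffeomorphisms between neighbourhoods, for some $\varepsilon>0$, and straighten two foliations that extend the stable and unstable manifolds of $\Lambda$: the arcs $I^s_a\times\{y\}$ are the stable leaves and the arcs $\{x\}\times I^u_a$ the unstable leaves, and a leaf through a point of $\Lambda$ is an arc of the stable, resp. unstable, manifold of that point, tangent there to $E^s$, resp. $E^u$. The foliations are locally invariant: $\varphi$ maps two points of $R_a\cap\varphi^{-1}(R_b)$ on the same stable leaf of $R_a$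 to the same stable leaf of $R_b$, and $\varphi^{-1}$ maps two points of $\varphi(R_a)\cap R_b$ on the same unstable leaf of $R_b$ to the same unstable leaf of $R_a$. A pair $(a,b)$ is admissible if $\varphi(R_a)\cap R_b\ne\emptyset$, and then $R_a\cap\varphi^{-1}(R_b)=I^s_a\times J$ and $\varphi(R_a)\cap R_b=J'\times I^u_b$ with nondegenerate compact intervals $J\subset I^u_a$, $J'\subset I^s_b$. The intervals $I^s_a$ are placed disjointly in $\mathbb R$, and so are the intervals $I^u_a$. Let $\pi^s_a:R_a\to I^u_a$ and $\pi^u_a:R_a\to I^s_a$ be the projections along the stable and the unstable leaves. Put $I^u(a,b)=\pi^s_a(R_a\cap\varphi^{-1}(R_b))$ and $I^s(b,a)=\pi^u_b(R_b\cap\varphi(R_a))$, and let $g_u$, $g_s$ be the maps with $g_u(\pi^s_a(z))=\pi^s_b(\varphi(z))$ and $g_s(\pi^u_b(\varphi(z)))=\pi^u_a(z)$ for $z\in R_a\cap\varphi^{-1}(R_b)$. For an admissible word $\alpha=a_1\cdots a_n$, $n\ge1$ (all pairs $(a_i,a_{i+1})$ admissible) put $$I^u(\alpha)=\{x\in I^u_{a_1}: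 g_u^{i-1}(x)\in I^u(a_i,a_{i+1}),\ 1\le i\le n-1\},$$ $$I^s(\alpha^T)=\{y\in I^s_{a_n}: g_s^{n-i}(y)\in I^s(a_i,a_{i-1}),\ 2\le i\le n\},$$ and let $r^{(u)}(\alpha)=\lfloor\log(1/|I^u(\alpha)|)\rfloor$, $r^{(s)}(\alpha)=\lfloor\log(1/|I^s(\alpha^T)|)\rfloor$, where $|\cdot|$ is the length. Let $f:M\to\mathbb R$ be of class $C^k$, $k\ge2$. For $t\in\mathbb R$ let $\Lambda_t=\{x\in\Lambda: f(\varphi^n(x))\le t\ \forall n\in\mathbb Z\}$, $K^u_t=\bigcup_a\pi^s_a(\Lambda_t\cap R_a)$ and $K^s_t=\bigcup_a\pi^u_a(\Lambda_t\cap R_a)$. For $r\in\mathbb N$ let $N_u(t,r)$ be the number of admissible words $\alpha=a_1\cdots a_n$, $n\ge1$, with $r^{(u)}(\alpha)\ge r$, with $r^{(u)}(a_1\cdots a_{n-1})<r$ (no condition if $n=1$) and with $I^u(\alpha)\cap K^u_t\neq\emptyset$; let $N_s(t,r)$ be the number of those with $r^{(s)}(\alpha)\ge r$, with $r^{(s)}(a_1\cdots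 a_{n-1})<r$ (no condition if $n=1$) and with $I^s(\alpha^T)\cap K^s_t\ne\emptyset$. We use the convention $\log 0=0$, which matters only if $\Lambda_t=\emptyset$, where all the numbers below are then $0$. Then the numbers $N_u(t,r)$, $N_s(t,r)$ are finite, and there is $c_3\in\mathbb N$, independent of $f$ and $t$, such that for all $t\in\mathbb R$, $n,m\in\mathbb N$ and $*\in\{u,s\}$ $$N_*(t,n+m)\le(\#\mathcal A)^{c_3}\,N_*(t,n)\,N_*(t,m),$$ the limits $$D_*(t)=\lim_{m\to\infty}\frac1m\log N_*(t,m)=\inf_{m\ge1}\frac1m\log\big((\#\mathcal A)^{c_3}N_*(t,m)\big)$$ exist, $D_u(t)$ and $D_s(t)$ are the box-counting dimensions of $K^u_t$ and $K^s_t$ (as subsets of $\mathbb R$), and the functions $t\mapsto D_u(t)$ and $t\mapsto D_s(t)$ are upper semicontinuous on $\mathbb R$. -/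

import Mathlib

open Set Filter
open scoped Manifold ContDiff Topology

noncomputable section

namespace MarkovLagrange

/-! ### Horseshoes of surface diffeomorphisms -/

section Horseshoe

variable {M : Type*} [TopologicalSpace M] [ChartedSpace (EuclideanSpace ℝ (Fin 2)) M]
  [IsManifold (𝓡 2) ∞ M]

/-- A continuous Riemannian metric on the surface `M`. -/
abbrev Metric2 (M : Type*) [TopologicalSpace M] [ChartedSpace (EuclideanSpace ℝ (Fin 2)) M]
    [IsManifold (𝓡 2) ∞ M] : Type _ :=
  Bundle.ContinuousRiemannianMetric (EuclideanSpace ℝ (Fin 2))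
    (fun x : M => TangentSpace (𝓡 2) x)

/-- The norm of a tangent vector. -/
def Metric2.norm (g : Metric2 M) (x : M) (v : TangentSpace (𝓡 2) x) : ℝ :=
  Real.sqrt (g.inner x v v)

/-- The iterate `φ ^ n`, `n ∈ ℤ`. -/
def iter (φ : M ≃ₘ^2⟮𝓡 2, 𝓡 2⟯ M) (n : ℤ) : M → M :=
  ⇑((φ.toEquiv : Equiv.Perm M) ^ n)

/-- `Λ` is a hyperbolic set of saddle type with splitting `T_Λ M = Es ⊕ Eu` (the values of `Es`
and `Eu` off `Λ` are irrelevant). -/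
structure IsHyperbolic (φ : M ≃ₘ^2⟮𝓡 2, 𝓡 2⟯ M) (Λ : Set M)
    (Es Eu : ∀ x : M, Submodule ℝ (TangentSpace (𝓡 2) x)) : Prop where
  isCompl : ∀ x ∈ Λ, IsCompl (Es x) (Eu x)
  finrank_s : ∀ x ∈ Λ, Module.finrank ℝ (Es x) = 1
  finrank_u : ∀ x ∈ Λ, Module.finrank ℝ (Eu x) = 1
  map_s : ∀ x ∈ Λ, (Es x).map (mfderiv (𝓡 2) (𝓡 2) φ x).toLinearMap = Es (φ x)
  map_u : ∀ x ∈ Λ, (Eu x).map (mfderiv (𝓡 2) (𝓡 2) φ x).toLinearMap = Eu (φ x)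
  rates : ∃ (g : Metric2 M) (C ρ : ℝ), 0 < C ∧ 0 < ρ ∧ ρ < 1 ∧ ∀ x ∈ Λ, ∀ n : ℕ,
    (∀ v ∈ Es x, g.norm (φ^[n] x) (mfderiv (𝓡 2) (𝓡 2) (φ^[n]) x v) ≤ C * ρ ^ n * g.norm x v) ∧
    (∀ v ∈ Eu x, g.norm (φ.symm^[n] x) (mfderiv (𝓡 2) (𝓡 2) (φ.symm^[n]) x v)
      ≤ C * ρ ^ n * g.norm x v)

/-- A horseshoe: a non-empty compact invariant hyperbolic set of saddle type which is transitive,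
locally maximal and not reduced to a periodic orbit. -/
structure IsHorseshoe (φ : M ≃ₘ^2⟮𝓡 2, 𝓡 2⟯ M) (Λ : Set M)
    (Es Eu : ∀ x : M, Submodule ℝ (TangentSpace (𝓡 2) x)) : Prop where
  nonempty : Λ.Nonempty
  isCompact : IsCompact Λ
  invariant : φ '' Λ = Λ
  hyperbolic : IsHyperbolic φ Λ Es Eu
  transitive : ∃ x ∈ Λ, Λ ⊆ closure (range fun n : ℕ => φ^[n] x)
  locallyMaximal : ∃ U : Set M, IsOpen U ∧ Λ ⊆ U ∧ Λ = {x | ∀ n : ℤ, iter φ n x ∈ U}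
  not_periodic : ∀ x ∈ Function.periodicPts φ, Λ ≠ range fun n : ℕ => φ^[n] x

/-- The stable set of `x` under `ψ`: the points `y` whose forward orbit is asymptotic to that
of `x`. If the orbit of `x` stays in a compact set, as it does for `x ∈ Λ`, convergence to the
diagonal means that the distance of `ψ ^ n x` and `ψ ^ n y` tends to `0`, for any metric that
induces the topology. -/
def stableSet (ψ : M → M) (x : M) : Set M :=
  {y | Tendsto (fun n : ℕ => (ψ^[n] x, ψ^[n] y)) atTop (𝓝ˢ (diagonal M))}

end Horseshoe

/-! ### Markov partitions adapted to the invariant foliations -/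

/-- `F` is of class `C^{1+ε}` near `p`: it is differentiable with `ε`-Hölder derivative on a
neighbourhood of `p`. -/
def C1HolderAt {E F : Type*} [NormedAddCommGroup E] [NormedSpace ℝ E] [NormedAddCommGroup F]
    [NormedSpace ℝ F] (ε : ℝ) (h : E → F) (p : E) : Prop :=
  ∃ N ∈ 𝓝 p, ∃ C : ℝ, (∀ q ∈ N, DifferentiableAt ℝ h q) ∧
    ∀ q ∈ N, ∀ q' ∈ N, ‖fderiv ℝ h q - fderiv ℝ h q'‖ ≤ C * ‖q - q'‖ ^ ε

section Partition

variable {M : Type*} [TopologicalSpace M] [ChartedSpace (EuclideanSpace ℝ (Fin 2)) M]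

/-- `Ψ`, defined on an open subset of the plane, is a `C^{1+ε}` diffeomorphism onto an open subset
of the surface: in the charts of `M`, both `Ψ` and its inverse are locally `C^{1+ε}`. -/
def IsC1HolderDiffeo (ε : ℝ) (Ψ : OpenPartialHomeomorph (ℝ × ℝ) M) : Prop :=
  ∀ p ∈ Ψ.source,
    C1HolderAt ε (fun q => extChartAt (𝓡 2) (Ψ p) (Ψ q)) p ∧
    C1HolderAt ε (fun w => Ψ.symm ((extChartAt (𝓡 2) (Ψ p)).symm w)) (extChartAt (𝓡 2) (Ψ p) (Ψ p))

/-- A finite family of rectangles `R a ≃ Is a × Iu a` in `M`, each given by a parametrization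
defined on a neighbourhood of the product of two nondegenerate compact intervals. The first
coordinate runs along the stable leaves, the second one along the unstable leaves. -/
structure RectangleFamily (M : Type*) [TopologicalSpace M] (A : Type*) where
  param : A → OpenPartialHomeomorph (ℝ × ℝ) M
  sLo : A → ℝ
  sHi : A → ℝ
  uLo : A → ℝ
  uHi : A → ℝ
  s_lt : ∀ a, sLo a < sHi a
  u_lt : ∀ a, uLo a < uHi a
  box_subset : ∀ a, Icc (sLo a) (sHi a) ×ˢ Icc (uLo a) (uHi a) ⊆ (param a).source

namespace RectangleFamily

variable {A : Type*} (P : RectangleFamily M A)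

/-- The interval `I^s_a`. -/
def Is (a : A) : Set ℝ := Icc (P.sLo a) (P.sHi a)

/-- The interval `I^u_a`. -/
def Iu (a : A) : Set ℝ := Icc (P.uLo a) (P.uHi a)

/-- The rectangle `R_a`. -/
def R (a : A) : Set M := P.param a '' (P.Is a ×ˢ P.Iu a)

/-- The projection `π^s_a` of `R_a` along the stable leaves, with values in `I^u_a`. -/
def projS (a : A) (z : M) : ℝ := ((P.param a).symm z).2

/-- The projection `π^u_a` of `R_a` along the unstable leaves, with values in `I^s_a`. -/
def projU (a : A) (z : M) : ℝ := ((P.param a).symm z).1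

end RectangleFamily

/-- The transition from `a` to `b` is admissible: `φ (R a)` meets `R b`. -/
def Admissible {A : Type*} (φ : M ≃ₘ^2⟮𝓡 2, 𝓡 2⟯ M) (P : RectangleFamily M A) (a b : A) : Prop :=
  (φ '' P.R a ∩ P.R b).Nonempty

/-- The rectangles form a geometrical Markov partition of the horseshoe `Λ`, in coordinates that
straighten locally invariant `C^{1+ε}` foliations which extend the stable and the unstable
manifolds of the points of `Λ`. -/
structure IsMarkovPartition {A : Type*} (φ : M ≃ₘ^2⟮𝓡 2, 𝓡 2⟯ M) (Λ : Set M)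
    (Es Eu : ∀ x : M, Submodule ℝ (TangentSpace (𝓡 2) x)) (P : RectangleFamily M A) : Prop where
  /-- The two foliations are of class `C^{1+ε}`. -/
  regular : ∃ ε : ℝ, 0 < ε ∧ ∀ a, IsC1HolderDiffeo ε (P.param a)
  /-- The rectangles are so small that `Λ` is the maximal invariant set of their union. -/
  maximal : Λ = {x | ∀ n : ℤ, iter φ n x ∈ ⋃ a, P.R a}
  meets : ∀ a, (Λ ∩ P.R a).Nonempty
  disjoint_R : Pairwise fun a b => Disjoint (P.R a) (P.R b)
  /-- The intervals `I^s_a` lie in one line without overlap, and so do the intervals `I^u_a`. -/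
  disjoint_Is : Pairwise fun a b => Disjoint (P.Is a) (P.Is b)
  disjoint_Iu : Pairwise fun a b => Disjoint (P.Iu a) (P.Iu b)
  /-- Markov property: `R a ∩ φ⁻¹ (R b)` crosses `R a` along the whole stable direction. -/
  cross_s : ∀ a b, Admissible φ P a b → ∃ c d : ℝ, c < d ∧ Icc c d ⊆ P.Iu a ∧
    P.R a ∩ φ ⁻¹' P.R b = P.param a '' (P.Is a ×ˢ Icc c d)
  /-- Markov property: `φ (R a) ∩ R b` crosses `R b` along the whole unstable direction. -/
  cross_u : ∀ a b, Admissible φ P a b → ∃ c d : ℝ, c < d ∧ Icc c d ⊆ P.Is b ∧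
    φ '' P.R a ∩ P.R b = P.param b '' (Icc c d ×ˢ P.Iu b)
  /-- Local invariance of the stable foliation under `φ`. -/
  invariant_s : ∀ a b, ∀ z ∈ P.R a ∩ φ ⁻¹' P.R b, ∀ z' ∈ P.R a ∩ φ ⁻¹' P.R b,
    P.projS a z = P.projS a z' → P.projS b (φ z) = P.projS b (φ z')
  /-- Local invariance of the unstable foliation under `φ⁻¹`. -/
  invariant_u : ∀ a b, ∀ z ∈ P.R a ∩ φ ⁻¹' P.R b, ∀ z' ∈ P.R a ∩ φ ⁻¹' P.R b,
    P.projU b (φ z) = P.projU b (φ z') → P.projU a z = P.projU a z'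
  /-- The leaves through the points of `Λ` are arcs of their stable and unstable manifolds. -/
  leaf_s : ∀ a, ∀ p ∈ P.Is a ×ˢ P.Iu a, P.param a p ∈ Λ →
    ∀ x ∈ P.Is a, P.param a (x, p.2) ∈ stableSet φ (P.param a p)
  leaf_u : ∀ a, ∀ p ∈ P.Is a ×ˢ P.Iu a, P.param a p ∈ Λ →
    ∀ y ∈ P.Iu a, P.param a (p.1, y) ∈ stableSet φ.symm (P.param a p)
  /-- These arcs are tangent to the invariant directions at the points of `Λ`. -/
  tangent_s : ∀ a, ∀ p ∈ P.Is a ×ˢ P.Iu a, P.param a p ∈ Λ →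
    mfderiv 𝓘(ℝ, ℝ × ℝ) (𝓡 2) (P.param a) p ((1, 0) : ℝ × ℝ) ∈ Es (P.param a p)
  tangent_u : ∀ a, ∀ p ∈ P.Is a ×ˢ P.Iu a, P.param a p ∈ Λ →
    mfderiv 𝓘(ℝ, ℝ × ℝ) (𝓡 2) (P.param a) p ((0, 1) : ℝ × ℝ) ∈ Eu (P.param a p)
  /-- The sides of the rectangles lie in stable and unstable manifolds of points of `Λ`. -/
  side_s : ∀ a, ∀ y ∈ ({P.uLo a, P.uHi a} : Set ℝ), ∃ q ∈ Λ,
    ∀ x ∈ P.Is a, P.param a (x, y) ∈ stableSet φ q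
  side_u : ∀ a, ∀ x ∈ ({P.sLo a, P.sHi a} : Set ℝ), ∃ q ∈ Λ,
    ∀ y ∈ P.Iu a, P.param a (x, y) ∈ stableSet φ.symm q

/-! ### The expanding maps and their cylinders -/

section Expanding

variable {A : Type*}

/-- The interval `π_a (R_a ∩ ψ⁻¹ (R_b))`. -/
def branchDomain (ψ : M → M) (R : A → Set M) (π : A → M → ℝ) (a b : A) : Set ℝ :=
  π a '' (R a ∩ ψ ⁻¹' R b)

open Classical in
/-- The map `g` with `g (π_a z) = π_b (ψ z)` for `z ∈ R_a ∩ ψ⁻¹ (R_b)` (and the identity off the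
union of the branch domains). -/
def expandingMap (ψ : M → M) (R : A → Set M) (π : A → M → ℝ) (x : ℝ) : ℝ :=
  if h : ∃ p : A × A × M, p.2.2 ∈ R p.1 ∧ ψ p.2.2 ∈ R p.2.1 ∧ π p.1 p.2.2 = x then
    π h.choose.2.1 (ψ h.choose.2.2)
  else x

/-- The interval of the points `x ∈ π (R_{w_0})` with `g ^ i x` in the branch domain of
`(w_i, w_{i+1})` for all consecutive letters of the word `w = w_0 w_1 ⋯`. -/
def cylinder (ψ : M → M) (R : A → Set M) (π : A → M → ℝ) (w : List A) : Set ℝ :=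
  {x | (∀ a ∈ w.head?, x ∈ π a '' R a) ∧
    ∀ i : ℕ, ∀ a ∈ w[i]?, ∀ b ∈ w[i + 1]?, (expandingMap ψ R π)^[i] x ∈ branchDomain ψ R π a b}

end Expanding

section Counting

variable {A : Type*} (φ : M ≃ₘ^2⟮𝓡 2, 𝓡 2⟯ M) (P : RectangleFamily M A)

/-- The interval `I^u(α)`, a cylinder of the map `g_u`. -/
def cylU (α : List A) : Set ℝ := cylinder φ P.R P.projS α

/-- The interval `I^s(α^T)`, a cylinder of the map `g_s`, where `α^T` is the transpose of `α`. -/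
def cylS (α : List A) : Set ℝ := cylinder φ.symm P.R P.projU α.reverse

/-- The scale `⌊log (1 / |I|)⌋` of an interval `I` of length `|I|`. -/
def scale (I : Set ℝ) : ℤ := ⌊Real.log (1 / Metric.diam I)⌋

/-- The words `α = a_1 ⋯ a_n`, `n ≥ 1`, that are admissible, of scale at least `r`, and such that
`a_1 ⋯ a_{n-1}` has scale less than `r`. For `n = 1` the last condition is void (the empty word
counts as having scale `-∞`). -/
def minimalWords (I : List A → Set ℝ) (r : ℕ) : Set (List A) :=
  {α | α ≠ [] ∧ α.IsChain (Admissible φ P) ∧ (r : ℤ) ≤ scale (I α) ∧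
    (2 ≤ α.length → scale (I α.dropLast) < (r : ℤ))}

/-- `Λ_t`: the points of `Λ` along whose orbit `f ≤ t`. -/
def sublevel (Λ : Set M) (f : M → ℝ) (t : ℝ) : Set M :=
  {x ∈ Λ | ∀ n : ℤ, f (iter φ n x) ≤ t}

/-- `K^u_t`. -/
def Ku (Λ : Set M) (f : M → ℝ) (t : ℝ) : Set ℝ := ⋃ a, P.projS a '' (sublevel φ Λ f t ∩ P.R a)

/-- `K^s_t`. -/
def Ks (Λ : Set M) (f : M → ℝ) (t : ℝ) : Set ℝ := ⋃ a, P.projU a '' (sublevel φ Λ f t ∩ P.R a)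

/-- `C_u(t, r)`. -/
def wordsU (Λ : Set M) (f : M → ℝ) (t : ℝ) (r : ℕ) : Set (List A) :=
  {α ∈ minimalWords φ P (cylU φ P) r | (cylU φ P α ∩ Ku φ P Λ f t).Nonempty}

/-- `C_s(t, r)`. -/
def wordsS (Λ : Set M) (f : M → ℝ) (t : ℝ) (r : ℕ) : Set (List A) :=
  {α ∈ minimalWords φ P (cylS φ P) r | (cylS φ P α ∩ Ks φ P Λ f t).Nonempty}

/-- `N_u(t, r)`. -/
def Nu (Λ : Set M) (f : M → ℝ) (t : ℝ) (r : ℕ) : ℕ := (wordsU φ P Λ f t r).ncard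

/-- `N_s(t, r)`. -/
def Ns (Λ : Set M) (f : M → ℝ) (t : ℝ) (r : ℕ) : ℕ := (wordsS φ P Λ f t r).ncard

end Counting

end Partition

/-- `inf_{m ≥ 1} (1/m) log (B · N(m))`. When `N` vanishes identically (the set that is counted is
empty), the convention `log 0 = 0` gives the value `0`. -/
def growthInf (B : ℕ) (N : ℕ → ℕ) : ℝ :=
  ⨅ m : ℕ+, Real.log ((B * N m : ℕ) : ℝ) / (m : ℝ)

/-- The set `E` of reals has box-counting dimension `d` (as a limit); the empty set has box-counting
dimension `0`. -/
def HasBoxDim (E : Set ℝ) (d : ℝ) : Prop :=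
  Tendsto (fun δ : ℝ => Real.log ((Metric.coveringNumber δ.toNNReal E).toNat : ℝ)
    / Real.log (1 / δ)) (𝓝[>] 0) (𝓝 d)

end MarkovLagrange

end

/-! The branches of g_u form a full Markov map of class C^{1+ε} on finitely many intervals.
Hyperbolicity gives expansion along orbits that stay in Λ; by compactness some fixed iterate at
least doubles lengths on all sufficiently deep cylinders, so cylinders shrink exponentially
(`exists_diam_le`). With the Hölder derivative this yields bounded distortion (`exists_distortion`).
Hence the weight S(α) = log (1/|I(α)|) is additive under concatenation up to a constant C and grows
at least linearly with the length of the word (`IsQuasiAdditive`). The remaining estimates count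
words of a language, the itineraries of the points of Λ_t, by such a weight.

A word counted at scale n + m splits as βγ with β counted at scale n and S(γ) within O(C) of m.
Words in such a window are at most a constant times as many as those counted at scale m
(`exists_window_ncard_le`), which gives submultiplicativity (`exists_firstPassage_add_le`); Fekete's
lemma gives the limit. The cylinders counted at scale r have length comparable to e^{-r}, cover the
projection of Λ_t up to a bounded factor in number, and overlap boundedly often, so their number is
comparable to the covering number (`IsCylinderCover.hasBoxDim`). Finally, a word that no point of
Λ_t follows is, by compactness, not followed by Λ_{t'} for t' near t. Each count is therefore upper
semicontinuous in t, and so is the infimum.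

The stable half is the unstable half for the inverse diffeomorphism with the two coordinates
exchanged (`IsMarkovPartition.swap`). One asymmetry remains: N_s also tests the word without its
last letter, which is the first letter of the transposed word. Its intervals are not nested along
prefixes, and the weight need not be monotone. For this reason the counting rests on
quasi-additivity, which survives reversal, and not on nestedness.

The constants C and c come from the system of all admissible words, and every Λ_t only selects a
sublanguage. Thus c₃ depends neither on f nor on t. -/

namespace MarkovLagrange

/-! ### Counting words of a language by a quasi-additive weight -/

section Words

variable {A : Type*}

/-- A factorial language of non-empty words that can be prolonged to the right. -/
structure IsLanguage (L : Set (List A)) : Prop where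
  nil_notMem : [] ∉ L
  of_append_left : ∀ {α β : List A}, α ++ β ∈ L → α ≠ [] → α ∈ L
  of_append_right : ∀ {α β : List A}, α ++ β ∈ L → β ≠ [] → β ∈ L
  extend : ∀ {α : List A}, α ∈ L → ∃ a, α ++ [a] ∈ L

/-- A weight on the words of `L` that is additive under concatenation up to the error `C`, and
grows at least linearly with the length. -/
structure IsQuasiAdditive (L : Set (List A)) (S : List A → ℝ) (C c : ℝ) : Prop where
  pos : 0 < c
  nonneg : 0 ≤ C
  append : ∀ {α β : List A}, α ++ β ∈ L → α ≠ [] → β ≠ [] → |S (α ++ β) - S α - S β| ≤ C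
  singleton : ∀ {a : A}, [a] ∈ L → |S [a]| ≤ C
  growth : ∀ {α : List A}, α ∈ L → c * α.length - C ≤ S α

lemma IsQuasiAdditive.mono {L L' : Set (List A)} {S : List A → ℝ} {C c : ℝ}
    (h : IsQuasiAdditive L S C c) (hL : L' ⊆ L) : IsQuasiAdditive L' S C c :=
  ⟨h.pos, h.nonneg, fun h' => h.append (hL h'), fun h' => h.singleton (hL h'),
    fun h' => h.growth (hL h')⟩

/-- The words of `L` along whose prefixes the weight crosses the level `r` at the last letter. -/
def firstPassage (L : Set (List A)) (S : List A → ℝ) (r : ℕ) : Set (List A) :=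
  {α ∈ L | (r : ℝ) ≤ S α ∧ (2 ≤ α.length → S α.dropLast < r)}

/-- The words of `L` whose weight differs from `r` by at most `K`. -/
def window (L : Set (List A)) (S : List A → ℝ) (K r : ℝ) : Set (List A) :=
  {α ∈ L | |S α - r| ≤ K}

lemma exists_dropLast_append {α : List A} (h : α ≠ []) : ∃ a, α = α.dropLast ++ [a] :=
  ⟨α.getLast h, (List.dropLast_append_getLast h).symm⟩

variable {L : Set (List A)} {S : List A → ℝ} {C c : ℝ}

lemma IsLanguage.ne_nil (hL : IsLanguage L) {α : List A} (h : α ∈ L) : α ≠ [] := by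
  rintro rfl
  exact hL.nil_notMem h

lemma IsLanguage.exists_extension (hL : IsLanguage L) {α : List A} (h : α ∈ L) (n : ℕ) :
    ∃ γ : List A, γ.length = n ∧ α ++ γ ∈ L := by
  induction n with
  | zero => exact ⟨[], rfl, by simpa using h⟩
  | succ n ih =>
    obtain ⟨γ, hγ, h'⟩ := ih
    obtain ⟨a, ha⟩ := hL.extend h'
    exact ⟨γ ++ [a], by simp [hγ], by simpa using ha⟩

lemma IsQuasiAdditive.le_mul_length (hL : IsLanguage L) (hS : IsQuasiAdditive L S C c)
    {α : List A} (h : α ∈ L) : S α ≤ 2 * C * α.length := by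
  induction α using List.reverseRecOn with
  | nil => exact absurd h hL.nil_notMem
  | append_singleton α a ih =>
    have ha : [a] ∈ L := hL.of_append_right h (by simp)
    have h1 := abs_le.1 (hS.singleton ha)
    have hC := hS.nonneg
    rcases eq_or_ne α [] with rfl | hα
    · simp only [List.nil_append, List.length_singleton, Nat.cast_one]
      linarith [h1.2]
    · have h2 := abs_le.1 (hS.append h hα (by simp))
      have h3 := ih (hL.of_append_left h hα)
      push_cast [List.length_append, List.length_singleton]
      linarith [h1.2, h2.2]

/-- The last letter raises the weight by at most C for its own weight and C for the error of
additivity. A one-letter word has no proper prefix below r, but its weight is at most C. -/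
lemma firstPassage_le (hL : IsLanguage L) (hS : IsQuasiAdditive L S C c) {r : ℕ} {α : List A}
    (h : α ∈ firstPassage L S r) : S α ≤ r + 2 * C := by
  obtain ⟨hα, -, h2⟩ := h
  have hC := hS.nonneg
  obtain ⟨a, ha⟩ := exists_dropLast_append (hL.ne_nil hα)
  rcases eq_or_ne α.dropLast [] with h0 | h0
  · rw [h0, List.nil_append] at ha
    have := (abs_le.1 (hS.singleton (ha ▸ hα))).2
    rw [ha]
    have : (0 : ℝ) ≤ r := by positivity
    linarith
  · have h3 : 2 ≤ α.length := by
      have := List.length_pos_iff.2 h0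
      rw [List.length_dropLast] at this
      omega
    rw [ha] at hα
    have h4 := (abs_le.1 (hS.append hα h0 (by simp))).2
    have h5 := (abs_le.1 (hS.singleton (hL.of_append_right hα (by simp)))).2
    rw [← ha] at h4
    linarith [h2 h3]

lemma firstPassage_subset_window (hL : IsLanguage L) (hS : IsQuasiAdditive L S C c) (r : ℕ) :
    firstPassage L S r ⊆ window L S (2 * C) r := fun α h =>
  ⟨h.1, abs_le.2 ⟨by linarith [h.2.1, hS.nonneg], by linarith [firstPassage_le hL hS h]⟩⟩

/-- Letters are removed from the end until the next removal would drop the weight below r or only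
one letter is left. Since the weight need not be monotone, such a prefix need not be unique. -/
lemma exists_prefix_firstPassage (hL : IsLanguage L) {r : ℕ} (α : List A)
    (h : α ∈ L) (hr : (r : ℝ) ≤ S α) : ∃ β δ, α = β ++ δ ∧ β ∈ firstPassage L S r := by
  induction α using List.reverseRecOn with
  | nil => exact absurd h hL.nil_notMem
  | append_singleton α a ih =>
    by_cases h1 : α ++ [a] ∈ firstPassage L S r
    · exact ⟨_, [], by simp, h1⟩
    · have h2 : 2 ≤ (α ++ [a]).length ∧ (r : ℝ) ≤ S α := by
        by_contra! h2
        exact h1 ⟨h, hr, fun h3 => by simpa using h2 h3⟩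
      have hα : α ≠ [] := by
        rintro rfl
        simp at h2
      obtain ⟨β, δ, rfl, hβ⟩ := ih (hL.of_append_left h hα) h2.2
      exact ⟨β, δ ++ [a], by simp, hβ⟩

lemma firstPassage_nonempty (hL : IsLanguage L) (hS : IsQuasiAdditive L S C c)
    (hne : L.Nonempty) (r : ℕ) : (firstPassage L S r).Nonempty := by
  obtain ⟨α, hα⟩ := hne
  obtain ⟨n, hn⟩ := exists_nat_ge ((r + C) / c)
  obtain ⟨γ, hγ, h⟩ := hL.exists_extension hα n
  have h1 := hS.growth h
  rw [div_le_iff₀ hS.pos] at hn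
  have h2 : c * n ≤ c * ((α ++ γ).length : ℕ) := by
    have : n ≤ (α ++ γ).length := by simp [hγ]
    have := hS.pos
    gcongr
  obtain ⟨β, δ, -, hβ⟩ := exists_prefix_firstPassage hL (r := r) (S := S) _ h (by linarith)
  exact ⟨β, hβ⟩

lemma window_finite [Finite A] (hS : IsQuasiAdditive L S C c) (K r : ℝ) :
    (window L S K r).Finite := by
  obtain ⟨n, hn⟩ := exists_nat_ge ((r + K + C) / c)
  refine (List.finite_length_le A n).subset fun α hα => ?_
  have h1 := hS.growth hα.1
  have h2 := (abs_le.1 hα.2).2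
  rw [div_le_iff₀ hS.pos] at hn
  have : c * (α.length : ℝ) ≤ c * n := by linarith
  exact_mod_cast le_of_mul_le_mul_left this hS.pos

lemma firstPassage_finite [Finite A] (hL : IsLanguage L) (hS : IsQuasiAdditive L S C c) (r : ℕ) :
    (firstPassage L S r).Finite :=
  (window_finite hS _ _).subset (firstPassage_subset_window hL hS r)

/-- The number of words in a window is at most a constant times the number of first passages; the
constant does not depend on the language. -/
lemma exists_window_ncard_le (A : Type*) [Finite A] (C c K : ℝ) : ∃ E : ℕ, ∀ (L : Set (List A))
    (S : List A → ℝ), IsLanguage L → IsQuasiAdditive L S C c → ∀ r : ℕ,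
    (window L S K r).ncard ≤ (firstPassage L S r).ncard * E := by
  -- Any extension by l + 1 letters lifts a word of the window to weight at least r. The bound D
  -- then limits what remains after a prefix of weight at least r is cut off, since the extension
  -- has weight at most r + K + C + 2C(l + 1).
  obtain ⟨l, hl⟩ := exists_nat_ge ((K + 2 * C) / c)
  obtain ⟨D, hD⟩ := exists_nat_ge ((K + 3 * C + 2 * C * (l + 1 : ℕ)) / c)
  refine ⟨{δ : List A | δ.length ≤ D}.ncard, fun L S hL hS r => ?_⟩
  have hc := hS.pos
  have hC := hS.nonneg
  rw [div_le_iff₀ hc] at hl hD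
  -- The pair (β, δ) determines α: the word βδ is α followed by exactly l + 1 letters, which are cut
  -- off again. This makes the assignment injective.
  have key : ∀ α ∈ window L S K r, ∃ p : List A × List A,
      p ∈ firstPassage L S r ×ˢ {δ : List A | δ.length ≤ D} ∧
      α = (p.1 ++ p.2).take ((p.1 ++ p.2).length - (l + 1)) := by
    rintro α ⟨hα, hw⟩
    obtain ⟨γ, hγ, h⟩ := hL.exists_extension hα (l + 1)
    have hγ0 : γ ≠ [] := by
      rintro rfl
      simp at hγ
    have h1 := abs_le.1 (hS.append h (hL.ne_nil hα) hγ0)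
    have hγL := hL.of_append_right h hγ0
    have h2 := hS.growth hγL
    have h3 := hS.le_mul_length hL hγL
    have h4 := abs_le.1 hw
    rw [hγ] at h2 h3
    have h5 : (r : ℝ) ≤ S (α ++ γ) := by
      push_cast at h2
      nlinarith [h1.1, h4.1]
    obtain ⟨β, δ, hβδ, hβ⟩ := exists_prefix_firstPassage hL (S := S) _ h h5
    refine ⟨(β, δ), ⟨hβ, ?_⟩, ?_⟩
    · rcases eq_or_ne δ [] with rfl | hδ
      · simp
      rw [hβδ] at h
      have h6 := abs_le.1 (hS.append h (hL.ne_nil hβ.1) hδ)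
      have h7 := hS.growth (hL.of_append_right h hδ)
      rw [← hβδ] at h6
      have h8 := hβ.2.1
      have : c * (δ.length : ℝ) ≤ c * D := by linarith [h6.1, h1.2, h4.2]
      exact_mod_cast le_of_mul_le_mul_left this hc
    · dsimp only
      rw [← hβδ, ← hγ]
      simp
  choose! p hp hpα using key
  rw [← ncard_prod]
  refine ncard_le_ncard_of_injOn p hp (fun α hα β hβ hab => ?_)
    ((firstPassage_finite hL hS r).prod (List.finite_length_le A D))
  rw [hpα α hα, hpα β hβ, hab]

/-- A word is cut after a prefix that crosses the level n. The rest is empty, or quasi-additivity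
puts its weight within 5C of m, and such words are controlled by `exists_window_ncard_le`. -/
lemma exists_firstPassage_add_le (A : Type*) [Finite A] (C c : ℝ) : ∃ E : ℕ,
    ∀ (L : Set (List A)) (S : List A → ℝ), IsLanguage L → IsQuasiAdditive L S C c → ∀ n m : ℕ,
    (firstPassage L S (n + m)).ncard ≤
      E * (firstPassage L S n).ncard * (firstPassage L S m).ncard := by
  obtain ⟨E, hE⟩ := exists_window_ncard_le A C c (5 * C)
  -- The summand 1 pays for the empty remainder; it is absorbed because the count at level m is at
  -- least 1 for a nonempty language.
  refine ⟨E + 1, fun L S hL hS n m => ?_⟩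
  rcases L.eq_empty_or_nonempty with rfl | hne
  · simp [firstPassage]
  have hC := hS.nonneg
  have hpos : 1 ≤ (firstPassage L S m).ncard :=
    (ncard_pos (firstPassage_finite hL hS m)).2 (firstPassage_nonempty hL hS hne m)
  have hT : ({[]} ∪ window L S (5 * C) m).Finite :=
    (finite_singleton _).union (window_finite hS _ _)
  have key : ∀ α ∈ firstPassage L S (n + m), ∃ p : List A × List A,
      p ∈ firstPassage L S n ×ˢ ({[]} ∪ window L S (5 * C) m) ∧ α = p.1 ++ p.2 := by
    intro α hα
    have h1 := hα.2.1
    have h2 := firstPassage_le hL hS hα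
    push_cast at h1 h2
    obtain ⟨β, γ, rfl, hβ⟩ := exists_prefix_firstPassage hL (r := n) (S := S) α hα.1
      (le_trans (by simp) h1)
    refine ⟨(β, γ), ⟨hβ, ?_⟩, rfl⟩
    rcases eq_or_ne γ [] with rfl | hγ
    · left; rfl
    · right
      have h3 := abs_le.1 (hS.append hα.1 (hL.ne_nil hβ.1) hγ)
      have h4 := hβ.2.1
      have h5 := firstPassage_le hL hS hβ
      exact ⟨hL.of_append_right hα.1 hγ, abs_le.2 ⟨by linarith [h3.2], by linarith [h3.1]⟩⟩
  choose! p hp hpα using key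
  calc (firstPassage L S (n + m)).ncard
      ≤ (firstPassage L S n ×ˢ ({[]} ∪ window L S (5 * C) m)).ncard := by
        refine ncard_le_ncard_of_injOn p hp (fun α hα β hβ hab => ?_)
          ((firstPassage_finite hL hS n).prod hT)
        rw [hpα α hα, hpα β hβ, hab]
    _ = (firstPassage L S n).ncard * ({[]} ∪ window L S (5 * C) m).ncard := ncard_prod
    _ ≤ (firstPassage L S n).ncard * (1 + (firstPassage L S m).ncard * E) := by
        gcongr
        refine (ncard_union_le _ _).trans ?_
        rw [ncard_singleton]
        gcongr
        exact hE L S hL hS m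
    _ ≤ (firstPassage L S n).ncard *
          ((firstPassage L S m).ncard + (firstPassage L S m).ncard * E) := by gcongr
    _ = _ := by ring

end Words

/-! ### Growth rates of submultiplicative counts -/

lemma log_natCast_mono {a b : ℕ} (h : a ≤ b) : Real.log a ≤ Real.log b := by
  rcases Nat.eq_zero_or_pos a with rfl | ha
  · simpa using Real.log_natCast_nonneg b
  · exact Real.log_le_log (by exact_mod_cast ha) (by exact_mod_cast h)

lemma growthInf_bddBelow (B : ℕ) (N : ℕ → ℕ) :
    BddBelow (range fun m : ℕ+ => Real.log ((B * N m : ℕ) : ℝ) / (m : ℝ)) :=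
  ⟨0, by
    rintro _ ⟨m, rfl⟩
    have := Real.log_natCast_nonneg (B * N m)
    positivity⟩

/-- Fekete's lemma for the subadditive sequence log (B · N m); the contribution log B / m vanishes
in the limit. The dichotomy on N keeps the convention log 0 = 0 from interfering with the logarithm
of a product. -/
lemma tendsto_growthInf {B : ℕ} {N : ℕ → ℕ} (hB : 0 < B)
    (hN : (∀ m, N m = 0) ∨ ∀ m, 0 < N m) (h : ∀ n m, N (n + m) ≤ B * N n * N m) :
    Tendsto (fun m : ℕ => 1 / (m : ℝ) * Real.log (N m)) atTop (𝓝 (growthInf B N)) := by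
  rcases hN with hN | hN
  · simp [growthInf, hN]
  have hsub : Subadditive fun m : ℕ => Real.log ((B * N m : ℕ) : ℝ) := by
    intro n m
    rw [← Real.log_mul (by have := hN n; positivity) (by have := hN m; positivity), ← Nat.cast_mul]
    refine log_natCast_mono ?_
    calc B * N (n + m) ≤ B * (B * N n * N m) := by gcongr; exact h n m
      _ = _ := by ring
  have hb : BddBelow (range fun m : ℕ => Real.log ((B * N m : ℕ) : ℝ) / (m : ℝ)) :=
    ⟨0, by
      rintro _ ⟨m, rfl⟩
      have := Real.log_natCast_nonneg (B * N m)
      positivity⟩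
  have hlim : hsub.lim = growthInf B N := by
    unfold Subadditive.lim growthInf
    rw [iInf]
    congr 1
    ext x
    constructor
    · rintro ⟨m, hm, rfl⟩
      exact ⟨⟨m, hm⟩, rfl⟩
    · rintro ⟨m, rfl⟩
      exact ⟨m, m.2, rfl⟩
  have h1 := hsub.tendsto_lim hb
  rw [hlim] at h1
  have h2 : Tendsto (fun m : ℕ => Real.log B / (m : ℝ)) atTop (𝓝 0) :=
    tendsto_const_div_atTop_nhds_zero_nat _
  have h3 := h1.sub h2
  rw [sub_zero] at h3
  refine h3.congr fun m => ?_
  push_cast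
  rw [Real.log_mul (by positivity) (by have := hN m; positivity)]
  ring

/-- An infimum of upper semicontinuous functions is upper semicontinuous, and each log (B · N t m) /
m is one because N cannot jump up near t. -/
lemma upperSemicontinuous_growthInf (B : ℕ) (N : ℝ → ℕ → ℕ) (hN : ∀ t m, ∀ᶠ t' in 𝓝 t,
    N t' m ≤ N t m) : UpperSemicontinuous fun t => growthInf B (N t) := by
  refine upperSemicontinuous_ciInf (fun t => growthInf_bddBelow B (N t)) fun m t y hy => ?_
  filter_upwards [hN t m] with t' ht'
  refine lt_of_le_of_lt ?_ hy
  have := log_natCast_mono (Nat.mul_le_mul_left B ht')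
  gcongr

/-! ### Box-counting dimension from cylinder counts -/

/-- The covering number at scale δ is squeezed between the counts at the floor and at the ceiling of
log (1/δ). The rounding changes the quotient by a factor tending to 1, and the constant E
contributes log E / log (1/δ), which tends to 0. -/
lemma hasBoxDim_of_comparable {K : Set ℝ} {N : ℕ → ℕ} {E : ℕ} {D : ℝ} (hE : 0 < E)
    (hN : ∀ r, 0 < N r)
    (hlim : Tendsto (fun m : ℕ => 1 / (m : ℝ) * Real.log (N m)) atTop (𝓝 D))
    (hle : ∀ (r : ℕ) (δ : ℝ), Real.exp (-r) ≤ δ →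
      Metric.coveringNumber δ.toNNReal K ≤ (E * N r : ℕ))
    (hge : ∀ (r : ℕ) (δ : ℝ), 0 < δ → δ ≤ Real.exp (-r) →
      N r ≤ E * (Metric.coveringNumber δ.toNNReal K).toNat) : HasBoxDim K D := by
  set x : ℝ → ℝ := fun δ => Real.log (1 / δ) with hx
  have hxt : Tendsto x (𝓝[>] 0) atTop := by
    simp only [hx, one_div, Real.log_inv]
    exact tendsto_neg_atBot_atTop.comp Real.tendsto_log_nhdsGT_zero
  have hfl := (tendsto_nat_floor_div_atTop (R := ℝ)).comp hxt
  have hce := (tendsto_nat_ceil_div_atTop (R := ℝ)).comp hxt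
  have hflD := hlim.comp ((tendsto_nat_floor_atTop (α := ℝ)).comp hxt)
  have hceD := hlim.comp ((tendsto_nat_ceil_atTop (α := ℝ)).comp hxt)
  have hEx : Tendsto (fun δ => Real.log E / x δ) (𝓝[>] 0) (𝓝 0) := hxt.const_div_atTop _
  have hlo := (hflD.mul hfl).sub hEx
  have hhi := (hceD.mul hce).add hEx
  rw [mul_one, sub_zero] at hlo
  rw [mul_one, add_zero] at hhi
  have hev : ∀ᶠ δ : ℝ in 𝓝[>] 0, 0 < δ ∧ 1 < x δ :=
    eventually_mem_nhdsWithin.and (hxt.eventually_gt_atTop 1)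
  unfold HasBoxDim
  refine tendsto_of_tendsto_of_tendsto_of_le_of_le' hlo hhi ?_ ?_
  · filter_upwards [hev] with δ ⟨hδ, hδx⟩
    have h0 : (⌊x δ⌋₊ : ℝ) ≠ 0 := by
      have : 1 ≤ ⌊x δ⌋₊ := Nat.one_le_floor_iff _ |>.2 hδx.le
      positivity
    have hexp : δ ≤ Real.exp (-(⌊x δ⌋₊ : ℕ)) := by
      rw [← Real.log_le_iff_le_exp hδ]
      have : (⌊x δ⌋₊ : ℝ) ≤ x δ := Nat.floor_le (by linarith)
      simp only [hx, one_div, Real.log_inv] at this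
      simp only [hx, one_div, Real.log_inv]
      linarith
    have hge' := log_natCast_mono (hge _ δ hδ hexp)
    have hpos : 0 < E * (Metric.coveringNumber δ.toNNReal K).toNat :=
      (hN _).trans_le (hge _ δ hδ hexp)
    rw [Nat.cast_mul, Real.log_mul (by positivity)
      (by have := Nat.pos_of_mul_pos_left hpos; positivity)] at hge'
    simp only [Function.comp_apply]
    have : 0 < x δ := by linarith
    have heq : 1 / (⌊x δ⌋₊ : ℝ) * Real.log (N ⌊x δ⌋₊) * ((⌊x δ⌋₊ : ℝ) / x δ) - Real.log E / x δ
        = (Real.log (N ⌊x δ⌋₊) - Real.log E) / x δ := by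
      field_simp
    rw [heq]
    change _ ≤ _ / x δ
    gcongr
    linarith
  · filter_upwards [hev] with δ ⟨hδ, hδx⟩
    have h0 : (⌈x δ⌉₊ : ℝ) ≠ 0 := by
      have : 0 < ⌈x δ⌉₊ := Nat.ceil_pos.2 (by linarith)
      positivity
    have hexp : Real.exp (-(⌈x δ⌉₊ : ℕ)) ≤ δ := by
      rw [← Real.le_log_iff_exp_le hδ]
      have : x δ ≤ (⌈x δ⌉₊ : ℝ) := Nat.le_ceil _
      simp only [hx, one_div, Real.log_inv] at this
      simp only [hx, one_div, Real.log_inv]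
      linarith
    have hle' : (Metric.coveringNumber δ.toNNReal K).toNat ≤ E * N ⌈x δ⌉₊ :=
      ENat.toNat_le_of_le_natCast (hle _ δ hexp)
    have hle'' := log_natCast_mono hle'
    rw [Nat.cast_mul, Real.log_mul (by positivity) (by have := hN ⌈x δ⌉₊; positivity)] at hle''
    simp only [Function.comp_apply]
    have : 0 < x δ := by linarith
    have heq : 1 / (⌈x δ⌉₊ : ℝ) * Real.log (N ⌈x δ⌉₊) * ((⌈x δ⌉₊ : ℝ) / x δ) + Real.log E / x δ
        = (Real.log (N ⌈x δ⌉₊) + Real.log E) / x δ := by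
      field_simp
    rw [heq]
    change _ / x δ ≤ _
    gcongr
    linarith

/-! ### Intervals indexed by words, and covering numbers of the set they surround. -/

section Cylinders

variable {A : Type*}

/-- The intervals `cyl α`, `α ∈ L`, of length `exp (-S α)`, are nested or disjoint, meet `K`, and
arbitrarily long ones surround every point of `K`. -/
structure IsCylinderCover (L : Set (List A)) (S : List A → ℝ) (cyl : List A → Set ℝ)
    (K : Set ℝ) : Prop where
  interval : ∀ α ∈ L, ∃ p q : ℝ, cyl α = Icc p q ∧ q - p = Real.exp (-S α)
  meets : ∀ α ∈ L, (cyl α ∩ K).Nonempty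
  cover : ∀ x ∈ K, ∃ s : ℕ → List A, (∀ n, s n ∈ L ∧ x ∈ cyl (s n) ∧ (s n).length = n + 1) ∧
    ∀ n, ∃ a, s (n + 1) = s n ++ [a] ∨ s (n + 1) = [a] ++ s n
  nested : ∀ α ∈ L, ∀ β ∈ L, (cyl α ∩ cyl β).Nonempty → α.length ≤ β.length →
    (∃ γ, β = α ++ γ) ∨ ∃ γ, β = γ ++ α

variable {L : Set (List A)} {S : List A → ℝ} {C c : ℝ} {cyl : List A → Set ℝ} {K : Set ℝ}

/-- Along the words that surround a point of K, the first weight to reach r exceeds it by at most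
2C, and the cylinder then has length at most e^{-r}. The previous word may lack the first letter
instead of the last, so this word need not lie in `firstPassage`; the bound is therefore by a
window. The centres are chosen in K, as the covering number requires. -/
lemma IsCylinderCover.coveringNumber_le [Finite A] (h : IsCylinderCover L S cyl K)
    (hL : IsLanguage L) (hS : IsQuasiAdditive L S C c) {r : ℕ} {δ : ℝ} (hδ : Real.exp (-r) ≤ δ) :
    Metric.coveringNumber δ.toNNReal K ≤ (window L S (2 * C) r).ncard := by
  have hC := hS.nonneg
  set W := {α ∈ L | (r : ℝ) ≤ S α ∧ S α ≤ r + 2 * C} with hW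
  have hWw : W ⊆ window L S (2 * C) r := fun α hα =>
    ⟨hα.1, abs_le.2 ⟨by linarith [hα.2.1], by linarith [hα.2.2]⟩⟩
  have hpt : ∀ α ∈ W, ∃ x, x ∈ cyl α ∩ K := fun α hα => h.meets α hα.1
  choose! pt hpt using hpt
  have hcov : Metric.IsCover δ.toNNReal K (pt '' W) := by
    intro x hx
    obtain ⟨s, hs, hs'⟩ := h.cover x hx
    have hex : ∃ n, (r : ℝ) ≤ S (s n) := by
      obtain ⟨n, hn⟩ := exists_nat_ge ((r + C) / c)
      rw [div_le_iff₀ hS.pos] at hn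
      refine ⟨n, ?_⟩
      have h1 := hS.growth (hs n).1
      rw [(hs n).2.2] at h1
      push_cast at h1
      nlinarith [hS.pos]
    classical
    have hmem : s (Nat.find hex) ∈ W := by
      refine ⟨(hs _).1, Nat.find_spec hex, ?_⟩
      rcases Nat.eq_zero_or_pos (Nat.find hex) with h0 | h0
      · rw [h0]
        have := hS.le_mul_length hL (hs 0).1
        rw [(hs 0).2.2] at this
        have hr : (0 : ℝ) ≤ r := by positivity
        norm_num at this
        linarith
      · obtain ⟨k, hk⟩ : ∃ k, Nat.find hex = k + 1 := ⟨_, (Nat.succ_pred_eq_of_pos h0).symm⟩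
        have hlt : S (s k) < r := by
          have := Nat.find_min hex (m := k) (by omega)
          simpa using this
        obtain ⟨a, ha⟩ := hs' k
        have hk0 : s k ≠ [] := hL.ne_nil (hs k).1
        have hk1 := (hs (k + 1)).1
        rw [hk]
        rcases ha with ha | ha
        · rw [ha] at hk1 ⊢
          have h1 := abs_le.1 (hS.append hk1 hk0 (by simp))
          have h2 := abs_le.1 (hS.singleton (hL.of_append_right hk1 (by simp)))
          linarith [h1.2, h2.2]
        · rw [ha] at hk1 ⊢
          have h1 := abs_le.1 (hS.append hk1 (by simp) hk0)
          have h2 := abs_le.1 (hS.singleton (hL.of_append_left hk1 (by simp)))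
          linarith [h1.2, h2.2]
    refine ⟨_, mem_image_of_mem _ hmem, ?_⟩
    obtain ⟨p, q, hpq, hlen⟩ := h.interval _ hmem.1
    have h1 : x ∈ Icc p q := hpq ▸ (hs _).2.1
    have h2 : pt (s (Nat.find hex)) ∈ Icc p q := hpq ▸ (hpt _ hmem).1
    have h3 : Real.exp (-S (s (Nat.find hex))) ≤ Real.exp (-r) :=
      Real.exp_le_exp.2 (by linarith [hmem.2.1])
    change edist x _ ≤ _
    rw [edist_dist]
    exact ENNReal.ofReal_le_ofReal (by
      rw [Real.dist_eq, abs_le]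
      constructor <;> linarith [h1.1, h1.2, h2.1, h2.2])
  have hfin := window_finite hS (2 * C) r
  calc Metric.coveringNumber δ.toNNReal K ≤ (pt '' W).encard :=
        hcov.coveringNumber_le_encard (by
          rintro _ ⟨α, hα, rfl⟩
          exact (hpt α hα).2)
    _ ≤ W.encard := encard_image_le _ _
    _ ≤ (window L S (2 * C) r).encard := encard_le_encard hWw
    _ = (window L S (2 * C) r).ncard := hfin.cast_ncard_eq.symm

/-- Two such words are nested, so equal lengths force equality and it suffices to bound the spread
of the lengths. Both weights lie in [r, r + 2C]; hence the extra factor has weight at most 3C, and c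
times its length is at most 4C. -/
lemma IsCylinderCover.ncard_point_le [Finite A] (h : IsCylinderCover L S cyl K)
    (hL : IsLanguage L) (hS : IsQuasiAdditive L S C c) {T : ℕ} (hT : 4 * C ≤ c * T) (r : ℕ)
    (x : ℝ) : {α ∈ firstPassage L S r | x ∈ cyl α}.ncard ≤ T + 1 := by
  set F := {α ∈ firstPassage L S r | x ∈ cyl α} with hF
  rcases F.eq_empty_or_nonempty with h0 | hne
  · simp [h0]
  classical
  have hex : ∃ n, ∃ α ∈ F, α.length = n := by
    obtain ⟨α, hα⟩ := hne
    exact ⟨_, α, hα, rfl⟩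
  obtain ⟨α₀, hα₀, hlen⟩ := Nat.find_spec hex
  have hmin : ∀ α ∈ F, α₀.length ≤ α.length := fun α hα => by
    rw [hlen]; exact Nat.find_min' hex ⟨α, hα, rfl⟩
  have hmaps : ∀ α ∈ F, α.length ∈ Icc α₀.length (α₀.length + T) := by
    intro α hα
    refine ⟨hmin α hα, ?_⟩
    have key : ∀ γ : List A, γ ∈ L → |S α - S α₀ - S γ| ≤ C → γ.length ≤ T := by
      intro γ hγ h1
      have h1 := abs_le.1 h1
      have h2 := hS.growth hγ
      have h3 := firstPassage_le hL hS hα.1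
      have h4 := hα₀.1.2.1
      have : c * (γ.length : ℝ) ≤ c * T := by linarith [h1.1]
      exact_mod_cast le_of_mul_le_mul_left this hS.pos
    rcases h.nested α₀ hα₀.1.1 α hα.1.1 ⟨x, hα₀.2, hα.2⟩ (hmin α hα) with ⟨γ, hγ⟩ | ⟨γ, hγ⟩
    · rcases eq_or_ne γ [] with rfl | hγ0
      · simp [hγ]
      have hmem := hα.1.1
      rw [hγ] at hmem
      have := key γ (hL.of_append_right hmem hγ0)
        (by rw [hγ]; exact hS.append hmem (hL.ne_nil hα₀.1.1) hγ0)
      rw [hγ, List.length_append]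
      omega
    · rcases eq_or_ne γ [] with rfl | hγ0
      · simp [hγ]
      have hmem := hα.1.1
      rw [hγ] at hmem
      have h5 := hS.append hmem hγ0 (hL.ne_nil hα₀.1.1)
      have := key γ (hL.of_append_left hmem hγ0)
        (by rw [hγ]; convert h5 using 2; ring)
      rw [hγ, List.length_append]
      omega
  calc F.ncard ≤ (Icc α₀.length (α₀.length + T)).ncard := by
        refine ncard_le_ncard_of_injOn List.length hmaps (fun α hα β hβ hab => ?_) (finite_Icc _ _)
        rcases h.nested α hα.1.1 β hβ.1.1 ⟨x, hα.2, hβ.2⟩ hab.le with ⟨γ, hγ⟩ | ⟨γ, hγ⟩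
        · have := congrArg List.length hγ
          rw [List.length_append] at this
          rw [hγ, List.eq_nil_of_length_eq_zero (l := γ) (by omega), List.append_nil]
        · have := congrArg List.length hγ
          rw [List.length_append] at this
          rw [hγ, List.eq_nil_of_length_eq_zero (l := γ) (by omega), List.nil_append]
    _ = T + 1 := by
        rw [← Finset.coe_Icc, ncard_coe_finset, Nat.card_Icc]
        omega

/-- Every counted cylinder has length at least η = e^{-(r + 2C)} and comes within δ of a centre. It
therefore contains a point of a grid of mesh η with Q + 2 points around that centre, and a grid
point lies in at most T + 1 cylinders. -/
lemma IsCylinderCover.ncard_le_coveringNumber [Finite A] (h : IsCylinderCover L S cyl K)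
    (hL : IsLanguage L) (hS : IsQuasiAdditive L S C c) {T Q : ℕ} (hT : 4 * C ≤ c * T)
    (hQ : 2 * Real.exp (2 * C) ≤ Q) {r : ℕ} {δ : ℝ} (hδ0 : 0 < δ) (hδ : δ ≤ Real.exp (-r)) :
    (firstPassage L S r).ncard ≤
      (T + 1) * (Q + 2) * (Metric.coveringNumber δ.toNNReal K).toNat := by
  set η : ℝ := Real.exp (-(r + 2 * C)) with hη
  have hη0 : 0 < η := Real.exp_pos _
  have hfin := firstPassage_finite hL hS r
  have hctop : Metric.coveringNumber δ.toNNReal K ≠ ⊤ := by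
    obtain ⟨r', hr'⟩ := exists_nat_ge (-Real.log δ)
    have : Real.exp (-r') ≤ δ := by
      rw [← Real.le_log_iff_exp_le hδ0]; linarith
    exact ((h.coveringNumber_le hL hS this).trans_lt (ENat.natCast_lt_top _)).ne
  obtain ⟨Z, hZK, hZfin, hZcov, hZcard⟩ := Metric.exists_set_encard_eq_coveringNumber hctop
  have hZn : (Metric.coveringNumber δ.toNNReal K).toNat = Z.ncard := by
    rw [← hZcard]; rfl
  rw [hZn]
  -- every word of the family has a cylinder that contains a point of a grid around a centre
  have hgrid : firstPassage L S r ⊆ ⋃ z ∈ hZfin.toFinset, ⋃ k ∈ Finset.range (Q + 2),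
      {α ∈ firstPassage L S r | z - δ + ((k : ℝ) - 1) * η ∈ cyl α} := by
    intro α hα
    obtain ⟨x, hxα, hxK⟩ := h.meets α hα.1
    obtain ⟨z, hz, hxz⟩ := hZcov hxK
    obtain ⟨p, q, hpq, hlen⟩ := h.interval α hα.1
    have hlen' : η ≤ q - p := by
      rw [hlen]
      exact Real.exp_le_exp.2 (by linarith [firstPassage_le hL hS hα])
    have hxz' : |x - z| ≤ δ := by
      change edist x z ≤ _ at hxz
      rw [edist_dist, Real.dist_eq] at hxz
      exact (ENNReal.ofReal_le_ofReal_iff hδ0.le).1 hxz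
    rw [abs_le] at hxz'
    rw [hpq] at hxα
    have hδη : 2 * δ ≤ Q * η := by
      calc 2 * δ ≤ 2 * Real.exp (-r) := by linarith
        _ = 2 * Real.exp (2 * C) * η := by
          rw [hη, mul_assoc, ← Real.exp_add]; ring_nf
        _ ≤ Q * η := by gcongr
    simp only [mem_iUnion, Set.Finite.mem_toFinset, Finset.mem_range]
    -- the largest grid point below `max x (p + η)`
    obtain ⟨u, hu1, hu2, hu3, hu4⟩ : ∃ u, p + η ≤ u ∧ u ≤ q ∧ z - δ ≤ u ∧ u ≤ z + δ + η := by
      rcases le_total x (p + η) with h1 | h1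
      · exact ⟨p + η, le_rfl, by linarith, by linarith [hxz'.1], by linarith [hxα.1, hxz'.2]⟩
      · exact ⟨x, h1, hxα.2, by linarith [hxz'.1], by linarith [hxz'.2]⟩
    set y : ℝ := (u - (z - δ)) / η with hy
    have hy0 : 0 ≤ y := div_nonneg (by linarith) hη0.le
    have hyη : y * η = u - (z - δ) := div_mul_cancel₀ _ hη0.ne'
    have hf1 := Nat.floor_le hy0
    have hf2 := Nat.lt_floor_add_one y
    have hyQ : y ≤ Q + 1 := by
      rw [hy, div_le_iff₀ hη0]; linarith
    have hm1 := mul_le_mul_of_nonneg_right hf1 hη0.le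
    have hm2 := mul_le_mul_of_nonneg_right hf2.le hη0.le
    rcases Nat.lt_or_ge (⌊y⌋₊ + 1) (Q + 2) with hk | hk
    · refine ⟨z, hz, ⌊y⌋₊ + 1, hk, hα, ?_⟩
      rw [hpq]
      push_cast
      constructor
      · linarith
      · linarith
    -- Here u is one mesh beyond the last grid point. That grid point is u - η, still in the
    -- interval because p + η ≤ u.
    · have hQ1 : ⌊y⌋₊ = Q + 1 := by
        have : ⌊y⌋₊ ≤ Q + 1 := Nat.floor_le_of_le (by exact_mod_cast hyQ)
        omega
      have hyQ' : y = Q + 1 := le_antisymm hyQ (by rw [hQ1] at hf1; exact_mod_cast hf1)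
      refine ⟨z, hz, Q + 1, by omega, hα, ?_⟩
      rw [hpq]
      rw [hyQ'] at hyη
      push_cast
      constructor
      · linarith
      · linarith
  calc (firstPassage L S r).ncard
      ≤ (⋃ z ∈ hZfin.toFinset, ⋃ k ∈ Finset.range (Q + 2),
        {α ∈ firstPassage L S r | z - δ + ((k : ℝ) - 1) * η ∈ cyl α}).ncard := by
        refine ncard_le_ncard hgrid (hfin.subset ?_)
        intro α hα
        simp only [mem_iUnion] at hα
        obtain ⟨_, _, _, _, h1⟩ := hα
        exact h1.1
    _ ≤ ∑ z ∈ hZfin.toFinset, ∑ k ∈ Finset.range (Q + 2),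
        {α ∈ firstPassage L S r | z - δ + ((k : ℝ) - 1) * η ∈ cyl α}.ncard :=
        (Finset.set_ncard_biUnion_le _ _).trans
          (Finset.sum_le_sum fun z _ => Finset.set_ncard_biUnion_le _ _)
    _ ≤ ∑ z ∈ hZfin.toFinset, ∑ k ∈ Finset.range (Q + 2), (T + 1) :=
        Finset.sum_le_sum fun z _ => Finset.sum_le_sum fun k _ =>
          h.ncard_point_le hL hS hT r _
    _ = (T + 1) * (Q + 2) * Z.ncard := by
        simp only [Finset.sum_const, Finset.card_range, smul_eq_mul,
          ncard_eq_toFinset_card Z hZfin]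
        ring

lemma IsCylinderCover.hasBoxDim [Finite A] (h : IsCylinderCover L S cyl K)
    (hL : IsLanguage L) (hS : IsQuasiAdditive L S C c) {D : ℝ}
    (hlim : Tendsto (fun m : ℕ => 1 / (m : ℝ) * Real.log (firstPassage L S m).ncard)
      atTop (𝓝 D)) : HasBoxDim K D := by
  rcases L.eq_empty_or_nonempty with rfl | hne
  · have hK : K = ∅ := by
      rw [eq_empty_iff_forall_notMem]
      intro x hx
      obtain ⟨s, hs, -⟩ := h.cover x hx
      exact (hs 0).1
    -- All counts vanish and log 0 = 0, so the limit is 0, the value `HasBoxDim` gives for the empty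
    -- set.
    have h0 : D = 0 := by
      refine tendsto_nhds_unique hlim ?_
      simp [firstPassage]
    simp [HasBoxDim, hK, h0]
  · obtain ⟨E, hE⟩ := exists_window_ncard_le A C c (2 * C)
    obtain ⟨T, hT⟩ := exists_nat_ge (4 * C / c)
    obtain ⟨Q, hQ⟩ := exists_nat_ge (2 * Real.exp (2 * C))
    rw [div_le_iff₀' hS.pos] at hT
    refine hasBoxDim_of_comparable (E := E + (T + 1) * (Q + 2)) (by positivity)
      (fun r => (ncard_pos (firstPassage_finite hL hS r)).2 (firstPassage_nonempty hL hS hne r))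
      hlim (fun r δ hδ => (h.coveringNumber_le hL hS hδ).trans ?_) fun r δ hδ0 hδ => ?_
    · norm_cast
      refine (hE L S hL hS r).trans ?_
      rw [mul_comm]
      gcongr
      omega
    · refine (h.ncard_le_coveringNumber hL hS hT hQ hδ0 hδ).trans ?_
      gcongr
      omega

end Cylinders

/-! ### One-dimensional Markov maps -/

/-- A continuous injective function on an interval is strictly monotone, so the preimage of an
interval inside its range is an interval. This is how cylinders are pulled back along a branch. -/
lemma exists_preimage_eq_Icc {f : ℝ → ℝ} {p q e l : ℝ} (hpq : p ≤ q)
    (hf : ContinuousOn f (Icc p q)) (hi : InjOn f (Icc p q)) (hel : e < l)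
    (hsub : Icc e l ⊆ f '' Icc p q) :
    ∃ u v, u < v ∧ {x ∈ Icc p q | f x ∈ Icc e l} = Icc u v := by
  obtain ⟨x, hx, hxe⟩ := hsub (left_mem_Icc.2 hel.le)
  obtain ⟨y, hy, hyl⟩ := hsub (right_mem_Icc.2 hel.le)
  rcases hf.strictMonoOn_of_injOn_Icc' hpq hi with hm | hm
  · refine ⟨x, y, (hm.lt_iff_lt hx hy).1 (by rw [hxe, hyl]; exact hel), ?_⟩
    ext z
    constructor
    · rintro ⟨hz, h1, h2⟩
      exact ⟨(hm.le_iff_le hx hz).1 (hxe ▸ h1), (hm.le_iff_le hz hy).1 (hyl ▸ h2)⟩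
    · rintro ⟨h1, h2⟩
      have hz : z ∈ Icc p q := ⟨hx.1.trans h1, h2.trans hy.2⟩
      exact ⟨hz, hxe ▸ (hm.le_iff_le hx hz).2 h1, hyl ▸ (hm.le_iff_le hz hy).2 h2⟩
  · refine ⟨y, x, (hm.lt_iff_gt hx hy).1 (by rw [hxe, hyl]; exact hel), ?_⟩
    ext z
    constructor
    · rintro ⟨hz, h1, h2⟩
      exact ⟨(hm.le_iff_ge hz hy).1 (hyl ▸ h2), (hm.le_iff_ge hx hz).1 (hxe ▸ h1)⟩
    · rintro ⟨h1, h2⟩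
      have hz : z ∈ Icc p q := ⟨hy.1.trans h1, h2.trans hx.2⟩
      exact ⟨hz, hxe ▸ (hm.le_iff_ge hx hz).2 h2, hyl ▸ (hm.le_iff_ge hz hy).2 h1⟩

lemma abs_sub_eq_of_image_Icc {f : ℝ → ℝ} {p q e l : ℝ} (hpq : p ≤ q)
    (hf : ContinuousOn f (Icc p q)) (hi : InjOn f (Icc p q)) (hel : e ≤ l)
    (him : f '' Icc p q = Icc e l) : |f q - f p| = l - e := by
  have hp := left_mem_Icc.2 hpq
  have hq := right_mem_Icc.2 hpq
  obtain ⟨x, hx, hxe⟩ := him.ge (left_mem_Icc.2 hel)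
  obtain ⟨y, hy, hyl⟩ := him.ge (right_mem_Icc.2 hel)
  have hfp := him.le (mem_image_of_mem f hp)
  have hfq := him.le (mem_image_of_mem f hq)
  rcases hf.strictMonoOn_of_injOn_Icc' hpq hi with hm | hm
  · have h1 := hm.monotoneOn hp hx hx.1
    have h2 := hm.monotoneOn hy hq hy.2
    have h3 := hm.monotoneOn hp hq hpq
    rw [abs_of_nonneg (by linarith)]
    linarith [hfp.1, hfq.2]
  · have h1 := hm.antitoneOn hx hq hx.2
    have h2 := hm.antitoneOn hp hy hy.1
    have h3 := hm.antitoneOn hp hq hpq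
    rw [abs_of_nonpos (by linarith)]
    linarith [hfp.2, hfq.1]

/-- The mean value theorem; derivatives within the interval suffice because only interior points
need two-sided ones. -/
lemma exists_abs_sub_eq_mul {f f' : ℝ → ℝ} {p q x y : ℝ}
    (hf : ∀ z ∈ Icc p q, HasDerivWithinAt f (f' z) (Icc p q) z) (hx : x ∈ Icc p q)
    (hy : y ∈ Icc p q) (hxy : x < y) : ∃ z ∈ Icc p q, |f y - f x| = |f' z| * (y - x) := by
  have hsub : Icc x y ⊆ Icc p q := Icc_subset_Icc hx.1 hy.2
  obtain ⟨z, hz, h⟩ := exists_hasDerivAt_eq_slope f f' hxy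
    (fun z hz => (hf z (hsub hz)).continuousWithinAt.mono hsub)
    (fun z hz => (hf z (hsub (Ioo_subset_Icc_self hz))).hasDerivAt
      (Icc_mem_nhds (hx.1.trans_lt hz.1) (hz.2.trans_le hy.2)))
  refine ⟨z, hsub (Ioo_subset_Icc_self hz), ?_⟩
  have : 0 < y - x := by linarith
  rw [h, abs_div, abs_of_pos this]
  field_simp

lemma injOn_of_hasDerivWithinAt_ne_zero {f f' : ℝ → ℝ} {p q : ℝ}
    (hf : ∀ z ∈ Icc p q, HasDerivWithinAt f (f' z) (Icc p q) z)
    (h0 : ∀ z ∈ Icc p q, f' z ≠ 0) : InjOn f (Icc p q) := by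
  have key : ∀ x ∈ Icc p q, ∀ y ∈ Icc p q, x < y → f x ≠ f y := by
    intro x hx y hy hxy h
    obtain ⟨z, hz, h1⟩ := exists_abs_sub_eq_mul hf hx hy hxy
    rw [h, sub_self, abs_zero, eq_comm, mul_eq_zero, abs_eq_zero] at h1
    rcases h1 with h1 | h1
    · exact h0 z hz h1
    · linarith
  intro x hx y hy h
  by_contra hne
  rcases lt_or_gt_of_ne hne with h1 | h1
  · exact key x hx y hy h1 h
  · exact key y hy x hx h1 h.symm

/-- A finite family of intervals `[lo a, hi a]` with branches `map a b`, defined on subintervals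
`[left a b, right a b]` for the admissible pairs, and their derivatives `dmap a b`. -/
structure BranchedMap (A : Type*) where
  lo : A → ℝ
  hi : A → ℝ
  adm : A → A → Prop
  left : A → A → ℝ
  right : A → A → ℝ
  map : A → A → ℝ → ℝ
  dmap : A → A → ℝ → ℝ

namespace BranchedMap

variable {A : Type*} (X : BranchedMap A)

/-- The domain of a branch. -/
def dom (a b : A) : Set ℝ := Icc (X.left a b) (X.right a b)

/-- The points that can be mapped along the branches of a word. -/
def cyl : List A → Set ℝ
  | [] => univ
  | [a] => Icc (X.lo a) (X.hi a)
  | a :: b :: w => {x ∈ X.dom a b | X.map a b x ∈ cyl (b :: w)}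

/-- The composition of the branches along a word. -/
def comp : List A → ℝ → ℝ
  | [] => id
  | [_] => id
  | a :: b :: w => fun x => comp (b :: w) (X.map a b x)

/-- The derivative of the composition of the branches along a word. -/
def dcomp : List A → ℝ → ℝ
  | [] => fun _ => 1
  | [_] => fun _ => 1
  | a :: b :: w => fun x => dcomp (b :: w) (X.map a b x) * X.dmap a b x

/-- The branches are full, and of class `C^{1+ε}` with non-vanishing derivative. -/
structure IsMarkov (m H ε : ℝ) : Prop where
  lo_lt : ∀ a, X.lo a < X.hi a
  left_lt : ∀ {a b}, X.adm a b → X.left a b < X.right a b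
  dom_subset : ∀ {a b}, X.adm a b → X.dom a b ⊆ Icc (X.lo a) (X.hi a)
  disjoint_interval : Pairwise fun a b => Disjoint (Icc (X.lo a) (X.hi a)) (Icc (X.lo b) (X.hi b))
  disjoint_dom : ∀ {a b b'}, X.adm a b → X.adm a b' → b ≠ b' → Disjoint (X.dom a b) (X.dom a b')
  image : ∀ {a b}, X.adm a b → X.map a b '' X.dom a b = Icc (X.lo b) (X.hi b)
  hasDeriv : ∀ {a b}, X.adm a b → ∀ x ∈ X.dom a b,
    HasDerivWithinAt (X.map a b) (X.dmap a b x) (X.dom a b) x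
  pos : 0 < m
  nonneg : 0 ≤ H
  exponent_pos : 0 < ε
  le_dmap : ∀ {a b}, X.adm a b → ∀ x ∈ X.dom a b, m ≤ |X.dmap a b x|
  holder : ∀ {a b}, X.adm a b → ∀ x ∈ X.dom a b, ∀ y ∈ X.dom a b,
    |X.dmap a b x - X.dmap a b y| ≤ H * |x - y| ^ ε

/-- Exponential growth of the derivative along the infinite orbits. -/
def IsHyperbolic (κ ρ : ℝ) : Prop :=
  ∀ w : List A, w ≠ [] → w.IsChain X.adm → ∀ x ∈ X.cyl w,
    (∀ n, ∃ w' : List A, w'.IsChain X.adm ∧ w'.length = n + 1 ∧ x ∈ X.cyl w') →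
    κ * ρ ^ w.length ≤ |X.dcomp w x|

/-- The set of the non-empty admissible words. -/
def words : Set (List A) := {w | w ≠ [] ∧ w.IsChain X.adm}

/-- The logarithmic size of a cylinder. -/
noncomputable def weight (w : List A) : ℝ := Real.log (1 / Metric.diam (X.cyl w))

variable {X} {m H ε κ ρ : ℝ}

lemma cyl_append_subset (α β : List A) (hα : α ≠ []) (hX : X.IsMarkov m H ε)
    (h : (α ++ β).IsChain X.adm) : X.cyl (α ++ β) ⊆ X.cyl α := by
  induction α with
  | nil => exact absurd rfl hα
  | cons a α ih =>
    cases α with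
    | nil =>
      cases β with
      | nil => exact subset_rfl
      | cons b β =>
        intro x hx
        exact hX.dom_subset (List.isChain_cons_cons.1 h).1 hx.1
    | cons b α =>
      intro x hx
      exact ⟨hx.1, ih (by simp) (List.isChain_cons_cons.1 h).2 hx.2⟩

lemma IsMarkov.dmap_ne_zero (hX : X.IsMarkov m H ε) {a b : A} (h : X.adm a b) :
    ∀ x ∈ X.dom a b, X.dmap a b x ≠ 0 := fun x hx h0 => by
  have := hX.le_dmap h x hx
  rw [h0, abs_zero] at this
  exact absurd hX.pos this.not_gt

lemma IsMarkov.continuousOn_map (hX : X.IsMarkov m H ε) {a b : A} (h : X.adm a b) :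
    ContinuousOn (X.map a b) (X.dom a b) := fun x hx => (hX.hasDeriv h x hx).continuousWithinAt

lemma IsMarkov.continuousOn_dmap (hX : X.IsMarkov m H ε) {a b : A} (h : X.adm a b) :
    ContinuousOn (X.dmap a b) (X.dom a b) := by
  intro x hx
  rw [ContinuousWithinAt, tendsto_iff_dist_tendsto_zero]
  have h1 : Tendsto (fun y => H * |y - x| ^ ε) (𝓝[X.dom a b] x) (𝓝 (H * |x - x| ^ ε)) :=
    ((by fun_prop : Continuous fun y => |y - x|).tendsto x |>.rpow_const
      (Or.inr hX.exponent_pos.le)).const_mul H |>.mono_left nhdsWithin_le_nhds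
  rw [sub_self, abs_zero, Real.zero_rpow hX.exponent_pos.ne', mul_zero] at h1
  refine squeeze_zero' (Eventually.of_forall fun y => dist_nonneg) ?_ h1
  filter_upwards [self_mem_nhdsWithin] with y hy
  exact hX.holder h y hy x hx

lemma IsMarkov.injOn_map (hX : X.IsMarkov m H ε) {a b : A} (h : X.adm a b) :
    InjOn (X.map a b) (X.dom a b) :=
  injOn_of_hasDerivWithinAt_ne_zero (hX.hasDeriv h) (hX.dmap_ne_zero h)

lemma IsMarkov.exists_cyl_eq_Icc (hX : X.IsMarkov m H ε) {w : List A} (hw : w ∈ X.words) :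
    ∃ p q, p < q ∧ X.cyl w = Icc p q := by
  obtain ⟨h0, hw⟩ := hw
  induction w with
  | nil => exact absurd rfl h0
  | cons a w ih =>
    cases w with
    | nil => exact ⟨_, _, hX.lo_lt a, rfl⟩
    | cons b w =>
      obtain ⟨hab, hw⟩ := List.isChain_cons_cons.1 hw
      obtain ⟨p, q, hpq, h⟩ := ih (by simp) hw
      have hsub : Icc p q ⊆ X.map a b '' Icc (X.left a b) (X.right a b) := by
        rw [← h]
        refine (cyl_append_subset [b] w (by simp) hX hw).trans ?_
        exact (hX.image hab).ge
      obtain ⟨u, v, huv, h'⟩ := exists_preimage_eq_Icc (hX.left_lt hab).le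
        (hX.continuousOn_map hab) (hX.injOn_map hab) hpq hsub
      refine ⟨u, v, huv, ?_⟩
      rw [← h', ← h]
      rfl

lemma IsMarkov.isCompact_cyl (hX : X.IsMarkov m H ε) {w : List A} (hw : w ∈ X.words) :
    IsCompact (X.cyl w) := by
  obtain ⟨p, q, -, h⟩ := hX.exists_cyl_eq_Icc hw
  rw [h]
  exact isCompact_Icc

lemma IsMarkov.diam_pos (hX : X.IsMarkov m H ε) {w : List A} (hw : w ∈ X.words) :
    0 < Metric.diam (X.cyl w) := by
  obtain ⟨p, q, hpq, h⟩ := hX.exists_cyl_eq_Icc hw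
  rw [h, Real.diam_Icc hpq.le]
  linarith

lemma IsMarkov.hasDerivWithinAt_comp (hX : X.IsMarkov m H ε) (w : List A)
    (hw : w.IsChain X.adm) : ∀ x ∈ X.cyl w,
    HasDerivWithinAt (X.comp w) (X.dcomp w x) (X.cyl w) x := by
  induction w with
  | nil => exact fun x _ => hasDerivWithinAt_id _ _
  | cons a w ih =>
    cases w with
    | nil => exact fun x _ => hasDerivWithinAt_id _ _
    | cons b w =>
      obtain ⟨hab, hw⟩ := List.isChain_cons_cons.1 hw
      intro x hx
      exact (ih hw _ hx.2).comp x ((hX.hasDeriv hab x hx.1).mono fun y hy => hy.1)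
        fun y hy => hy.2

lemma IsMarkov.dcomp_ne_zero (hX : X.IsMarkov m H ε) (w : List A)
    (hw : w.IsChain X.adm) : ∀ x ∈ X.cyl w, X.dcomp w x ≠ 0 := by
  induction w with
  | nil => exact fun x _ => one_ne_zero
  | cons a w ih =>
    cases w with
    | nil => exact fun x _ => one_ne_zero
    | cons b w =>
      obtain ⟨hab, hw⟩ := List.isChain_cons_cons.1 hw
      exact fun x hx => mul_ne_zero (ih hw _ hx.2) (hX.dmap_ne_zero hab x hx.1)

lemma IsMarkov.continuousOn_dcomp (hX : X.IsMarkov m H ε) (w : List A)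
    (hw : w.IsChain X.adm) : ContinuousOn (X.dcomp w) (X.cyl w) := by
  induction w with
  | nil => exact continuousOn_const
  | cons a w ih =>
    cases w with
    | nil => exact continuousOn_const
    | cons b w =>
      obtain ⟨hab, hw⟩ := List.isChain_cons_cons.1 hw
      exact ((ih hw).comp ((hX.continuousOn_map hab).mono fun y hy => hy.1) fun y hy => hy.2).mul
        ((hX.continuousOn_dmap hab).mono fun y hy => hy.1)

/-- Fullness of the branches: every point of the target cylinder is hit at each step, so the
composition along αb carries the cylinder of αbγ onto all of that of bγ. -/
lemma IsMarkov.image_comp (hX : X.IsMarkov m H ε) (α : List A) (b : A) (γ : List A)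
    (hw : (α ++ b :: γ).IsChain X.adm) :
    X.comp (α ++ [b]) '' X.cyl (α ++ b :: γ) = X.cyl (b :: γ) := by
  induction α with
  | nil => exact image_id _
  | cons a α ih =>
    obtain ⟨b', β, hβ, hβ'⟩ : ∃ b' β, α ++ b :: γ = b' :: β ∧ ∃ β', α ++ [b] = b' :: β' := by
      cases α with
      | nil => exact ⟨b, γ, rfl, [], rfl⟩
      | cons b' α => exact ⟨b', _, rfl, _, rfl⟩
    obtain ⟨β', hβ'⟩ := hβ'
    rw [List.cons_append, hβ] at hw
    obtain ⟨hab, hw⟩ := List.isChain_cons_cons.1 hw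
    rw [← hβ] at hw
    rw [← ih hw]
    rw [List.cons_append, List.cons_append, hβ, hβ']
    ext y
    constructor
    · rintro ⟨x, hx, rfl⟩
      exact ⟨X.map a b' x, hx.2, rfl⟩
    · rintro ⟨z, hz, rfl⟩
      rw [hβ] at hw
      have hz' : z ∈ X.map a b' '' X.dom a b' := by
        rw [hX.image hab]
        exact cyl_append_subset [b'] β (by simp) hX hw hz
      obtain ⟨x, hx, rfl⟩ := hz'
      exact ⟨x, ⟨hx, hz⟩, rfl⟩

/-- The composition of branches stretches a cylinder by its derivative at some point. -/
lemma IsMarkov.exists_diam_eq (hX : X.IsMarkov m H ε) {α : List A} {b : A} {γ : List A}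
    (hw : (α ++ b :: γ).IsChain X.adm) : ∃ x ∈ X.cyl (α ++ b :: γ),
    Metric.diam (X.cyl (b :: γ)) =
      |X.dcomp (α ++ [b]) x| * Metric.diam (X.cyl (α ++ b :: γ)) := by
  obtain ⟨h1, h2⟩ := List.isChain_split.1 hw
  obtain ⟨p, q, hpq, h⟩ := hX.exists_cyl_eq_Icc (w := α ++ b :: γ) ⟨by simp, hw⟩
  obtain ⟨p', q', hpq', h'⟩ := hX.exists_cyl_eq_Icc (w := b :: γ) ⟨by simp, h2⟩
  have hsub : X.cyl (α ++ b :: γ) ⊆ X.cyl (α ++ [b]) := by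
    have := cyl_append_subset (α ++ [b]) γ (by simp) hX (by simpa using hw)
    simpa using this
  have him := hX.image_comp α b γ hw
  rw [h, h'] at him
  rw [h] at hsub
  have hd : ∀ z ∈ Icc p q, HasDerivWithinAt (X.comp (α ++ [b])) (X.dcomp (α ++ [b]) z)
      (Icc p q) z := fun z hz => (hX.hasDerivWithinAt_comp _ h1 z (hsub hz)).mono hsub
  have hinj := injOn_of_hasDerivWithinAt_ne_zero hd
    fun z hz => hX.dcomp_ne_zero _ h1 z (hsub hz)
  -- The injective composition maps the cylinder onto an interval, so the increment between the
  -- endpoints is the full length of the image.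
  obtain ⟨z, hz, hz'⟩ := exists_abs_sub_eq_mul hd (left_mem_Icc.2 hpq.le)
    (right_mem_Icc.2 hpq.le) hpq
  rw [abs_sub_eq_of_image_Icc hpq.le (fun z hz => (hd z hz).continuousWithinAt) hinj hpq'.le him]
    at hz'
  refine ⟨z, h ▸ hz, ?_⟩
  rw [h, h', Real.diam_Icc hpq.le, Real.diam_Icc hpq'.le, hz']

lemma IsMarkov.abs_sub_le_diam (hX : X.IsMarkov m H ε) {w : List A} (hw : w ∈ X.words)
    {x y : ℝ} (hx : x ∈ X.cyl w) (hy : y ∈ X.cyl w) : |x - y| ≤ Metric.diam (X.cyl w) :=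
  Metric.dist_le_diam_of_mem (hX.isCompact_cyl hw).isBounded hx hy

/-- Cylinders with a common point belong to comparable words. -/
lemma IsMarkov.exists_append_of_inter (hX : X.IsMarkov m H ε) (α β : List A)
    (hα : α.IsChain X.adm) (hβ : β.IsChain X.adm) (hl : α.length ≤ β.length) {x : ℝ}
    (hxα : x ∈ X.cyl α) (hxβ : x ∈ X.cyl β) : ∃ γ, β = α ++ γ := by
  induction α generalizing β x with
  | nil => exact ⟨β, rfl⟩
  | cons a α ih =>
    cases β with
    | nil => simp at hl
    | cons b β =>
      have ha : x ∈ Icc (X.lo a) (X.hi a) := cyl_append_subset [a] α (by simp) hX hα hxα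
      have hb : x ∈ Icc (X.lo b) (X.hi b) := cyl_append_subset [b] β (by simp) hX hβ hxβ
      obtain rfl : a = b := by
        by_contra hne
        exact (hX.disjoint_interval hne).le_bot ⟨ha, hb⟩
      cases α with
      | nil => exact ⟨β, rfl⟩
      | cons a' α =>
        cases β with
        | nil => simp at hl
        | cons b' β =>
          obtain ⟨h1, h2⟩ := List.isChain_cons_cons.1 hα
          obtain ⟨h3, h4⟩ := List.isChain_cons_cons.1 hβ
          obtain rfl : a' = b' := by
            by_contra hne
            exact (hX.disjoint_dom h1 h3 hne).le_bot ⟨hxα.1, hxβ.1⟩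
          obtain ⟨γ, hγ⟩ := ih _ h2 h4 (by simpa using hl) hxα.2 hxβ.2
          exact ⟨γ, by rw [hγ]; rfl⟩

/-- `IsHyperbolic` speaks only of points that can be iterated forever. A compactness argument passes
to all points of sufficiently deep cylinders: if expansion failed at every depth, some point would
fail at all depths, hence have an infinite orbit without expansion. -/
lemma IsMarkov.exists_expansion [Finite A] (hX : X.IsMarkov m H ε) (hκ : 0 < κ) (hρ : 1 < ρ)
    (hyp : X.IsHyperbolic κ ρ) : ∃ N n₀ : ℕ, 0 < N ∧ N < n₀ ∧ ∀ w : List A, w.IsChain X.adm →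
      n₀ ≤ w.length → ∀ x ∈ X.cyl w, 2 ≤ |X.dcomp (w.take (N + 1)) x| := by
  obtain ⟨N, hN⟩ := pow_unbounded_of_one_lt (2 / κ) hρ
  have hN2 : 2 < κ * ρ ^ (N + 2) := by
    rw [div_lt_iff₀' hκ] at hN
    refine hN.trans_le ?_
    gcongr
    · exact hρ.le
    · omega
  -- The points of depth N + 2 + n at which the first N + 1 branches expand by at most 2; these sets
  -- are compact and decrease with n.
  set T : ℕ → Set ℝ := fun n => ⋃ w ∈ {w : List A | w.length = N + 2 + n ∧ w.IsChain X.adm},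
    {x ∈ X.cyl w | |X.dcomp (w.take (N + 2)) x| ≤ 2} with hT
  have htake : ∀ (w : List A) (k : ℕ), w.IsChain X.adm → 0 < k → 0 < w.length →
      X.cyl w ⊆ X.cyl (w.take k) := by
    intro w k hw hk h0
    have h1 : w.take k ≠ [] := by
      intro h
      have := congrArg List.length h
      rw [List.length_take, List.length_nil] at this
      omega
    have := cyl_append_subset (w.take k) (w.drop k) h1 hX (by rwa [List.take_append_drop])
    rwa [List.take_append_drop] at this
  have hTc : ∀ n, IsCompact (T n) := by
    intro n
    refine Set.Finite.isCompact_biUnion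
      ((List.finite_length_eq A (N + 2 + n)).subset fun w hw => hw.1) fun w hw => ?_
    obtain ⟨hl, hw⟩ := hw
    have hne : w ∈ X.words := ⟨List.length_pos_iff.1 (by omega), hw⟩
    have hc := hX.isCompact_cyl hne
    have hcont : ContinuousOn (fun x => |X.dcomp (w.take (N + 2)) x|) (X.cyl w) :=
      ((hX.continuousOn_dcomp _ (hw.take _)).mono (htake w _ hw (by omega) (by omega))).abs
    exact hc.of_isClosed_subset (hcont.preimage_isClosed_of_isClosed hc.isClosed isClosed_Iic)
      fun x hx => hx.1
  have hTmono : ∀ n, T (n + 1) ⊆ T n := by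
    intro n x hx
    simp only [hT, mem_iUnion] at hx ⊢
    obtain ⟨w, ⟨hl, hw⟩, hxw, hx⟩ := hx
    refine ⟨w.take (N + 2 + n), ⟨by rw [List.length_take]; omega, hw.take _⟩,
      htake w _ hw (by omega) (by omega) hxw, ?_⟩
    rwa [List.take_take, min_eq_left (by omega)]
  have hempty : ∃ n, T n = ∅ := by
    by_contra! hne
    obtain ⟨x, hx⟩ := IsCompact.nonempty_iInter_of_sequence_nonempty_isCompact_isClosed T hTmono
      hne (hTc 0) fun n => (hTc n).isClosed
    rw [mem_iInter] at hx
    have h0 := hx 0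
    simp only [hT, mem_iUnion] at h0
    obtain ⟨w, ⟨hl, hw⟩, hxw, hx0⟩ := h0
    rw [List.take_of_length_le (by omega)] at hx0
    have := hyp w (by rintro rfl; simp at hl) hw x hxw fun n => by
      have hn := hx n
      simp only [hT, mem_iUnion] at hn
      obtain ⟨w', ⟨hl', hw'⟩, hxw', -⟩ := hn
      exact ⟨w'.take (n + 1), hw'.take _, by rw [List.length_take]; omega,
        htake w' _ hw' (by omega) (by omega) hxw'⟩
    rw [hl] at this
    simp only [add_zero] at this
    linarith
  obtain ⟨n, hn⟩ := hempty
  refine ⟨N + 1, N + 2 + n, by omega, by omega, fun w hw hl x hx => ?_⟩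
  by_contra! hlt
  have : x ∈ T n := by
    simp only [hT, mem_iUnion]
    refine ⟨w.take (N + 2 + n), ⟨by rw [List.length_take]; omega, hw.take _⟩,
      htake w _ hw (by omega) (by omega) hx, ?_⟩
    rw [List.take_take, min_eq_left (by omega)]
    exact hlt.le
  rw [hn] at this
  exact this

/-- The lengths of the cylinders decay exponentially. -/
lemma IsMarkov.exists_diam_le [Finite A] (hX : X.IsMarkov m H ε) (hκ : 0 < κ) (hρ : 1 < ρ)
    (hyp : X.IsHyperbolic κ ρ) : ∃ K θ : ℝ, 0 < K ∧ 0 < θ ∧ θ < 1 ∧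
      ∀ w ∈ X.words, Metric.diam (X.cyl w) ≤ K * θ ^ w.length := by
  obtain ⟨N, n₀, hN, hNn, h⟩ := hX.exists_expansion hκ hρ hyp
  obtain ⟨B, hB⟩ := (finite_range fun a => X.hi a - X.lo a).bddAbove
  have hB' : ∀ w ∈ X.words, Metric.diam (X.cyl w) ≤ max B 1 := by
    rintro w ⟨h0, hw⟩
    cases w with
    | nil => exact absurd rfl h0
    | cons a w =>
      have hsub : X.cyl (a :: w) ⊆ Icc (X.lo a) (X.hi a) :=
        cyl_append_subset [a] w (by simp) hX hw
      refine (Metric.diam_mono hsub (Metric.isBounded_Icc _ _)).trans ?_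
      rw [Real.diam_Icc (hX.lo_lt a).le]
      exact (hB ⟨a, rfl⟩).trans (le_max_left _ _)
  -- Removing N letters from the front of a word of length at least n₀ at least doubles the
  -- cylinder, which corresponds to θ^N = 1/2. Division by θ^{n₀} makes the bound hold for the
  -- shorter words, where the strong induction starts.
  set θ : ℝ := (1 / 2 : ℝ) ^ (1 / (N : ℝ)) with hθ
  have hθ0 : 0 < θ := by positivity
  have hθ1 : θ < 1 := Real.rpow_lt_one (by norm_num) (by norm_num) (by positivity)
  have hθN : θ ^ N = 1 / 2 := by
    rw [hθ, ← Real.rpow_natCast, ← Real.rpow_mul (by norm_num), one_div_mul_cancel (by positivity),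
      Real.rpow_one]
  have hK0 : 0 < max B 1 / θ ^ n₀ := by positivity
  refine ⟨max B 1 / θ ^ n₀, θ, hK0, hθ0, hθ1, ?_⟩
  intro w
  induction hn : w.length using Nat.strong_induction_on generalizing w with
  | _ n ih =>
    intro hw
    rcases Nat.lt_or_ge n n₀ with hlt | hge
    · refine (hB' w hw).trans ?_
      rw [div_mul_eq_mul_div, le_div_iff₀ (by positivity)]
      gcongr ?_ * ?_
      exact pow_le_pow_of_le_one hθ0.le hθ1.le hlt.le
    · obtain ⟨b, γ, hbγ⟩ : ∃ b γ, w.drop N = b :: γ := by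
        cases hd : w.drop N with
        | nil =>
          have := congrArg List.length hd
          rw [List.length_drop, List.length_nil] at this
          omega
        | cons b γ => exact ⟨b, γ, rfl⟩
      have hw' : w = w.take N ++ b :: γ := by rw [← hbγ, List.take_append_drop]
      have hlen : (b :: γ).length = n - N := by rw [← hbγ, List.length_drop, hn]
      have hch : (w.take N ++ b :: γ).IsChain X.adm := hw' ▸ hw.2
      obtain ⟨x, hx, hd⟩ := hX.exists_diam_eq hch
      have htake : w.take N ++ [b] = w.take (N + 1) := by
        have h1 : (w.take N).length = N := by rw [List.length_take]; omega
        conv_rhs => rw [hw']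
        rw [List.take_append, h1]
        simp
      rw [htake, ← hw'] at hd
      have h2 := h w hw.2 (hn ▸ hge) x (hw' ▸ hx)
      have h3 := ih (n - N) (by omega) (b :: γ) hlen ⟨by simp, (List.isChain_split.1 hch).2⟩
      have h4 := (hX.diam_pos hw).le
      have h5 : 2 * Metric.diam (X.cyl w) ≤ max B 1 / θ ^ n₀ * θ ^ (n - N) := by
        refine le_trans ?_ h3
        rw [hd]
        gcongr
      have h6 : θ ^ n = θ ^ (n - N) * (1 / 2) := by
        rw [← hθN, ← pow_add, Nat.sub_add_cancel (by omega)]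
      rw [h6]
      linarith

/-- Bounded distortion. -/
lemma IsMarkov.exists_distortion [Finite A] (hX : X.IsMarkov m H ε) (hκ : 0 < κ) (hρ : 1 < ρ)
    (hyp : X.IsHyperbolic κ ρ) : ∃ Q : ℝ, 0 ≤ Q ∧ ∀ w : List A, w.IsChain X.adm →
      ∀ x ∈ X.cyl w, ∀ y ∈ X.cyl w, |X.dcomp w x| ≤ Real.exp Q * |X.dcomp w y| := by
  obtain ⟨K, θ, hK, hθ0, hθ1, hdiam⟩ := hX.exists_diam_le hκ hρ hyp
  have hm := hX.pos
  have hH := hX.nonneg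
  set τ : ℝ := θ ^ ε with hτ
  have hτ0 : 0 < τ := by positivity
  have hτ1 : τ < 1 := Real.rpow_lt_one hθ0.le hθ1 hX.exponent_pos
  set q : ℕ → ℝ := fun n => H / m * K ^ ε * ∑ k ∈ Finset.range n, τ ^ k with hq
  -- The first branch of a word of length n sees two points at distance at most K θ^n, so its
  -- derivatives differ by a factor at most exp (H/m · K^ε · τ^n). The exponents for shorter and
  -- shorter tails add up to a partial geometric series.
  have key : ∀ w : List A, w.IsChain X.adm → ∀ x ∈ X.cyl w, ∀ y ∈ X.cyl w,
      |X.dcomp w x| ≤ Real.exp (q (w.length + 1)) * |X.dcomp w y| := by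
    have hq0 : ∀ n, 0 ≤ q n := fun n => by positivity
    intro w
    induction w with
    | nil => exact fun _ x _ y _ => by simpa [dcomp] using hq0 1
    | cons a w ih =>
      cases w with
      | nil => exact fun _ x _ y _ => by simpa [dcomp] using hq0 2
      | cons b w =>
        intro hw x hx y hy
        obtain ⟨hab, hw'⟩ := List.isChain_cons_cons.1 hw
        have h1 := ih hw' _ hx.2 _ hy.2
        set n := (a :: b :: w).length with hn
        have hn' : n = (b :: w).length + 1 := rfl
        rw [← hn'] at h1
        have hxy : |x - y| ^ ε ≤ K ^ ε * τ ^ n := by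
          have h2 := (hX.abs_sub_le_diam ⟨by simp, hw⟩ hx hy).trans (hdiam _ ⟨by simp, hw⟩)
          refine (Real.rpow_le_rpow (abs_nonneg _) h2 hX.exponent_pos.le).trans_eq ?_
          rw [Real.mul_rpow hK.le (by positivity), hτ, ← Real.rpow_natCast, ← Real.rpow_natCast,
            ← Real.rpow_mul hθ0.le, ← Real.rpow_mul hθ0.le, mul_comm ε]
        have h2 : |X.dmap a b x| ≤ Real.exp (H / m * K ^ ε * τ ^ n) * |X.dmap a b y| := by
          have h3 := hX.holder hab x hx.1 y hy.1
          have h4 := hX.le_dmap hab y hy.1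
          have h5 : |X.dmap a b x| ≤ |X.dmap a b y| + |X.dmap a b x - X.dmap a b y| := by
            have := abs_add_le (X.dmap a b y) (X.dmap a b x - X.dmap a b y)
            simpa using this
          have h6 : |X.dmap a b x - X.dmap a b y| ≤ H / m * K ^ ε * τ ^ n * |X.dmap a b y| := by
            calc |X.dmap a b x - X.dmap a b y| ≤ H * |x - y| ^ ε := h3
              _ ≤ H * (K ^ ε * τ ^ n) := by gcongr
              _ = H / m * K ^ ε * τ ^ n * m := by field_simp
              _ ≤ _ := by gcongr
          calc |X.dmap a b x| ≤ (H / m * K ^ ε * τ ^ n + 1) * |X.dmap a b y| := by linarith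
            _ ≤ _ := by gcongr; exact Real.add_one_le_exp _
        have hsum : q (n + 1) = q n + H / m * K ^ ε * τ ^ n := by
          simp only [hq, Finset.sum_range_succ]
          ring
        calc |X.dcomp (a :: b :: w) x|
            = |X.dcomp (b :: w) (X.map a b x)| * |X.dmap a b x| := abs_mul _ _
          _ ≤ (Real.exp (q n) * |X.dcomp (b :: w) (X.map a b y)|) *
              (Real.exp (H / m * K ^ ε * τ ^ n) * |X.dmap a b y|) := by gcongr
          _ = Real.exp (q (n + 1)) * |X.dcomp (a :: b :: w) y| := by
            rw [hsum, Real.exp_add]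
            change _ = _ * |_ * _|
            rw [abs_mul]
            ring
  refine ⟨H / m * K ^ ε * (1 - τ)⁻¹, ?_, fun w hw x hx y hy => (key w hw x hx y hy).trans ?_⟩
  · have : 0 < 1 - τ := by linarith
    positivity
  · gcongr
    simp only [hq]
    gcongr
    rw [← tsum_geometric_of_lt_one hτ0.le hτ1]
    exact (summable_geometric_of_lt_one hτ0.le hτ1).sum_le_tsum _ fun _ _ => by positivity

lemma abs_log_four_le {a b c d Q : ℝ} (ha : 0 < a) (hb : 0 < b) (hc : 0 < c) (hd : 0 < d)
    (h1 : a * b ≤ Real.exp Q * (c * d)) (h2 : c * d ≤ Real.exp Q * (a * b)) :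
    |Real.log (1 / a) + Real.log (1 / b) - Real.log (1 / c) - Real.log (1 / d)| ≤ Q := by
  have h1' := Real.log_le_log (by positivity) h1
  have h2' := Real.log_le_log (by positivity) h2
  rw [Real.log_mul (by positivity) (by positivity), Real.log_mul (by positivity) (by positivity),
    Real.log_exp, Real.log_mul (by positivity) (by positivity)] at h1' h2'
  simp only [one_div, Real.log_inv]
  rw [abs_le]
  constructor <;> linarith

/-- The weight of the cylinders is quasi-additive. -/
lemma IsMarkov.exists_isQuasiAdditive [Finite A] (hX : X.IsMarkov m H ε) (hκ : 0 < κ)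
    (hρ : 1 < ρ) (hyp : X.IsHyperbolic κ ρ) :
    ∃ C c : ℝ, IsQuasiAdditive X.words X.weight C c := by
  obtain ⟨Q, hQ, hdist⟩ := hX.exists_distortion hκ hρ hyp
  obtain ⟨K, θ, hK, hθ0, hθ1, hdiam⟩ := hX.exists_diam_le hκ hρ hyp
  obtain ⟨B, hB⟩ := (finite_range fun a : A => |X.weight [a]|).bddAbove
  obtain ⟨B', hB'⟩ := (finite_range fun p : A × A => |X.weight [p.1, p.2]|).bddAbove
  have hB1 : ∀ a, |X.weight [a]| ≤ B := fun a => hB ⟨a, rfl⟩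
  have hB2 : ∀ a b, |X.weight [a, b]| ≤ B' := fun a b => hB' ⟨(a, b), rfl⟩
  -- The same composition, along αb, carries the cylinder of αbγ onto that of bγ and the cylinder of
  -- αb onto that of b. By bounded distortion the two stretching factors agree up to e^Q, so the
  -- weight is additive for words glued along the common letter b.
  have hratio : ∀ (α : List A) (b : A) (γ : List A), (α ++ b :: γ).IsChain X.adm →
      |X.weight (b :: γ) + X.weight (α ++ [b]) - X.weight (α ++ b :: γ) - X.weight [b]| ≤ Q := by
    intro α b γ hw
    obtain ⟨h1, h2⟩ := List.isChain_split.1 hw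
    obtain ⟨x, hx, hx'⟩ := hX.exists_diam_eq hw
    obtain ⟨y, hy, hy'⟩ := hX.exists_diam_eq h1
    have hsub : X.cyl (α ++ b :: γ) ⊆ X.cyl (α ++ [b]) := by
      have := cyl_append_subset (α ++ [b]) γ (by simp) hX (by simpa using hw)
      simpa using this
    have hp1 := hX.diam_pos (w := b :: γ) ⟨by simp, h2⟩
    have hp2 := hX.diam_pos (w := α ++ [b]) ⟨by simp, h1⟩
    have hp3 := hX.diam_pos (w := α ++ b :: γ) ⟨by simp, hw⟩
    have hp4 := hX.diam_pos (w := [b]) ⟨by simp, by simp⟩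
    refine abs_log_four_le hp1 hp2 hp3 hp4 ?_ ?_
    · rw [hx', hy']
      calc _ ≤ Real.exp Q * |X.dcomp (α ++ [b]) y| * Metric.diam (X.cyl (α ++ b :: γ)) *
              Metric.diam (X.cyl (α ++ [b])) := by
            gcongr
            exact hdist _ h1 _ (hsub hx) _ hy
        _ = _ := by ring
    · rw [hx', hy']
      calc _ ≤ Metric.diam (X.cyl (α ++ b :: γ)) * ((Real.exp Q * |X.dcomp (α ++ [b]) x|) *
              Metric.diam (X.cyl (α ++ [b]))) := by
            gcongr
            exact hdist _ h1 _ hy _ (hsub hx)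
        _ = _ := by ring
  have hlogθ : 0 < -Real.log θ := by
    have := Real.log_neg hθ0 hθ1
    linarith
  refine ⟨2 * Q + 2 * |B| + |B'| + |Real.log K|, -Real.log θ, hlogθ, by positivity, ?_, ?_, ?_⟩
  · rintro α β ⟨-, hw⟩ hα hβ
    obtain ⟨b, γ, rfl⟩ := List.exists_cons_of_ne_nil hβ
    obtain ⟨a, ha⟩ := exists_dropLast_append hα
    have h1 := abs_le.1 (hratio α b γ hw)
    have hw' := (List.isChain_split.1 hw).1
    rw [ha] at hw'
    simp only [List.append_assoc, List.singleton_append] at hw'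
    -- A second gluing, along the last letter a of α, replaces the weight of αb by that of α. Only
    -- the weights of a, b and ab remain, and these are bounded since the alphabet is finite.
    have h2 := abs_le.1 (hratio α.dropLast a [b] hw')
    have h3 : α.dropLast ++ [a, b] = α ++ [b] := by
      conv_rhs => rw [ha]
      simp
    rw [← ha, h3] at h2
    have h4 := abs_le.1 (hB1 a)
    have h5 := abs_le.1 (hB1 b)
    have h6 := abs_le.1 (hB2 a b)
    have h7 := le_abs_self B
    have h8 := le_abs_self B'
    have h9 := abs_nonneg (Real.log K)
    rw [abs_le]
    constructor <;> linarith [h1.1, h1.2, h2.1, h2.2, h4.1, h4.2, h5.1, h5.2, h6.1, h6.2]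
  · intro a _
    have h7 := le_abs_self B
    have h8 := abs_nonneg B'
    have h9 := abs_nonneg (Real.log K)
    linarith [hB1 a, abs_nonneg B]
  · intro w hw
    have h1 := Real.log_le_log (hX.diam_pos hw) (hdiam w hw)
    rw [Real.log_mul hK.ne' (by positivity), Real.log_pow] at h1
    have h2 : X.weight w = -Real.log (Metric.diam (X.cyl w)) := by
      rw [weight, one_div, Real.log_inv]
    rw [h2]
    linarith [le_abs_self (Real.log K), abs_nonneg B, abs_nonneg B']

end BranchedMap

/-! ### Calculus of `C^{1+ε}` maps -/

lemma continuousAt_of_holder {E F : Type*} [NormedAddCommGroup E] [NormedAddCommGroup F] {ε : ℝ}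
    (hε : 0 < ε) {u : E → F} {p : E} {N : Set E} (hN : N ∈ 𝓝 p) {C : ℝ}
    (h : ∀ q ∈ N, ‖u q - u p‖ ≤ C * ‖q - p‖ ^ ε) : ContinuousAt u p := by
  rw [ContinuousAt, tendsto_iff_dist_tendsto_zero]
  have h1 : Tendsto (fun y => C * ‖y - p‖ ^ ε) (𝓝 p) (𝓝 (C * ‖p - p‖ ^ ε)) :=
    ((by fun_prop : Continuous fun y => ‖y - p‖).tendsto p |>.rpow_const
      (Or.inr hε.le)).const_mul C
  rw [sub_self, norm_zero, Real.zero_rpow hε.ne', mul_zero] at h1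
  refine squeeze_zero' (Eventually.of_forall fun y => dist_nonneg) ?_ h1
  filter_upwards [hN] with y hy
  rw [dist_eq_norm]
  exact h y hy

/-- On compact sets, local Hölder bounds are global. -/
lemma exists_holder_of_locally {E F : Type*} [NormedAddCommGroup E]
    [NormedAddCommGroup F] {ε : ℝ} {u : E → F} {K : Set E} (hK : IsCompact K) (hε : 0 < ε)
    (hu : ∀ p ∈ K, ∃ N ∈ 𝓝 p, ∃ C : ℝ, ∀ q ∈ N, ∀ q' ∈ N, ‖u q - u q'‖ ≤ C * ‖q - q'‖ ^ ε) :
    ∃ C ≥ 0, ∀ q ∈ K, ∀ q' ∈ K, ‖u q - u q'‖ ≤ C * ‖q - q'‖ ^ ε := by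
  have hb : ContinuousOn u K := fun p hp => by
    obtain ⟨N, hN, C, hC⟩ := hu p hp
    exact (continuousAt_of_holder hε hN fun q hq =>
      hC q hq p (mem_of_mem_nhds hN)).continuousWithinAt
  obtain ⟨B, hB⟩ := hK.exists_bound_of_continuousOn hb
  suffices h : ∃ C, 0 ≤ C ∧ ∀ z ∈ K ×ˢ K, ‖u z.1 - u z.2‖ ≤ C * ‖z.1 - z.2‖ ^ ε by
    obtain ⟨C, hC, h⟩ := h
    exact ⟨C, hC, fun q hq q' hq' => h (q, q') ⟨hq, hq'⟩⟩
  refine (hK.prod hK).induction_on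
    (p := fun Z => ∃ C, 0 ≤ C ∧ ∀ z ∈ Z, ‖u z.1 - u z.2‖ ≤ C * ‖z.1 - z.2‖ ^ ε)
    ⟨0, le_rfl, by simp⟩ ?_ ?_ ?_
  · rintro Z Z' hZ ⟨C, hC, h⟩
    exact ⟨C, hC, fun z hz => h z (hZ hz)⟩
  · rintro Z Z' ⟨C, hC, h⟩ ⟨C', hC', h'⟩
    refine ⟨max C C', le_max_of_le_left hC, ?_⟩
    rintro z (hz | hz)
    · exact (h z hz).trans (by gcongr; exact le_max_left _ _)
    · exact (h' z hz).trans (by gcongr; exact le_max_right _ _)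
  · rintro ⟨p, p'⟩ ⟨hp, hp'⟩
    -- Near the diagonal the local estimate applies. Away from it the distance is bounded below
    -- while u is bounded, so a large constant suffices.
    rcases eq_or_ne p p' with rfl | hne
    · obtain ⟨N, hN, C, hC⟩ := hu p hp
      refine ⟨N ×ˢ N, mem_nhdsWithin_of_mem_nhds (prod_mem_nhds hN hN), |C|, abs_nonneg _,
        fun z hz => (hC _ hz.1 _ hz.2).trans ?_⟩
      gcongr
      exact le_abs_self _
    · have hpos : 0 < ‖p - p'‖ / 2 := by
        have := norm_pos_iff.2 (sub_ne_zero.2 hne)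
        positivity
      have hcont : Continuous fun z : E × E => ‖z.1 - z.2‖ := by fun_prop
      have hev : {z : E × E | ‖p - p'‖ / 2 < ‖z.1 - z.2‖} ∈ 𝓝 (p, p') :=
        (isOpen_lt continuous_const hcont).mem_nhds (by
          change ‖p - p'‖ / 2 < ‖p - p'‖
          linarith)
      refine ⟨(K ×ˢ K) ∩ {z : E × E | ‖p - p'‖ / 2 < ‖z.1 - z.2‖},
        inter_mem self_mem_nhdsWithin (mem_nhdsWithin_of_mem_nhds hev),
        2 * |B| / (‖p - p'‖ / 2) ^ ε, by positivity, ?_⟩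
      rintro z ⟨⟨hz1, hz2⟩, hz⟩
      have h1 : ‖u z.1 - u z.2‖ ≤ 2 * |B| := by
        have := norm_sub_le (u z.1) (u z.2)
        linarith [hB _ hz1, hB _ hz2, le_abs_self B]
      refine h1.trans ?_
      rw [div_mul_eq_mul_div, le_div_iff₀ (by positivity)]
      gcongr
      exact le_of_lt hz

/-! ### Stability of the class `C^{1+ε}`. -/

section Holder

variable {E F G : Type*} [NormedAddCommGroup E] [NormedSpace ℝ E] [NormedAddCommGroup F]
  [NormedSpace ℝ F] [NormedAddCommGroup G] [NormedSpace ℝ G] {ε : ℝ}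

lemma C1HolderAt.differentiableAt {h : E → F} {p : E} (hh : C1HolderAt ε h p) :
    DifferentiableAt ℝ h p := by
  obtain ⟨N, hN, C, hd, -⟩ := hh
  exact hd p (mem_of_mem_nhds hN)

lemma C1HolderAt.congr {h k : E → F} {p : E} (hh : C1HolderAt ε h p) (hk : k =ᶠ[𝓝 p] h) :
    C1HolderAt ε k p := by
  obtain ⟨N, hN, C, hd, hC⟩ := hh
  obtain ⟨U, hU, hUo, hpU⟩ := eventually_nhds_iff.1 hk
  have hev : ∀ q ∈ U, k =ᶠ[𝓝 q] h := fun q hq => eventually_nhds_iff.2 ⟨U, hU, hUo, hq⟩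
  refine ⟨N ∩ U, inter_mem hN (hUo.mem_nhds hpU), C,
    fun q hq => (hd q hq.1).congr_of_eventuallyEq (hev q hq.2), fun q hq q' hq' => ?_⟩
  rw [(hev q hq.2).fderiv_eq, (hev q' hq'.2).fderiv_eq]
  exact hC q hq.1 q' hq'.1

/-- A `C^{1+ε}` map has a bounded derivative near each point. -/
lemma C1HolderAt.exists_ball {h : E → F} {p : E} (hε : 0 < ε) (hh : C1HolderAt ε h p) :
    ∃ δ > 0, ∃ C ≥ 0, ∃ B ≥ 0, (∀ q ∈ Metric.ball p δ, DifferentiableAt ℝ h q) ∧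
      (∀ q ∈ Metric.ball p δ, ∀ q' ∈ Metric.ball p δ,
        ‖fderiv ℝ h q - fderiv ℝ h q'‖ ≤ C * ‖q - q'‖ ^ ε) ∧
      (∀ q ∈ Metric.ball p δ, ‖fderiv ℝ h q‖ ≤ B) ∧
      ∀ q ∈ Metric.ball p δ, ∀ q' ∈ Metric.ball p δ, ‖h q - h q'‖ ≤ B * ‖q - q'‖ := by
  obtain ⟨N, hN, C, hd, hC⟩ := hh
  obtain ⟨δ, hδ, hball⟩ := Metric.mem_nhds_iff.1 hN
  have hsub : Metric.ball p (min δ 1) ⊆ N := (Metric.ball_subset_ball (min_le_left _ _)).trans hball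
  have hB : ∀ q ∈ Metric.ball p (min δ 1), ‖fderiv ℝ h q‖ ≤ ‖fderiv ℝ h p‖ + |C| := by
    intro q hq
    have h1 := hC q (hsub hq) p (mem_of_mem_nhds hN)
    have h2 : ‖q - p‖ ≤ 1 := by
      rw [← dist_eq_norm]
      exact (Metric.mem_ball.1 hq).le.trans (min_le_right _ _)
    have h3 : C * ‖q - p‖ ^ ε ≤ |C| := by
      calc C * ‖q - p‖ ^ ε ≤ |C| * 1 := by
            gcongr
            · exact le_abs_self _
            · exact Real.rpow_le_one (norm_nonneg _) h2 hε.le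
        _ = |C| := mul_one _
    have h4 := norm_sub_norm_le (fderiv ℝ h q) (fderiv ℝ h p)
    linarith
  refine ⟨min δ 1, by positivity, |C|, abs_nonneg _, ‖fderiv ℝ h p‖ + |C|, by positivity,
    fun q hq => hd q (hsub hq), fun q hq q' hq' => ?_, hB, fun q hq q' hq' => ?_⟩
  · refine (hC q (hsub hq) q' (hsub hq')).trans ?_
    gcongr
    exact le_abs_self _
  · exact (convex_ball p _).norm_image_sub_le_of_norm_fderiv_le (fun z hz => hd z (hsub hz))
      hB hq' hq

lemma C1HolderAt.mono {h : E → F} {p : E} {ε' : ℝ} (hε : 0 < ε) (hε' : 0 < ε') (hle : ε' ≤ ε)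
    (hh : C1HolderAt ε h p) : C1HolderAt ε' h p := by
  obtain ⟨δ, hδ, C, hC, B, -, hd, hH, -, -⟩ := hh.exists_ball hε
  have hsub : Metric.ball p (min δ (1 / 2)) ⊆ Metric.ball p δ :=
    Metric.ball_subset_ball (min_le_left _ _)
  refine ⟨Metric.ball p (min δ (1 / 2)), Metric.ball_mem_nhds p (by positivity), C,
    fun q hq => hd q (hsub hq), fun q hq q' hq' => (hH q (hsub hq) q' (hsub hq')).trans ?_⟩
  have h1 : ‖q - q'‖ ≤ 1 := by
    have := dist_triangle_right q q' p
    have h2 := (Metric.mem_ball.1 hq).trans_le (min_le_right _ _)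
    have h3 := (Metric.mem_ball.1 hq').trans_le (min_le_right _ _)
    rw [← dist_eq_norm]
    linarith
  gcongr ?_ * ?_
  exact Real.rpow_le_rpow_of_exponent_ge' (norm_nonneg _) h1 hε'.le hle

lemma C1HolderAt.comp {k : F → G} {h : E → F} {p : E} (hε : 0 < ε) (hk : C1HolderAt ε k (h p))
    (hh : C1HolderAt ε h p) : C1HolderAt ε (k ∘ h) p := by
  obtain ⟨δ₁, hδ₁, C₁, hC₁, B₁, hB₁, hd₁, hH₁, hb₁, hl₁⟩ := hh.exists_ball hε
  obtain ⟨δ₂, hδ₂, C₂, hC₂, B₂, hB₂, hd₂, hH₂, hb₂, -⟩ := hk.exists_ball hε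
  have hcont := hh.differentiableAt.continuousAt
  refine ⟨Metric.ball p δ₁ ∩ h ⁻¹' Metric.ball (h p) δ₂,
    inter_mem (Metric.ball_mem_nhds p hδ₁) (hcont (Metric.ball_mem_nhds _ hδ₂)),
    C₂ * B₁ ^ ε * B₁ + B₂ * C₁,
    fun q hq => (hd₂ _ hq.2).comp q (hd₁ q hq.1), fun q hq q' hq' => ?_⟩
  rw [fderiv_comp _ (hd₂ _ hq.2) (hd₁ _ hq.1), fderiv_comp _ (hd₂ _ hq'.2) (hd₁ _ hq'.1)]
  have hsplit : (fderiv ℝ k (h q)).comp (fderiv ℝ h q) - (fderiv ℝ k (h q')).comp (fderiv ℝ h q')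
      = (fderiv ℝ k (h q) - fderiv ℝ k (h q')).comp (fderiv ℝ h q)
        + (fderiv ℝ k (h q')).comp (fderiv ℝ h q - fderiv ℝ h q') := by
    ext v
    simp
  have h1 : ‖fderiv ℝ k (h q) - fderiv ℝ k (h q')‖ ≤ C₂ * B₁ ^ ε * ‖q - q'‖ ^ ε := by
    refine (hH₂ _ hq.2 _ hq'.2).trans ?_
    rw [mul_assoc, ← Real.mul_rpow hB₁ (norm_nonneg _)]
    gcongr
    exact hl₁ q hq.1 q' hq'.1
  rw [hsplit]
  calc _ ≤ ‖fderiv ℝ k (h q) - fderiv ℝ k (h q')‖ * ‖fderiv ℝ h q‖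
        + ‖fderiv ℝ k (h q')‖ * ‖fderiv ℝ h q - fderiv ℝ h q'‖ :=
        (norm_add_le _ _).trans (add_le_add (ContinuousLinearMap.opNorm_comp_le _ _)
          (ContinuousLinearMap.opNorm_comp_le _ _))
    _ ≤ C₂ * B₁ ^ ε * ‖q - q'‖ ^ ε * B₁ + B₂ * (C₁ * ‖q - q'‖ ^ ε) := by
        gcongr
        · exact hb₁ q hq.1
        · exact hb₂ _ hq'.2
        · exact hH₁ q hq.1 q' hq'.1
    _ = _ := by ring

lemma C1HolderAt.of_contDiffAt {h : E → F} {p : E} (hε : 0 < ε) (hε1 : ε ≤ 1)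
    (hh : ContDiffAt ℝ 2 h p) : C1HolderAt ε h p := by
  have h1 : ContDiffAt ℝ 1 (fderiv ℝ h) p := hh.fderiv_right (by norm_num)
  obtain ⟨K, N, hN, hK⟩ := h1.exists_lipschitzOnWith
  have h2 : ∀ᶠ q in 𝓝 p, DifferentiableAt ℝ h q :=
    (hh.eventually (by simp)).mono fun q hq => hq.differentiableAt (by simp)
  have h3 : C1HolderAt 1 h p := by
    refine ⟨N ∩ {q | DifferentiableAt ℝ h q}, inter_mem hN h2, K, fun q hq => hq.2,
      fun q hq q' hq' => ?_⟩
    rw [Real.rpow_one]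
    exact hK.norm_sub_le hq.1 hq'.1
  exact h3.mono one_pos hε hε1

lemma C1HolderAt.contDiffAt {h : E → F} {p : E} (hε : 0 < ε) (hh : C1HolderAt ε h p) :
    ContDiffAt ℝ 1 h p := by
  obtain ⟨δ, hδ, C, hC, B, -, hd, hH, -, -⟩ := hh.exists_ball hε
  rw [contDiffAt_one_iff]
  refine ⟨fderiv ℝ h, Metric.ball p δ, Metric.ball_mem_nhds p hδ, fun q hq => ?_,
    fun q hq => (hd q hq).hasFDerivAt⟩
  exact (continuousAt_of_holder hε (Metric.isOpen_ball.mem_nhds hq) fun y hy =>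
    hH y hy q hq).continuousWithinAt

end Holder

/-! ### Rectangles in the charts of the surface -/

section Swap

variable {M : Type*} [TopologicalSpace M] {Ψ : OpenPartialHomeomorph (ℝ × ℝ) M}

/-- Exchange of the two coordinates of a parametrization. -/
def swapParam (Ψ : OpenPartialHomeomorph (ℝ × ℝ) M) : OpenPartialHomeomorph (ℝ × ℝ) M :=
  (Homeomorph.prodComm ℝ ℝ).toOpenPartialHomeomorph.trans Ψ

@[simp] lemma swapParam_apply (p : ℝ × ℝ) : swapParam Ψ p = Ψ p.swap := rfl

@[simp] lemma swapParam_symm_apply (x : M) : (swapParam Ψ).symm x = (Ψ.symm x).swap := rfl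

lemma mem_swapParam_source {p : ℝ × ℝ} : p ∈ (swapParam Ψ).source ↔ p.swap ∈ Ψ.source := by
  simp [swapParam]

end Swap

section Charts

variable {M : Type*} [TopologicalSpace M] [ChartedSpace (EuclideanSpace ℝ (Fin 2)) M] {ε : ℝ}
  {Ψ Ψ' : OpenPartialHomeomorph (ℝ × ℝ) M}

lemma IsC1HolderDiffeo.mono {ε' : ℝ} (hε : 0 < ε) (hε' : 0 < ε') (hle : ε' ≤ ε)
    (h : IsC1HolderDiffeo ε Ψ) : IsC1HolderDiffeo ε' Ψ := fun p hp =>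
  ⟨(h p hp).1.mono hε hε' hle, (h p hp).2.mono hε hε' hle⟩

lemma IsC1HolderDiffeo.contMDiffAt (hε : 0 < ε) (h : IsC1HolderDiffeo ε Ψ) {p : ℝ × ℝ}
    (hp : p ∈ Ψ.source) : ContMDiffAt 𝓘(ℝ, ℝ × ℝ) (𝓡 2) 1 Ψ p := by
  rw [contMDiffAt_iff]
  refine ⟨Ψ.continuousAt hp, ?_⟩
  have := ((h p hp).1.contDiffAt hε).contDiffWithinAt (s := univ)
  simpa [Function.comp_def, chartAt_self_eq] using this

lemma IsC1HolderDiffeo.contMDiffAt_symm (hε : 0 < ε) (h : IsC1HolderDiffeo ε Ψ) {x : M}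
    (hx : x ∈ Ψ.target) : ContMDiffAt (𝓡 2) 𝓘(ℝ, ℝ × ℝ) 1 Ψ.symm x := by
  rw [contMDiffAt_iff]
  refine ⟨Ψ.symm.continuousAt hx, ?_⟩
  have := ((h _ (Ψ.map_target hx)).2.contDiffAt hε).contDiffWithinAt (s := univ)
  rw [Ψ.right_inv hx] at this
  simpa [Function.comp_def, chartAt_self_eq] using this

/-- The charts at Ψ p and at φ (Ψ p) are inserted: the outer factors are the given `C^{1+ε}`
coordinates, and the middle one is `C^2`, hence `C^{1+ε}` for ε ≤ 1. -/
lemma IsC1HolderDiffeo.transition (hε : 0 < ε) (hε1 : ε ≤ 1) (h : IsC1HolderDiffeo ε Ψ)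
    (h' : IsC1HolderDiffeo ε Ψ') (φ : M ≃ₘ^2⟮𝓡 2, 𝓡 2⟯ M) {p : ℝ × ℝ} (hp : p ∈ Ψ.source)
    (hp' : φ (Ψ p) ∈ Ψ'.target) : C1HolderAt ε (fun q => Ψ'.symm (φ (Ψ q))) p := by
  have h1 := (h p hp).1
  have h3 := (h' _ (Ψ'.map_target hp')).2
  rw [Ψ'.right_inv hp'] at h3
  have h2 : C1HolderAt ε (fun w => extChartAt (𝓡 2) (φ (Ψ p))
      (φ ((extChartAt (𝓡 2) (Ψ p)).symm w))) (extChartAt (𝓡 2) (Ψ p) (Ψ p)) := by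
    refine C1HolderAt.of_contDiffAt hε hε1 ?_
    have := (contMDiffAt_iff.1 (φ.contMDiff (Ψ p))).2
    simpa [Function.comp_def, contDiffWithinAt_univ] using this
  have hinv : (extChartAt (𝓡 2) (Ψ p)).symm (extChartAt (𝓡 2) (Ψ p) (Ψ p)) = Ψ p :=
    extChartAt_to_inv (I := 𝓡 2) (Ψ p)
  have hcomp := (C1HolderAt.comp hε (h := fun w => extChartAt (𝓡 2) (φ (Ψ p))
      (φ ((extChartAt (𝓡 2) (Ψ p)).symm w))) (p := extChartAt (𝓡 2) (Ψ p) (Ψ p))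
      (by simpa only [hinv] using h3) h2).comp hε (h := fun q => extChartAt (𝓡 2) (Ψ p) (Ψ q))
      (p := p) h1
  refine hcomp.congr ?_
  have hc := Ψ.continuousAt hp
  have e1 : ∀ᶠ q in 𝓝 p, Ψ q ∈ (extChartAt (𝓡 2) (Ψ p)).source :=
    hc (extChartAt_source_mem_nhds (I := 𝓡 2) (Ψ p))
  have e2 : ∀ᶠ q in 𝓝 p, φ (Ψ q) ∈ (extChartAt (𝓡 2) (φ (Ψ p))).source :=
    (φ.continuous.continuousAt.comp hc) (extChartAt_source_mem_nhds (I := 𝓡 2) (φ (Ψ p)))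
  filter_upwards [e1, e2] with q hq1 hq2
  simp only [Function.comp_apply]
  rw [(extChartAt (𝓡 2) (Ψ p)).left_inv hq1, (extChartAt (𝓡 2) (φ (Ψ p))).left_inv hq2]

lemma IsC1HolderDiffeo.swap (hε : 0 < ε) (h : IsC1HolderDiffeo ε Ψ) :
    IsC1HolderDiffeo ε (swapParam Ψ) := by
  have hs : ∀ p : ℝ × ℝ, C1HolderAt ε (Prod.swap : ℝ × ℝ → ℝ × ℝ) p := by
    intro p
    have hf : ∀ q, HasFDerivAt (Prod.swap : ℝ × ℝ → ℝ × ℝ)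
        (ContinuousLinearEquiv.prodComm ℝ ℝ ℝ : ℝ × ℝ →L[ℝ] ℝ × ℝ) q := fun q =>
      (ContinuousLinearEquiv.prodComm ℝ ℝ ℝ).hasFDerivAt
    refine ⟨univ, univ_mem, 0, fun q _ => (hf q).differentiableAt, fun q _ q' _ => ?_⟩
    rw [(hf q).fderiv, (hf q').fderiv]
    simp
  intro p hp
  rw [mem_swapParam_source] at hp
  obtain ⟨h1, h2⟩ := h _ hp
  exact ⟨C1HolderAt.comp hε (h := Prod.swap) h1 (hs p), C1HolderAt.comp hε (k := Prod.swap) (hs _) h2⟩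

end Charts

/-! ### Itineraries -/

section Follows

variable {M A : Type*}

/-- The points whose orbit under `ψ` runs through the sets `R a` along the letters of a word. -/
def Follows (ψ : M → M) (R : A → Set M) : List A → M → Prop
  | [], _ => True
  | a :: w, x => x ∈ R a ∧ Follows ψ R w (ψ x)

variable {ψ : M → M} {R : A → Set M}

lemma follows_append (α β : List A) (x : M) :
    Follows ψ R (α ++ β) x ↔ Follows ψ R α x ∧ Follows ψ R β (ψ^[α.length] x) := by
  induction α generalizing x with
  | nil => simp [Follows]
  | cons a α ih => simp [Follows, ih, and_assoc]

/-- The reversed word is read from the last visited point, which is `length - 1` steps away. For the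
empty word the truncated subtraction is harmless. -/
lemma Follows.reverse {ψ' : M → M} (h : Function.LeftInverse ψ' ψ) (w : List A) (x : M)
    (hw : Follows ψ R w x) : Follows ψ' R w.reverse (ψ^[w.length - 1] x) := by
  induction w generalizing x with
  | nil => trivial
  | cons a w ih =>
    rw [List.reverse_cons, follows_append]
    have h1 : ψ'^[w.reverse.length] (ψ^[(a :: w).length - 1] x) = x := by
      simpa using h.iterate w.length x
    refine ⟨?_, ?_⟩
    · cases w with
      | nil => trivial
      | cons b w => exact ih (ψ x) hw.2
    · rw [h1]
      exact ⟨hw.1, trivial⟩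

lemma exists_follows {S : Set M} (hS : S ⊆ ⋃ a, R a) (hψ : ∀ x ∈ S, ψ x ∈ S) {x : M}
    (hx : x ∈ S) : ∃ s : ℕ → List A, (∀ n, Follows ψ R (s n) x ∧ (s n).length = n + 1) ∧
      ∀ n, ∃ a, s (n + 1) = s n ++ [a] := by
  have hit : ∀ n, ψ^[n] x ∈ S := fun n => by
    induction n with
    | zero => exact hx
    | succ n ih => rw [Function.iterate_succ_apply']; exact hψ _ ih
  choose l hl using fun n => mem_iUnion.1 (hS (hit n))
  refine ⟨fun n => (List.range (n + 1)).map l, fun n => ⟨?_, by simp⟩, fun n => ⟨l (n + 1), ?_⟩⟩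
  · induction n with
    | zero => exact ⟨by simpa using hl 0, trivial⟩
    | succ n ih =>
      change Follows ψ R ((List.range (n + 1 + 1)).map l) x
      rw [List.range_succ, List.map_append, follows_append]
      exact ⟨ih, by simpa using hl (n + 1), trivial⟩
  · change (List.range (n + 1 + 1)).map l = _
    rw [List.range_succ, List.map_append]
    rfl

end Follows

/-! ### Integer iterates of the diffeomorphism and of its inverse. -/

section Iter

variable {M : Type*} [TopologicalSpace M] [ChartedSpace (EuclideanSpace ℝ (Fin 2)) M]
  (φ : M ≃ₘ^2⟮𝓡 2, 𝓡 2⟯ M)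

lemma iter_natCast (n : ℕ) : iter φ n = φ^[n] := by
  rw [iter, zpow_natCast]
  exact (Equiv.Perm.iterate_eq_pow _ n).symm

lemma iter_symm (n : ℤ) : iter φ.symm n = iter φ (-n) := by
  unfold iter
  rw [zpow_neg, ← inv_zpow]
  rfl

lemma iter_neg_natCast (n : ℕ) : iter φ (-(n : ℤ)) = φ.symm^[n] := by
  rw [← iter_symm, iter_natCast]

lemma iter_add (m n : ℤ) (x : M) : iter φ (m + n) x = iter φ m (iter φ n x) := by
  rw [iter, zpow_add]
  rfl

lemma iter_one (x : M) : iter φ 1 x = φ x := by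
  rw [iter, zpow_one]
  rfl

lemma forall_iter_symm {p : M → Prop} {x : M} :
    (∀ n : ℤ, p (iter φ.symm n x)) ↔ ∀ n : ℤ, p (iter φ n x) := by
  simp only [iter_symm]
  exact ⟨fun h n => by simpa using h (-n), fun h n => h (-n)⟩

lemma forall_iter_apply {p : M → Prop} {x : M} (h : ∀ n : ℤ, p (iter φ n x)) (n : ℤ) :
    p (iter φ n (φ x)) := by
  rw [← iter_one φ x, ← iter_add]
  exact h _

lemma continuous_iter (n : ℤ) : Continuous (iter φ n) := by
  obtain ⟨k, rfl | rfl⟩ := n.eq_nat_or_neg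
  · rw [iter_natCast]
    exact φ.continuous.iterate k
  · rw [iter_neg_natCast]
    exact φ.symm.continuous.iterate k

end Iter

/-! ### Exchange of the stable and the unstable direction -/

section Swap

variable {M : Type*} [TopologicalSpace M] {A : Type*}

/-- The same rectangles with exchanged coordinates. -/
def RectangleFamily.swap (P : RectangleFamily M A) : RectangleFamily M A where
  param a := swapParam (P.param a)
  sLo := P.uLo
  sHi := P.uHi
  uLo := P.sLo
  uHi := P.sHi
  s_lt := P.u_lt
  u_lt := P.s_lt
  box_subset a _ hp := mem_swapParam_source.2 (P.box_subset a ⟨hp.2, hp.1⟩)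

lemma image_swapParam (Ψ : OpenPartialHomeomorph (ℝ × ℝ) M) (s t : Set ℝ) :
    swapParam Ψ '' (s ×ˢ t) = Ψ '' (t ×ˢ s) := by
  ext x
  constructor
  · rintro ⟨p, hp, rfl⟩
    exact ⟨p.swap, ⟨hp.2, hp.1⟩, rfl⟩
  · rintro ⟨p, hp, rfl⟩
    exact ⟨p.swap, ⟨hp.2, hp.1⟩, by simp⟩

@[simp] lemma RectangleFamily.swap_R (P : RectangleFamily M A) (a : A) : P.swap.R a = P.R a :=
  image_swapParam _ _ _

lemma RectangleFamily.swap_R_eq (P : RectangleFamily M A) : P.swap.R = P.R :=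
  funext P.swap_R

variable [ChartedSpace (EuclideanSpace ℝ (Fin 2)) M] {φ : M ≃ₘ^2⟮𝓡 2, 𝓡 2⟯ M}
  {P : RectangleFamily M A}

lemma image_symm_eq (s : Set M) : φ.symm '' s = φ ⁻¹' s :=
  φ.toEquiv.symm.image_eq_preimage_symm s

lemma preimage_symm_eq (s : Set M) : φ.symm ⁻¹' s = φ '' s :=
  (φ.toEquiv.image_eq_preimage_symm s).symm

lemma admissible_symm_swap {a b : A} : Admissible φ.symm P.swap a b ↔ Admissible φ P b a := by
  simp only [Admissible, RectangleFamily.swap_R]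
  constructor
  · rintro ⟨_, ⟨x, hx, rfl⟩, h⟩
    exact ⟨x, ⟨_, h, φ.apply_symm_apply x⟩, hx⟩
  · rintro ⟨_, ⟨x, hx, rfl⟩, h⟩
    exact ⟨x, ⟨_, h, φ.symm_apply_apply x⟩, hx⟩

lemma mfderiv_swapParam {ε : ℝ} (hε : 0 < ε) {Ψ : OpenPartialHomeomorph (ℝ × ℝ) M}
    (h : IsC1HolderDiffeo ε Ψ) {p : ℝ × ℝ} (hp : p.swap ∈ Ψ.source) (v : ℝ × ℝ) :
    mfderiv 𝓘(ℝ, ℝ × ℝ) (𝓡 2) (swapParam Ψ) p v =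
      mfderiv 𝓘(ℝ, ℝ × ℝ) (𝓡 2) Ψ p.swap v.swap := by
  have hf : HasFDerivAt (Prod.swap : ℝ × ℝ → ℝ × ℝ)
      (ContinuousLinearEquiv.prodComm ℝ ℝ ℝ : ℝ × ℝ →L[ℝ] ℝ × ℝ) p :=
    (ContinuousLinearEquiv.prodComm ℝ ℝ ℝ).hasFDerivAt
  have h1 := (h.contMDiffAt hε hp).mdifferentiableAt one_ne_zero
  have h2 := h1.hasMFDerivAt.comp p hf.hasMFDerivAt
  rw [show (swapParam Ψ : ℝ × ℝ → M) = Ψ ∘ Prod.swap from rfl, h2.mfderiv]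
  rfl

/-- The definition is symmetric under time reversal combined with exchange of coordinates, so each
result about g_u for φ becomes one about g_s when applied to the inverse. -/
lemma IsMarkovPartition.swap {Λ : Set M} {Es Eu : ∀ x : M, Submodule ℝ (TangentSpace (𝓡 2) x)}
    (hP : IsMarkovPartition φ Λ Es Eu P) : IsMarkovPartition φ.symm Λ Eu Es P.swap := by
  obtain ⟨ε, hε, hreg⟩ := hP.regular
  have hsrc : ∀ a, ∀ p ∈ P.swap.Is a ×ˢ P.swap.Iu a, p.swap ∈ P.Is a ×ˢ P.Iu a :=
    fun a p hp => ⟨hp.2, hp.1⟩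
  have key : ∀ a b, ∀ z ∈ P.swap.R a ∩ φ.symm ⁻¹' P.swap.R b,
      φ.symm z ∈ P.R b ∩ φ ⁻¹' P.R a := by
    rintro a b z ⟨h1, h2⟩
    rw [mem_preimage, RectangleFamily.swap_R] at h2
    rw [RectangleFamily.swap_R] at h1
    exact ⟨h2, by rwa [mem_preimage, φ.apply_symm_apply]⟩
  refine
    { regular := ⟨ε, hε, fun a => (hreg a).swap hε⟩
      maximal := ?_
      meets := fun a => by simpa using hP.meets a
      disjoint_R := fun a b hab => by simpa using hP.disjoint_R hab
      disjoint_Is := hP.disjoint_Iu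
      disjoint_Iu := hP.disjoint_Is
      cross_s := ?_
      cross_u := ?_
      invariant_s := ?_
      invariant_u := ?_
      leaf_s := fun a p hp hpΛ x hx => hP.leaf_u a p.swap (hsrc a p hp) hpΛ x hx
      leaf_u := fun a p hp hpΛ y hy => hP.leaf_s a p.swap (hsrc a p hp) hpΛ y hy
      tangent_s := ?_
      tangent_u := ?_
      side_s := fun a y hy => hP.side_u a y hy
      side_u := fun a x hx => hP.side_s a x hx }
  · simp only [RectangleFamily.swap_R]
    rw [hP.maximal]
    ext x
    exact (forall_iter_symm φ (p := fun y => y ∈ ⋃ a, P.R a)).symm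
  · intro a b hab
    obtain ⟨c, d, hcd, hsub, h⟩ := hP.cross_u b a (admissible_symm_swap.1 hab)
    refine ⟨c, d, hcd, hsub, ?_⟩
    rw [RectangleFamily.swap_R, RectangleFamily.swap_R, preimage_symm_eq, inter_comm, h]
    exact (image_swapParam _ _ _).symm
  · intro a b hab
    obtain ⟨c, d, hcd, hsub, h⟩ := hP.cross_s b a (admissible_symm_swap.1 hab)
    refine ⟨c, d, hcd, hsub, ?_⟩
    rw [RectangleFamily.swap_R, RectangleFamily.swap_R, image_symm_eq, inter_comm, h]
    exact (image_swapParam _ _ _).symm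
  · intro a b z hz z' hz' h
    refine hP.invariant_u b a _ (key a b z hz) _ (key a b z' hz') ?_
    rwa [φ.apply_symm_apply, φ.apply_symm_apply]
  · intro a b z hz z' hz' h
    have := hP.invariant_s b a _ (key a b z hz) _ (key a b z' hz') h
    rwa [φ.apply_symm_apply, φ.apply_symm_apply] at this
  · intro a p hp hpΛ
    have h1 := hP.tangent_u a p.swap (hsrc a p hp) hpΛ
    have h2 := mfderiv_swapParam hε (hreg a) (P.box_subset a (hsrc a p hp)) (1, 0)
    exact h2 ▸ h1
  · intro a p hp hpΛ
    have h1 := hP.tangent_s a p.swap (hsrc a p hp) hpΛ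
    have h2 := mfderiv_swapParam hε (hreg a) (P.box_subset a (hsrc a p hp)) (0, 1)
    exact h2 ▸ h1

lemma mfderiv_apply_of_leftInverse {f h : M → M} (hf : MDifferentiable (𝓡 2) (𝓡 2) f)
    (hh : MDifferentiable (𝓡 2) (𝓡 2) h) (hinv : Function.LeftInverse h f) (x : M)
    (v : TangentSpace (𝓡 2) x) :
    (mfderiv (𝓡 2) (𝓡 2) h (f x) (mfderiv (𝓡 2) (𝓡 2) f x v) : EuclideanSpace ℝ (Fin 2)) = v := by
  have h3 := mfderiv_comp x (hh (f x)) (hf x)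
  rw [show h ∘ f = id from funext hinv, mfderiv_id] at h3
  exact (DFunLike.congr_fun h3 v).symm

variable [IsManifold (𝓡 2) ∞ M]

/-- The part of the hyperbolicity that concerns the unstable direction. -/
structure IsUnstableDirection (φ : M ≃ₘ^2⟮𝓡 2, 𝓡 2⟯ M) (Λ : Set M)
    (Eu : ∀ x : M, Submodule ℝ (TangentSpace (𝓡 2) x)) : Prop where
  finrank : ∀ x ∈ Λ, Module.finrank ℝ (Eu x) = 1
  map : ∀ x ∈ Λ, ∀ v ∈ Eu x, mfderiv (𝓡 2) (𝓡 2) φ x v ∈ Eu (φ x)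
  rates : ∃ (g : Metric2 M) (C ρ : ℝ), 0 < C ∧ 0 < ρ ∧ ρ < 1 ∧ ∀ x ∈ Λ, ∀ n : ℕ, ∀ v ∈ Eu x,
    g.norm (φ.symm^[n] x) (mfderiv (𝓡 2) (𝓡 2) (φ.symm^[n]) x v) ≤ C * ρ ^ n * g.norm x v

lemma IsHorseshoe.isUnstableDirection {Λ : Set M}
    {Es Eu : ∀ x : M, Submodule ℝ (TangentSpace (𝓡 2) x)} (h : IsHorseshoe φ Λ Es Eu) :
    IsUnstableDirection φ Λ Eu where
  finrank := h.hyperbolic.finrank_u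
  map x hx v hv := by
    rw [← h.hyperbolic.map_u x hx]
    exact Submodule.mem_map_of_mem hv
  rates := by
    obtain ⟨g, C, ρ, hC, hρ, hρ1, hr⟩ := h.hyperbolic.rates
    exact ⟨g, C, ρ, hC, hρ, hρ1, fun x hx n => (hr x hx n).2⟩

lemma IsHorseshoe.isUnstableDirection_symm {Λ : Set M}
    {Es Eu : ∀ x : M, Submodule ℝ (TangentSpace (𝓡 2) x)} (h : IsHorseshoe φ Λ Es Eu) :
    IsUnstableDirection φ.symm Λ Es where
  finrank := h.hyperbolic.finrank_s
  map x hx v hv := by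
    rw [← h.invariant] at hx
    obtain ⟨y, hy, rfl⟩ := hx
    rw [← h.hyperbolic.map_s y hy] at hv
    obtain ⟨u, hu, rfl⟩ := hv
    have h1 := mfderiv_apply_of_leftInverse (φ.mdifferentiable two_ne_zero)
      (φ.symm.mdifferentiable two_ne_zero) φ.symm_apply_apply y u
    -- The identity `φ.symm (φ y) = y` moves the base point of the tangent space, so the membership
    -- is transported together with the vector.
    have key : ∀ z : M, z = y → ∀ u' : EuclideanSpace ℝ (Fin 2), u' = u →
        (u' : TangentSpace (𝓡 2) z) ∈ Es z := by
      rintro z rfl u' rfl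
      exact hu
    exact key _ (φ.symm_apply_apply y) _ h1
  rates := by
    obtain ⟨g, C, ρ, hC, hρ, hρ1, hr⟩ := h.hyperbolic.rates
    exact ⟨g, C, ρ, hC, hρ, hρ1, fun x hx n => (hr x hx n).1⟩

end Swap

/-! ### Coordinates in the rectangles -/

namespace RectangleFamily

variable {M : Type*} [TopologicalSpace M] {A : Type*} (P : RectangleFamily M A)

lemma symm_param {a : A} {p : ℝ × ℝ} (hp : p ∈ P.Is a ×ˢ P.Iu a) :
    (P.param a).symm (P.param a p) = p := (P.param a).left_inv (P.box_subset a hp)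

lemma symm_mem {a : A} {z : M} (hz : z ∈ P.R a) : (P.param a).symm z ∈ P.Is a ×ˢ P.Iu a := by
  obtain ⟨p, hp, rfl⟩ := hz
  rwa [P.symm_param hp]

lemma R_subset_target (a : A) : P.R a ⊆ (P.param a).target := by
  rintro _ ⟨p, hp, rfl⟩
  exact (P.param a).map_source (P.box_subset a hp)

lemma param_symm {a : A} {z : M} (hz : z ∈ P.R a) : P.param a ((P.param a).symm z) = z :=
  (P.param a).right_inv (P.R_subset_target a hz)

lemma param_proj {a : A} {z : M} (hz : z ∈ P.R a) :
    P.param a (P.projU a z, P.projS a z) = z := P.param_symm hz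

lemma projS_param {a : A} {x y : ℝ} (hx : x ∈ P.Is a) (hy : y ∈ P.Iu a) :
    P.projS a (P.param a (x, y)) = y :=
  congrArg Prod.snd (P.symm_param (p := (x, y)) ⟨hx, hy⟩)

lemma projU_param {a : A} {x y : ℝ} (hx : x ∈ P.Is a) (hy : y ∈ P.Iu a) :
    P.projU a (P.param a (x, y)) = x :=
  congrArg Prod.fst (P.symm_param (p := (x, y)) ⟨hx, hy⟩)

lemma param_mem {a : A} {x y : ℝ} (hx : x ∈ P.Is a) (hy : y ∈ P.Iu a) :
    P.param a (x, y) ∈ P.R a := ⟨(x, y), ⟨hx, hy⟩, rfl⟩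

lemma projS_mem {a : A} {z : M} (hz : z ∈ P.R a) : P.projS a z ∈ P.Iu a := (P.symm_mem hz).2

lemma projU_mem {a : A} {z : M} (hz : z ∈ P.R a) : P.projU a z ∈ P.Is a := (P.symm_mem hz).1

lemma sLo_mem (a : A) : P.sLo a ∈ P.Is a := left_mem_Icc.2 (P.s_lt a).le

lemma image_projS (a : A) : P.projS a '' P.R a = P.Iu a := by
  ext y
  constructor
  · rintro ⟨z, hz, rfl⟩
    exact P.projS_mem hz
  · intro hy
    exact ⟨_, P.param_mem (P.sLo_mem a) hy, P.projS_param (P.sLo_mem a) hy⟩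

lemma isCompact_R (a : A) : IsCompact (P.R a) :=
  (isCompact_Icc.prod isCompact_Icc).image_of_continuousOn
    ((P.param a).continuousOn.mono (P.box_subset a))

end RectangleFamily

/-! ### The Markov map on the unstable intervals -/

section USystem

variable {M : Type*} [TopologicalSpace M] [ChartedSpace (EuclideanSpace ℝ (Fin 2)) M] {A : Type*}

/-- The map `φ` in the coordinates of the rectangles. -/
noncomputable def transition (φ : M ≃ₘ^2⟮𝓡 2, 𝓡 2⟯ M) (P : RectangleFamily M A) (a b : A)
    (q : ℝ × ℝ) : ℝ × ℝ :=
  (P.param b).symm (φ (P.param a q))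

/-- The branches of the map `g_u`. -/
noncomputable def uSystem (φ : M ≃ₘ^2⟮𝓡 2, 𝓡 2⟯ M) (P : RectangleFamily M A) : BranchedMap A where
  lo := P.uLo
  hi := P.uHi
  adm := Admissible φ P
  left a b := sInf (branchDomain φ P.R P.projS a b)
  right a b := sSup (branchDomain φ P.R P.projS a b)
  map a b y := (transition φ P a b (P.sLo a, y)).2
  dmap a b y := (fderiv ℝ (transition φ P a b) (P.sLo a, y) (0, 1)).2

variable {φ : M ≃ₘ^2⟮𝓡 2, 𝓡 2⟯ M} {P : RectangleFamily M A} {Λ : Set M}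
  {Es Eu : ∀ x : M, Submodule ℝ (TangentSpace (𝓡 2) x)}

lemma admissible_of_mem {a b : A} {z : M} (hz : z ∈ P.R a) (hz' : φ z ∈ P.R b) :
    Admissible φ P a b := ⟨φ z, mem_image_of_mem φ hz, hz'⟩

namespace IsMarkovPartition

lemma exists_branchDomain_eq (hP : IsMarkovPartition φ Λ Es Eu P)
    {a b : A} (hab : Admissible φ P a b) : ∃ c d : ℝ, c < d ∧
    branchDomain φ P.R P.projS a b = Icc c d ∧ Icc c d ⊆ P.Iu a ∧
    P.R a ∩ φ ⁻¹' P.R b = P.param a '' (P.Is a ×ˢ Icc c d) := by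
  obtain ⟨c, d, hcd, hsub, h⟩ := hP.cross_s a b hab
  refine ⟨c, d, hcd, ?_, hsub, h⟩
  rw [branchDomain, h]
  ext y
  constructor
  · rintro ⟨_, ⟨⟨x, y⟩, ⟨hx, hy⟩, rfl⟩, rfl⟩
    rwa [P.projS_param hx (hsub hy)]
  · intro hy
    exact ⟨_, ⟨(P.sLo a, y), ⟨P.sLo_mem a, hy⟩, rfl⟩, P.projS_param (P.sLo_mem a) (hsub hy)⟩

lemma dom_eq (hP : IsMarkovPartition φ Λ Es Eu P) {a b : A} (hab : Admissible φ P a b) :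
    (uSystem φ P).dom a b = branchDomain φ P.R P.projS a b := by
  obtain ⟨c, d, hcd, h, -⟩ := hP.exists_branchDomain_eq hab
  simp only [BranchedMap.dom, uSystem]
  rw [h, csInf_Icc hcd.le, csSup_Icc hcd.le]

/-- A rectangle is crossed along whole stable leaves. -/
lemma apply_mem_R_iff (hP : IsMarkovPartition φ Λ Es Eu P) {a b : A} {z : M} (hz : z ∈ P.R a) :
    φ z ∈ P.R b ↔ P.projS a z ∈ branchDomain φ P.R P.projS a b := by
  refine ⟨fun h => ⟨z, ⟨hz, h⟩, rfl⟩, fun h => ?_⟩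
  have hab : Admissible φ P a b := by
    obtain ⟨z', ⟨h1, h2⟩, -⟩ := h
    exact admissible_of_mem h1 h2
  obtain ⟨c, d, hcd, h1, hsub, h2⟩ := hP.exists_branchDomain_eq hab
  rw [h1] at h
  have : z ∈ P.R a ∩ φ ⁻¹' P.R b := by
    rw [h2]
    exact ⟨(P.projU a z, P.projS a z), ⟨P.projU_mem hz, h⟩, P.param_proj hz⟩
  exact this.2

/-- The image of R_a crosses R_b along whole unstable leaves, so backward iteration keeps two points
of one unstable leaf in the same rectangle and on one leaf. -/
lemma symm_apply_mem_R (hP : IsMarkovPartition φ Λ Es Eu P)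
    {a b : A} {z z' : M} (hz : z ∈ P.R b) (hz' : z' ∈ P.R b)
    (h : P.projU b z = P.projU b z') (ha : φ.symm z ∈ P.R a) :
    φ.symm z' ∈ P.R a ∧ P.projU a (φ.symm z) = P.projU a (φ.symm z') := by
  have hφ : φ (φ.symm z) ∈ P.R b := by rwa [φ.apply_symm_apply]
  obtain ⟨c, d, hcd, hsub, h1⟩ := hP.cross_u a b (admissible_of_mem ha hφ)
  have hzmem : z ∈ P.param b '' (Icc c d ×ˢ P.Iu b) := by
    rw [← h1]
    exact ⟨⟨_, ha, φ.apply_symm_apply z⟩, hz⟩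
  obtain ⟨⟨x, y⟩, ⟨hx, hy⟩, rfl⟩ := hzmem
  rw [P.projU_param (hsub hx) hy] at h
  have hz'mem : z' ∈ φ '' P.R a ∩ P.R b := by
    rw [h1]
    exact ⟨(P.projU b z', P.projS b z'), ⟨h ▸ hx, P.projS_mem hz'⟩, P.param_proj hz'⟩
  obtain ⟨⟨u, hu, rfl⟩, -⟩ := hz'mem
  rw [φ.symm_apply_apply]
  refine ⟨hu, hP.invariant_u a b _ ⟨ha, hφ⟩ _ ⟨hu, hz'⟩ ?_⟩
  rw [φ.apply_symm_apply, P.projU_param (hsub hx) hy, h]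

/-- The branch was defined on the left edge of the rectangle; local invariance of the stable
foliation makes the choice of the transversal irrelevant. -/
lemma map_projS (hP : IsMarkovPartition φ Λ Es Eu P)
    {a b : A} {z : M} (hz : z ∈ P.R a) (hz' : φ z ∈ P.R b) :
    (uSystem φ P).map a b (P.projS a z) = P.projS b (φ z) := by
  have h1 : P.param a (P.sLo a, P.projS a z) ∈ P.R a :=
    P.param_mem (P.sLo_mem a) (P.projS_mem hz)
  have h2 : P.projS a (P.param a (P.sLo a, P.projS a z)) = P.projS a z :=
    P.projS_param (P.sLo_mem a) (P.projS_mem hz)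
  refine hP.invariant_s a b _ ⟨h1, ?_⟩ _ ⟨hz, hz'⟩ h2
  rw [mem_preimage, hP.apply_mem_R_iff h1, h2]
  exact ⟨z, ⟨hz, hz'⟩, rfl⟩

lemma eq_of_mem_Iu (hP : IsMarkovPartition φ Λ Es Eu P)
    {a b : A} {x : ℝ} (ha : x ∈ P.Iu a) (hb : x ∈ P.Iu b) : a = b := by
  by_contra hne
  exact (hP.disjoint_Iu hne).le_bot ⟨ha, hb⟩

lemma eq_of_mem_R (hP : IsMarkovPartition φ Λ Es Eu P)
    {a b : A} {z : M} (ha : z ∈ P.R a) (hb : z ∈ P.R b) : a = b := by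
  by_contra hne
  exact (hP.disjoint_R hne).le_bot ⟨ha, hb⟩

lemma eq_of_mem_branchDomain (hP : IsMarkovPartition φ Λ Es Eu P) {a b a' b' : A} {x : ℝ}
    (h : x ∈ branchDomain φ P.R P.projS a b) (h' : x ∈ branchDomain φ P.R P.projS a' b') :
    a = a' ∧ b = b' := by
  have hx' := h'
  obtain ⟨z, ⟨hz1, hz2⟩, rfl⟩ := h
  obtain ⟨z', ⟨hz1', hz2'⟩, hzz⟩ := h'
  obtain rfl : a = a' := hP.eq_of_mem_Iu (P.projS_mem hz1) (hzz ▸ P.projS_mem hz1')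
  exact ⟨rfl, hP.eq_of_mem_R hz2 ((hP.apply_mem_R_iff hz1).2 hx')⟩

/-- The choice inside `expandingMap` does no harm: the coordinate x determines both letters by
disjointness, and the value depends only on the stable leaf. -/
lemma expandingMap_eq (hP : IsMarkovPartition φ Λ Es Eu P)
    {a b : A} {x : ℝ} (hx : x ∈ branchDomain φ P.R P.projS a b) :
    expandingMap φ P.R P.projS x = (uSystem φ P).map a b x := by
  have hex : ∃ p : A × A × M, p.2.2 ∈ P.R p.1 ∧ φ p.2.2 ∈ P.R p.2.1 ∧ P.projS p.1 p.2.2 = x := by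
    obtain ⟨z, ⟨h1, h2⟩, h3⟩ := hx
    exact ⟨(a, b, z), h1, h2, h3⟩
  rw [expandingMap, dif_pos hex]
  obtain ⟨h1, h2, h3⟩ := hex.choose_spec
  obtain ⟨ha, hb⟩ := hP.eq_of_mem_branchDomain hx ⟨_, ⟨h1, h2⟩, h3⟩
  rw [← hP.map_projS h1 h2, h3, ← ha, ← hb]

lemma image_map (hP : IsMarkovPartition φ Λ Es Eu P) {a b : A} (hab : Admissible φ P a b) :
    (uSystem φ P).map a b '' branchDomain φ P.R P.projS a b = P.Iu b := by
  ext y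
  constructor
  · rintro ⟨_, ⟨z, ⟨h1, h2⟩, rfl⟩, rfl⟩
    rw [hP.map_projS h1 h2]
    exact P.projS_mem h2
  · intro hy
    obtain ⟨c, d, hcd, hsub, h⟩ := hP.cross_u a b hab
    have hmem : P.param b (c, y) ∈ φ '' P.R a ∩ P.R b := by
      rw [h]
      exact ⟨(c, y), ⟨left_mem_Icc.2 hcd.le, hy⟩, rfl⟩
    obtain ⟨⟨z, hz, hzφ⟩, hb⟩ := hmem
    rw [← hzφ] at hb
    refine ⟨P.projS a z, ⟨z, ⟨hz, hb⟩, rfl⟩, ?_⟩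
    rw [hP.map_projS hz hb, hzφ, P.projS_param (hsub (left_mem_Icc.2 hcd.le)) hy]

/-- The cylinders of `g_u` are those of the system of its branches. -/
lemma cyl_eq_cylU (hP : IsMarkovPartition φ Λ Es Eu P)
    (w : List A) (hw : w.IsChain (Admissible φ P)) :
    (uSystem φ P).cyl w = cylU φ P w := by
  induction w with
  | nil => simp [BranchedMap.cyl, cylU, cylinder]
  | cons a w ih =>
    cases w with
    | nil =>
      ext x
      simp only [cylU, cylinder, List.head?_cons, Option.mem_def, Option.some.injEq,
        forall_eq', mem_ofPred_eq]
      rw [P.image_projS]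
      refine ⟨fun hx => ⟨hx, fun i a' _ b' hb' => by simp at hb'⟩, fun hx => hx.1⟩
    | cons b w =>
      obtain ⟨hab, hw⟩ := List.isChain_cons_cons.1 hw
      ext x
      simp only [BranchedMap.cyl, mem_ofPred_eq]
      rw [ih hw, hP.dom_eq hab]
      constructor
      · rintro ⟨hx, -, hx'⟩
        refine ⟨?_, ?_⟩
        · rintro a' ha'
          simp only [List.head?_cons, Option.mem_def, Option.some.injEq] at ha'
          subst ha'
          exact image_mono inter_subset_left hx
        · rintro i a' ha' b' hb'
          cases i with
          | zero =>
            simp only [List.getElem?_cons_zero, List.getElem?_cons_succ, Option.mem_def,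
              Option.some.injEq, zero_add] at ha' hb'
            subst ha' hb'
            exact hx
          | succ i =>
            rw [Function.iterate_succ_apply, hP.expandingMap_eq hx]
            exact hx' i a' (by simpa using ha') b' (by simpa using hb')
      · rintro ⟨-, hx⟩
        have h0 : x ∈ branchDomain φ P.R P.projS a b := hx 0 a (by simp) b (by simp)
        refine ⟨h0, ?_, ?_⟩
        · rintro b' hb'
          simp only [List.head?_cons, Option.mem_def, Option.some.injEq] at hb'
          subst hb'
          rw [P.image_projS, ← hP.image_map hab]
          exact mem_image_of_mem _ h0
        · intro i a' ha' b' hb'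
          rw [← hP.expandingMap_eq h0, ← Function.iterate_succ_apply]
          exact hx (i + 1) a' (by simpa using ha') b' (by simpa using hb')

/-- Whether a point follows a word depends only on its stable leaf, so itineraries in the surface
and cylinders on the line carry the same information. -/
lemma follows_iff (hP : IsMarkovPartition φ Λ Es Eu P)
    (a : A) (w : List A) (hw : (a :: w).IsChain (Admissible φ P)) {z : M}
    (hz : z ∈ P.R a) :
    Follows φ P.R (a :: w) z ↔ P.projS a z ∈ (uSystem φ P).cyl (a :: w) := by
  induction w generalizing a z with
  | nil => exact ⟨fun _ => P.projS_mem hz, fun _ => ⟨hz, trivial⟩⟩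
  | cons b w ih =>
    obtain ⟨hab, hw⟩ := List.isChain_cons_cons.1 hw
    change z ∈ P.R a ∧ Follows φ P.R (b :: w) (φ z) ↔ P.projS a z ∈ (uSystem φ P).dom a b ∧
      (uSystem φ P).map a b (P.projS a z) ∈ (uSystem φ P).cyl (b :: w)
    rw [hP.dom_eq hab, ← hP.apply_mem_R_iff hz]
    constructor
    · rintro ⟨-, h⟩
      refine ⟨h.1, ?_⟩
      rw [hP.map_projS hz h.1]
      exact (ih b hw h.1).1 h
    · rintro ⟨h1, h2⟩
      rw [hP.map_projS hz h1] at h2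
      exact ⟨hz, (ih b hw h1).2 h2⟩

lemma isChain_of_follows (w : List A) (z : M) (h : Follows φ P.R w z) :
    w.IsChain (Admissible φ P) := by
  induction w generalizing z with
  | nil => simp
  | cons a w ih =>
    cases w with
    | nil => simp
    | cons b w =>
      exact List.isChain_cons_cons.2 ⟨admissible_of_mem h.1 h.2.1, ih _ h.2⟩

lemma subset_R (hP : IsMarkovPartition φ Λ Es Eu P) : Λ ⊆ ⋃ a, P.R a := fun z hz => by
  rw [hP.maximal] at hz
  exact hz 0

lemma apply_mem (hP : IsMarkovPartition φ Λ Es Eu P) {z : M} (hz : z ∈ Λ) : φ z ∈ Λ := by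
  rw [hP.maximal] at hz ⊢
  exact forall_iter_apply φ hz

lemma symm_apply_mem (hP : IsMarkovPartition φ Λ Es Eu P)
    {z : M} (hz : z ∈ Λ) : φ.symm z ∈ Λ := hP.swap.apply_mem hz

/-- The points on the unstable leaf of a point of `Λ` that can be iterated forever lie in `Λ`. -/
lemma mem_of_forall_cyl (hP : IsMarkovPartition φ Λ Es Eu P)
    {a : A} {z₀ : M} (hz₀ : z₀ ∈ Λ ∩ P.R a) {x : ℝ} (hx : x ∈ P.Iu a)
    (h : ∀ n, ∃ w : List A, w.IsChain (Admissible φ P) ∧ w.length = n + 1 ∧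
      x ∈ (uSystem φ P).cyl w) : P.param a (P.projU a z₀, x) ∈ Λ := by
  set z := P.param a (P.projU a z₀, x) with hz
  have hza : z ∈ P.R a := P.param_mem (P.projU_mem hz₀.2) hx
  have hzS : P.projS a z = x := P.projS_param (P.projU_mem hz₀.2) hx
  have hzU : P.projU a z₀ = P.projU a z := (P.projU_param (P.projU_mem hz₀.2) hx).symm
  -- Forward iterates stay in the rectangles because the coordinate x lies in cylinders of every
  -- length.
  have hfwd : ∀ n, φ^[n] z ∈ ⋃ b, P.R b := by
    intro n
    obtain ⟨w, hw, hl, hxw⟩ := h n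
    rw [hP.cyl_eq_cylU w hw] at hxw
    cases w with
    | nil => simp at hl
    | cons b w =>
      have hb : x ∈ P.Iu b := by
        rw [← P.image_projS b]
        exact hxw.1 b (by simp)
      obtain rfl := hP.eq_of_mem_Iu hx hb
      rw [← hP.cyl_eq_cylU _ hw, ← hzS, ← hP.follows_iff a w hw hza] at hxw
      obtain ⟨b, hb⟩ := exists_dropLast_append (α := a :: w) (by simp)
      have hlen : (a :: w).dropLast.length = n := by rw [List.length_dropLast, hl]; rfl
      rw [hb, follows_append, hlen] at hxw
      exact mem_iUnion.2 ⟨b, hxw.2.1⟩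
  -- Backward iterates accompany those of z₀ along common unstable leaves, and the orbit of z₀ never
  -- leaves the rectangles.
  have hbwd : ∀ n, ∃ b, φ.symm^[n] z ∈ P.R b ∧ φ.symm^[n] z₀ ∈ P.R b ∧ φ.symm^[n] z₀ ∈ Λ ∧
      P.projU b (φ.symm^[n] z₀) = P.projU b (φ.symm^[n] z) := by
    intro n
    induction n with
    | zero => exact ⟨a, hza, hz₀.2, hz₀.1, hzU⟩
    | succ n ih =>
      obtain ⟨b, h1, h2, h3, h4⟩ := ih
      have h5 := hP.symm_apply_mem h3
      obtain ⟨c, hc⟩ := mem_iUnion.1 (hP.subset_R h5)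
      obtain ⟨h6, h7⟩ := hP.symm_apply_mem_R h2 h1 h4 hc
      simp only [Function.iterate_succ_apply']
      exact ⟨c, h6, hc, h5, h7⟩
  rw [hP.maximal]
  intro n
  obtain ⟨k, rfl | rfl⟩ := n.eq_nat_or_neg
  · rw [iter_natCast]
    exact hfwd k
  · rw [iter_neg_natCast]
    obtain ⟨b, hb, -⟩ := hbwd k
    exact mem_iUnion.2 ⟨b, hb⟩

end IsMarkovPartition

end USystem

/-! ### Regularity and hyperbolicity of the Markov map -/

section Regularity

variable {M : Type*} [TopologicalSpace M] [ChartedSpace (EuclideanSpace ℝ (Fin 2)) M] {A : Type*}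
  {φ : M ≃ₘ^2⟮𝓡 2, 𝓡 2⟯ M} {P : RectangleFamily M A} {Λ : Set M}
  {Es Eu : ∀ x : M, Submodule ℝ (TangentSpace (𝓡 2) x)}

lemma exists_pos_forall_le {ι : Type*} [Finite ι] (m : ι → ℝ) (hm : ∀ i, 0 < m i) :
    ∃ c > 0, ∀ i, c ≤ m i := by
  obtain ⟨B, hB⟩ := (finite_range fun i => (m i)⁻¹).bddAbove
  refine ⟨(max B 1)⁻¹, by positivity, fun i => ?_⟩
  rw [inv_le_comm₀ (by positivity) (hm i)]
  exact (hB ⟨i, rfl⟩).trans (le_max_left _ _)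

namespace IsMarkovPartition

lemma exists_regular (hP : IsMarkovPartition φ Λ Es Eu P) :
    ∃ ε : ℝ, 0 < ε ∧ ε ≤ 1 ∧ ∀ a, IsC1HolderDiffeo ε (P.param a) := by
  obtain ⟨ε, hε, h⟩ := hP.regular
  exact ⟨min ε 1, by positivity, min_le_right _ _,
    fun a => (h a).mono hε (by positivity) (min_le_left _ _)⟩

lemma c1HolderAt_transition {ε : ℝ} (hε : 0 < ε) (hε1 : ε ≤ 1)
    (hreg : ∀ a, IsC1HolderDiffeo ε (P.param a)) {a b : A} {p : ℝ × ℝ}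
    (hp : p ∈ P.Is a ×ˢ P.Iu a) (hp' : φ (P.param a p) ∈ P.R b) :
    C1HolderAt ε (transition φ P a b) p :=
  (hreg a).transition hε hε1 (hreg b) φ (P.box_subset a hp) (P.R_subset_target b hp')

lemma dom_subset (hP : IsMarkovPartition φ Λ Es Eu P) {a b : A} (hab : Admissible φ P a b) :
    (uSystem φ P).dom a b ⊆ P.Iu a := by
  rw [hP.dom_eq hab]
  obtain ⟨c, d, -, h, hsub, -⟩ := hP.exists_branchDomain_eq hab
  rwa [h]

lemma apply_param_mem (hP : IsMarkovPartition φ Λ Es Eu P) {a b : A} (hab : Admissible φ P a b)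
    {x y : ℝ} (hx : x ∈ P.Is a) (hy : y ∈ (uSystem φ P).dom a b) :
    φ (P.param a (x, y)) ∈ P.R b := by
  have hy' := hP.dom_subset hab hy
  rw [hP.apply_mem_R_iff (P.param_mem hx hy'), P.projS_param hx hy', ← hP.dom_eq hab]
  exact hy

lemma transition_snd (hP : IsMarkovPartition φ Λ Es Eu P) {a b : A} (hab : Admissible φ P a b)
    {x y : ℝ} (hx : x ∈ P.Is a) (hy : y ∈ (uSystem φ P).dom a b) :
    (transition φ P a b (x, y)).2 = (uSystem φ P).map a b y := by
  have hy' := hP.dom_subset hab hy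
  have := hP.map_projS (P.param_mem hx hy') (hP.apply_param_mem hab hx hy)
  rw [P.projS_param hx hy'] at this
  exact this.symm

lemma left_lt_right (hP : IsMarkovPartition φ Λ Es Eu P) {a b : A} (hab : Admissible φ P a b) :
    (uSystem φ P).left a b < (uSystem φ P).right a b := by
  obtain ⟨c, d, hcd, h, -⟩ := hP.exists_branchDomain_eq hab
  simp only [uSystem]
  rwa [h, csInf_Icc hcd.le, csSup_Icc hcd.le]

lemma differentiableAt_transition (hP : IsMarkovPartition φ Λ Es Eu P) {a b : A}
    (hab : Admissible φ P a b) {x y : ℝ} (hx : x ∈ P.Is a) (hy : y ∈ (uSystem φ P).dom a b) :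
    DifferentiableAt ℝ (transition φ P a b) (x, y) := by
  obtain ⟨ε, hε, hε1, hreg⟩ := hP.exists_regular
  exact (c1HolderAt_transition hε hε1 hreg ⟨hx, hP.dom_subset hab hy⟩
    (hP.apply_param_mem hab hx hy)).differentiableAt

lemma hasDerivWithinAt_map (hP : IsMarkovPartition φ Λ Es Eu P) {a b : A}
    (hab : Admissible φ P a b) {x y : ℝ} (hx : x ∈ P.Is a) (hy : y ∈ (uSystem φ P).dom a b) :
    HasDerivWithinAt ((uSystem φ P).map a b) (fderiv ℝ (transition φ P a b) (x, y) (0, 1)).2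
      ((uSystem φ P).dom a b) y := by
  have h1 := (hP.differentiableAt_transition hab hx hy).hasFDerivAt
  have h2 : HasDerivAt (fun y' : ℝ => (x, y')) ((0 : ℝ), (1 : ℝ)) y :=
    (hasDerivAt_const y x).prodMk (hasDerivAt_id y)
  have h3 := (h1.comp_hasDerivAt y h2).hasDerivWithinAt (s := (uSystem φ P).dom a b)
  have h4 := ((ContinuousLinearMap.snd ℝ ℝ ℝ).hasFDerivAt
    (x := transition φ P a b (x, y))).comp_hasDerivWithinAt y h3
  exact h4.congr (fun y' hy' => (hP.transition_snd hab hx hy').symm)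
    (hP.transition_snd hab hx hy).symm

/-- The derivative across the stable leaves does not depend on the point of the leaf. -/
lemma fderiv_transition_snd (hP : IsMarkovPartition φ Λ Es Eu P) {a b : A}
    (hab : Admissible φ P a b) {x y : ℝ} (hx : x ∈ P.Is a) (hy : y ∈ (uSystem φ P).dom a b)
    (v : ℝ × ℝ) :
    (fderiv ℝ (transition φ P a b) (x, y) v).2 = v.2 * (uSystem φ P).dmap a b y := by
  -- The coordinate of the image is known to be independent of x only on the rectangle, so
  -- derivatives are compared within a nondegenerate closed interval, where they are still unique.
  have hu1 : UniqueDiffWithinAt ℝ ((uSystem φ P).dom a b) y :=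
    uniqueDiffOn_Icc (hP.left_lt_right hab) y hy
  have h1 : (fderiv ℝ (transition φ P a b) (x, y) (0, 1)).2 = (uSystem φ P).dmap a b y :=
    hu1.eq_deriv _ (hP.hasDerivWithinAt_map hab hx hy)
      (hP.hasDerivWithinAt_map hab (P.sLo_mem a) hy)
  have h2 : (fderiv ℝ (transition φ P a b) (x, y) (1, 0)).2 = 0 := by
    have h1 := (hP.differentiableAt_transition hab hx hy).hasFDerivAt
    have h2 : HasDerivAt (fun x' : ℝ => (x', y)) ((1 : ℝ), (0 : ℝ)) x :=
      (hasDerivAt_id x).prodMk (hasDerivAt_const x y)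
    have h3 := (h1.comp_hasDerivAt x h2).hasDerivWithinAt (s := P.Is a)
    have h4 := ((ContinuousLinearMap.snd ℝ ℝ ℝ).hasFDerivAt
      (x := transition φ P a b (x, y))).comp_hasDerivWithinAt x h3
    have h5 : HasDerivWithinAt (fun _ : ℝ => (uSystem φ P).map a b y) _ (P.Is a) x :=
      h4.congr (fun x' hx' => (hP.transition_snd hab hx' hy).symm)
        (hP.transition_snd hab hx hy).symm
    exact (uniqueDiffOn_Icc (P.s_lt a) x hx).eq_deriv _ h5 (hasDerivWithinAt_const x _ _)
  have hv : v = v.1 • ((1 : ℝ), (0 : ℝ)) + v.2 • ((0 : ℝ), (1 : ℝ)) := by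
    ext <;> simp
  conv_lhs => rw [hv]
  rw [map_add, map_smul, map_smul, Prod.snd_add, Prod.smul_snd, Prod.smul_snd, h1, h2]
  simp

/-- The transition has a differentiable local inverse, so its derivative is onto. As the second
component of that derivative is `dmap` times the second coordinate of the vector, `dmap` cannot
vanish. -/
lemma dmap_ne_zero (hP : IsMarkovPartition φ Λ Es Eu P) {a b : A} (hab : Admissible φ P a b)
    {y : ℝ} (hy : y ∈ (uSystem φ P).dom a b) : (uSystem φ P).dmap a b y ≠ 0 := by
  obtain ⟨ε, hε, hε1, hreg⟩ := hP.exists_regular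
  have hx := P.sLo_mem a
  set p : ℝ × ℝ := (P.sLo a, y) with hp
  have hpbox : p ∈ P.Is a ×ˢ P.Iu a := ⟨hx, hP.dom_subset hab hy⟩
  have hb := hP.apply_param_mem hab hx hy
  set q := transition φ P a b p with hq
  have hqb : P.param b q = φ (P.param a p) := P.param_symm hb
  have hqbox : q ∈ P.Is b ×ˢ P.Iu b := P.symm_mem hb
  have hback : φ.symm (P.param b q) = P.param a p := by rw [hqb, φ.symm_apply_apply]
  have hinv : transition φ.symm P b a q = p := by
    rw [transition, hback, P.symm_param hpbox]
  have h1 := (c1HolderAt_transition (φ := φ.symm) hε hε1 hreg (a := b) (b := a) hqbox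
    (by rw [hback]; exact ⟨p, hpbox, rfl⟩)).differentiableAt
  have h2 := hP.differentiableAt_transition hab hx hy
  have hev : transition φ P a b ∘ transition φ.symm P b a =ᶠ[𝓝 q] id := by
    have hc : ContinuousAt (fun q' => φ.symm (P.param b q')) q :=
      φ.symm.continuous.continuousAt.comp ((P.param b).continuousAt (P.box_subset b hqbox))
    have e1 : ∀ᶠ q' in 𝓝 q, φ.symm (P.param b q') ∈ (P.param a).target := by
      refine hc ((P.param a).open_target.mem_nhds ?_)
      simp only [hback]
      exact (P.param a).map_source (P.box_subset a hpbox)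
    have e2 : ∀ᶠ q' in 𝓝 q, q' ∈ (P.param b).source :=
      (P.param b).open_source.mem_nhds (P.box_subset b hqbox)
    filter_upwards [e1, e2] with q' h1 h2
    simp only [Function.comp_apply, transition, id]
    rw [(P.param a).right_inv h1, φ.apply_symm_apply, (P.param b).left_inv h2]
  have h3 := hev.fderiv_eq (𝕜 := ℝ)
  rw [fderiv_comp _ (by rwa [hinv]) h1, fderiv_id, hinv] at h3
  have h4 := congrArg Prod.snd (DFunLike.congr_fun h3 ((0 : ℝ), (1 : ℝ)))
  rw [ContinuousLinearMap.comp_apply, hp, hP.fderiv_transition_snd hab hx hy] at h4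
  intro h0
  rw [h0, mul_zero] at h4
  simp at h4

/-- The branches of `g_u` form a Markov map of class `C^{1+ε}`. -/
lemma exists_isMarkov [Finite A] (hP : IsMarkovPartition φ Λ Es Eu P) :
    ∃ m H ε : ℝ, (uSystem φ P).IsMarkov m H ε := by
  obtain ⟨ε, hε, hε1, hreg⟩ := hP.exists_regular
  have hloc : ∀ a b, Admissible φ P a b → ∃ C ≥ 0, ∀ x ∈ (uSystem φ P).dom a b,
      ∀ y ∈ (uSystem φ P).dom a b,
      ‖(uSystem φ P).dmap a b x - (uSystem φ P).dmap a b y‖ ≤ C * ‖x - y‖ ^ ε := by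
    intro a b hab
    refine exists_holder_of_locally isCompact_Icc hε fun y hy => ?_
    obtain ⟨N, hN, C, -, hC⟩ := c1HolderAt_transition hε hε1 hreg
      ⟨P.sLo_mem a, hP.dom_subset hab hy⟩ (hP.apply_param_mem hab (P.sLo_mem a) hy)
    have hcont : Continuous fun y : ℝ => (P.sLo a, y) := by fun_prop
    refine ⟨_, hcont.continuousAt hN, C, fun u hu u' hu' => ?_⟩
    have h1 := hC _ hu _ hu'
    have h2 : ‖((P.sLo a, u) : ℝ × ℝ) - (P.sLo a, u')‖ = ‖u - u'‖ := by
      simp [Prod.norm_def]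
    rw [h2] at h1
    refine le_trans ?_ h1
    have h3 : (uSystem φ P).dmap a b u - (uSystem φ P).dmap a b u' =
        ((fderiv ℝ (transition φ P a b) (P.sLo a, u) -
          fderiv ℝ (transition φ P a b) (P.sLo a, u')) (0, 1)).2 := rfl
    rw [h3]
    refine (norm_snd_le _).trans ((ContinuousLinearMap.le_opNorm _ _).trans_eq ?_)
    simp [Prod.norm_def]
  have hmin : ∀ a b, ∃ m > 0, Admissible φ P a b → ∀ x ∈ (uSystem φ P).dom a b,
      m ≤ |(uSystem φ P).dmap a b x| := by
    intro a b
    by_cases hab : Admissible φ P a b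
    · have hcont : ContinuousOn (fun x => |(uSystem φ P).dmap a b x|)
          ((uSystem φ P).dom a b) := by
        refine ContinuousOn.abs fun y hy => ?_
        obtain ⟨N, hN, C, -, hC⟩ := c1HolderAt_transition hε hε1 hreg
          ⟨P.sLo_mem a, hP.dom_subset hab hy⟩ (hP.apply_param_mem hab (P.sLo_mem a) hy)
        have h1 : ContinuousAt (fderiv ℝ (transition φ P a b)) (P.sLo a, y) :=
          continuousAt_of_holder hε hN fun q hq => hC q hq _ (mem_of_mem_nhds hN)
        have h2 : ContinuousAt (fun y => fderiv ℝ (transition φ P a b) (P.sLo a, y)) y :=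
          ContinuousAt.comp (f := fun y : ℝ => (P.sLo a, y)) h1 (by fun_prop)
        exact (h2.clm_apply continuousAt_const).snd.continuousWithinAt
      obtain ⟨x₀, hx₀, hmin⟩ := isCompact_Icc.exists_isMinOn
        (nonempty_Icc.2 (hP.left_lt_right hab).le) hcont
      exact ⟨_, abs_pos.2 (hP.dmap_ne_zero hab hx₀), fun _ x hx => hmin hx⟩
    · exact ⟨1, one_pos, fun h => absurd h hab⟩
  choose m hm hmle using hmin
  obtain ⟨m₀, hm₀, hm₀le⟩ := exists_pos_forall_le (fun p : A × A => m p.1 p.2) fun p => hm _ _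
  have hloc' : ∀ a b, ∃ C, Admissible φ P a b → ∀ x ∈ (uSystem φ P).dom a b,
      ∀ y ∈ (uSystem φ P).dom a b,
      ‖(uSystem φ P).dmap a b x - (uSystem φ P).dmap a b y‖ ≤ C * ‖x - y‖ ^ ε := by
    intro a b
    by_cases hab : Admissible φ P a b
    · obtain ⟨C, -, hC⟩ := hloc a b hab
      exact ⟨C, fun _ => hC⟩
    · exact ⟨0, fun h => absurd h hab⟩
  choose C hC using hloc'
  obtain ⟨B, hB⟩ := (finite_range fun p : A × A => C p.1 p.2).bddAbove
  refine ⟨m₀, max B 0, ε, ?_⟩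
  exact
    { lo_lt := P.u_lt
      left_lt := hP.left_lt_right
      dom_subset := hP.dom_subset
      disjoint_interval := hP.disjoint_Iu
      disjoint_dom := fun {a b b'} hb hb' hne => by
        rw [hP.dom_eq hb, hP.dom_eq hb', Set.disjoint_left]
        exact fun x hx hx' => hne (hP.eq_of_mem_branchDomain hx hx').2
      image := fun {a b} hab => by
        rw [hP.dom_eq hab]
        exact hP.image_map hab
      hasDeriv := fun {a b} hab x hx => hP.hasDerivWithinAt_map hab (P.sLo_mem a) hx
      pos := hm₀
      nonneg := le_max_right _ _
      exponent_pos := hε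
      le_dmap := fun {a b} hab x hx => (hm₀le (a, b)).trans (hmle a b hab x hx)
      holder := fun {a b} hab x hx y hy => (hC a b hab x hx y hy).trans (by
        simp only [Real.norm_eq_abs]
        gcongr
        exact (hB ⟨(a, b), rfl⟩).trans (le_max_left _ _)) }

end IsMarkovPartition

end Regularity

/-! ### Expansion along the unstable leaves. -/

section Hyperbolicity

variable {M : Type*} [TopologicalSpace M] [ChartedSpace (EuclideanSpace ℝ (Fin 2)) M] {A : Type*}
  {φ : M ≃ₘ^2⟮𝓡 2, 𝓡 2⟯ M} {P : RectangleFamily M A} {Λ : Set M}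
  {Es Eu : ∀ x : M, Submodule ℝ (TangentSpace (𝓡 2) x)}

/-- The tangent vector to the unstable leaf of a rectangle in the direction of its coordinate. -/
noncomputable def leafVector (P : RectangleFamily M A) (a : A) (z : M) :
    EuclideanSpace ℝ (Fin 2) :=
  mfderiv 𝓘(ℝ, ℝ × ℝ) (𝓡 2) (P.param a) ((P.param a).symm z) ((0, 1) : ℝ × ℝ)

lemma leafVector_param {a : A} {p : ℝ × ℝ} (hp : p ∈ P.Is a ×ˢ P.Iu a) :
    leafVector P a (P.param a p) =
      (mfderiv 𝓘(ℝ, ℝ × ℝ) (𝓡 2) (P.param a) p ((0, 1) : ℝ × ℝ) : EuclideanSpace ℝ (Fin 2)) := by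
  have key : ∀ q, q = p →
      (mfderiv 𝓘(ℝ, ℝ × ℝ) (𝓡 2) (P.param a) q ((0, 1) : ℝ × ℝ) : EuclideanSpace ℝ (Fin 2)) =
      mfderiv 𝓘(ℝ, ℝ × ℝ) (𝓡 2) (P.param a) p ((0, 1) : ℝ × ℝ) := by
    rintro q rfl
    rfl
  exact key _ (P.symm_param hp)

lemma Metric2.norm_smul [IsManifold (𝓡 2) ∞ M] (g : Metric2 M) (x : M) (c : ℝ)
    (v : TangentSpace (𝓡 2) x) : g.norm x (c • v) = |c| * g.norm x v := by
  unfold Metric2.norm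
  rw [map_smul, map_smul, smul_apply, smul_eq_mul, smul_eq_mul, ← mul_assoc,
    Real.sqrt_mul (mul_self_nonneg c), Real.sqrt_mul_self_eq_abs]

namespace IsMarkovPartition

lemma mfderiv_symm_leafVector (hP : IsMarkovPartition φ Λ Es Eu P) {a : A} {z : M}
    (hz : z ∈ P.R a) :
    (mfderiv (𝓡 2) 𝓘(ℝ, ℝ × ℝ) (P.param a).symm z (leafVector P a z) : ℝ × ℝ) = (0, 1) := by
  obtain ⟨ε, hε, -, hreg⟩ := hP.exists_regular
  obtain ⟨p, hp, rfl⟩ := hz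
  rw [leafVector_param hp]
  have hps := P.box_subset a hp
  have h1 := ((hreg a).contMDiffAt hε hps).mdifferentiableAt one_ne_zero
  have h2 := ((hreg a).contMDiffAt_symm hε
    ((P.param a).map_source hps)).mdifferentiableAt one_ne_zero
  have h3 := mfderiv_comp p h2 h1
  have hev : (P.param a).symm ∘ P.param a =ᶠ[𝓝 p] id := by
    filter_upwards [(P.param a).open_source.mem_nhds hps] with q hq
    exact (P.param a).left_inv hq
  rw [hev.mfderiv_eq, mfderiv_id] at h3
  exact (DFunLike.congr_fun h3 ((0, 1) : ℝ × ℝ)).symm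

lemma leafVector_ne_zero (hP : IsMarkovPartition φ Λ Es Eu P) {a : A} {z : M}
    (hz : z ∈ P.R a) : leafVector P a z ≠ 0 := by
  intro h0
  have h1 := hP.mfderiv_symm_leafVector hz
  rw [h0] at h1
  have h2 : (mfderiv (𝓡 2) 𝓘(ℝ, ℝ × ℝ) (P.param a).symm z
      (0 : EuclideanSpace ℝ (Fin 2)) : ℝ × ℝ) = 0 := map_zero _
  rw [h2] at h1
  exact zero_ne_one (congrArg Prod.snd h1)

lemma leafVector_mem (hP : IsMarkovPartition φ Λ Es Eu P) {a : A} {z : M} (hz : z ∈ P.R a)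
    (hzΛ : z ∈ Λ) : (leafVector P a z : TangentSpace (𝓡 2) z) ∈ Eu z := by
  obtain ⟨p, hp, rfl⟩ := hz
  rw [leafVector_param hp]
  exact hP.tangent_u a p hp hzΛ

lemma mfderiv_symm_mfderiv_leafVector (hP : IsMarkovPartition φ Λ Es Eu P) {a b : A} {z : M}
    (hz : z ∈ P.R a) (hz' : φ z ∈ P.R b) :
    (mfderiv (𝓡 2) 𝓘(ℝ, ℝ × ℝ) (P.param b).symm (φ z)
      (mfderiv (𝓡 2) (𝓡 2) φ z (leafVector P a z)) : ℝ × ℝ).2 =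
      (uSystem φ P).dmap a b (P.projS a z) := by
  obtain ⟨ε, hε, -, hreg⟩ := hP.exists_regular
  obtain ⟨⟨x, y⟩, hp, rfl⟩ := hz
  rw [leafVector_param hp, P.projS_param hp.1 hp.2]
  have hps := P.box_subset a hp
  have h1 := ((hreg a).contMDiffAt hε hps).mdifferentiableAt one_ne_zero
  have h2 : MDifferentiableAt (𝓡 2) (𝓡 2) φ (P.param a (x, y)) := φ.mdifferentiable two_ne_zero _
  have h3 := ((hreg b).contMDiffAt_symm hε (P.R_subset_target b hz')).mdifferentiableAt one_ne_zero
  have h4 := (h3.hasMFDerivAt.comp _ h2.hasMFDerivAt).comp (x, y) h1.hasMFDerivAt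
  have h5 := h4.mfderiv
  have hab := admissible_of_mem (P.param_mem hp.1 hp.2) hz'
  have hy : y ∈ (uSystem φ P).dom a b := by
    rw [hP.dom_eq hab]
    have := (hP.apply_mem_R_iff (P.param_mem hp.1 hp.2)).1 hz'
    rwa [P.projS_param hp.1 hp.2] at this
  have h6 := hP.fderiv_transition_snd hab hp.1 hy (0, 1)
  rw [one_mul] at h6
  rw [← h6, ← mfderiv_eq_fderiv]
  exact congrArg Prod.snd (DFunLike.congr_fun h5 ((0, 1) : ℝ × ℝ)).symm

lemma follows_getLast {w : List A} {a : A} {z : M} (hw : Follows φ P.R (a :: w) z) :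
    φ^[w.length] z ∈ P.R ((a :: w).getLast (by simp)) := by
  induction w generalizing a z with
  | nil => exact hw.1
  | cons b w ih => exact ih hw.2

variable [IsManifold (𝓡 2) ∞ M]

/-- Both vectors lie on the line Eu at φ z, so they are proportional; the factor is read off in the
second coordinate of the rectangle. In this way the derivative of g_u is the derivative of φ along
Eu. -/
lemma mfderiv_leafVector (hP : IsMarkovPartition φ Λ Es Eu P) (hu : IsUnstableDirection φ Λ Eu)
    {a b : A} {z : M} (hzΛ : z ∈ Λ) (hz : z ∈ P.R a) (hz' : φ z ∈ P.R b) :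
    (mfderiv (𝓡 2) (𝓡 2) φ z (leafVector P a z) : EuclideanSpace ℝ (Fin 2)) =
      (uSystem φ P).dmap a b (P.projS a z) • leafVector P b (φ z) := by
  have hφz := hP.apply_mem hzΛ
  have h1 := hu.map z hzΛ _ (hP.leafVector_mem hz hzΛ)
  have h2 := hP.leafVector_mem hz' hφz
  have h3 : (⟨leafVector P b (φ z), h2⟩ : Eu (φ z)) ≠ 0 := fun h =>
    hP.leafVector_ne_zero hz' (congrArg Subtype.val h)
  obtain ⟨c, hc⟩ := (finrank_eq_one_iff_of_nonzero' _ h3).1 (hu.finrank _ hφz) ⟨_, h1⟩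
  have hc' : c • leafVector P b (φ z) =
      (mfderiv (𝓡 2) (𝓡 2) φ z (leafVector P a z) : EuclideanSpace ℝ (Fin 2)) :=
    congrArg Subtype.val hc
  have h4 := hP.mfderiv_symm_mfderiv_leafVector hz hz'
  have h5 : (mfderiv (𝓡 2) 𝓘(ℝ, ℝ × ℝ) (P.param b).symm (φ z)
      (c • leafVector P b (φ z) : EuclideanSpace ℝ (Fin 2)) : ℝ × ℝ) =
      c • (mfderiv (𝓡 2) 𝓘(ℝ, ℝ × ℝ) (P.param b).symm (φ z) (leafVector P b (φ z)) : ℝ × ℝ) :=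
    map_smul _ _ _
  rw [hP.mfderiv_symm_leafVector hz', hc'] at h5
  have h6 : (c • ((0, 1) : ℝ × ℝ)).2 = c := by simp
  have h7 : (uSystem φ P).dmap a b (P.projS a z) = c :=
    h4.symm.trans ((congrArg Prod.snd h5).trans h6)
  rw [← hc', h7]

lemma mfderiv_iterate_leafVector (hP : IsMarkovPartition φ Λ Es Eu P)
    (hu : IsUnstableDirection φ Λ Eu) (w : List A) (a : A) (z : M) (hzΛ : z ∈ Λ)
    (hw : Follows φ P.R (a :: w) z) :
    (mfderiv (𝓡 2) (𝓡 2) φ^[w.length] z (leafVector P a z) : EuclideanSpace ℝ (Fin 2)) =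
      (uSystem φ P).dcomp (a :: w) (P.projS a z) •
        leafVector P ((a :: w).getLast (by simp)) (φ^[w.length] z) := by
  induction w generalizing a z with
  | nil =>
    have h1 : mfderiv (𝓡 2) (𝓡 2) φ^[0] z = ContinuousLinearMap.id ℝ _ := mfderiv_id
    simp only [List.length_nil, List.getLast_singleton, BranchedMap.dcomp, one_smul]
    rw [h1]
    rfl
  | cons b w ih =>
    have h1 := hP.mfderiv_leafVector hu hzΛ hw.1 hw.2.1
    have h2 := ih b (φ z) (hP.apply_mem hzΛ) hw.2
    have hφ : MDifferentiableAt (𝓡 2) (𝓡 2) φ z := φ.mdifferentiable two_ne_zero _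
    have hφn : MDifferentiableAt (𝓡 2) (𝓡 2) φ^[w.length] (φ z) :=
      (φ.contMDiff.iterate w.length).mdifferentiable two_ne_zero _
    have h3 := mfderiv_comp z hφn hφ
    have h4 : (mfderiv (𝓡 2) (𝓡 2) φ^[(b :: w).length] z (leafVector P a z) :
        EuclideanSpace ℝ (Fin 2)) = mfderiv (𝓡 2) (𝓡 2) φ^[w.length] (φ z)
          (mfderiv (𝓡 2) (𝓡 2) φ z (leafVector P a z)) := DFunLike.congr_fun h3 _
    have h5 : (mfderiv (𝓡 2) (𝓡 2) φ^[w.length] (φ z)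
        ((uSystem φ P).dmap a b (P.projS a z) • leafVector P b (φ z) :
          EuclideanSpace ℝ (Fin 2)) : EuclideanSpace ℝ (Fin 2)) =
        (uSystem φ P).dmap a b (P.projS a z) •
          (mfderiv (𝓡 2) (𝓡 2) φ^[w.length] (φ z) (leafVector P b (φ z)) :
            EuclideanSpace ℝ (Fin 2)) := map_smul _ _ _
    have h6 : (uSystem φ P).dcomp (a :: b :: w) (P.projS a z) =
        (uSystem φ P).dmap a b (P.projS a z) * (uSystem φ P).dcomp (b :: w) (P.projS b (φ z)) := by
      rw [← hP.map_projS hw.1 hw.2.1, mul_comm]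
      rfl
    rw [h4, h1, h5, h2, h6]
    exact smul_smul (M := ℝ) (α := EuclideanSpace ℝ (Fin 2)) _ _ _

/-- The metric is comparable to the coordinate along the unstable leaves. -/
lemma exists_norm_leafVector (hP : IsMarkovPartition φ Λ Es Eu P) [Finite A] (g : Metric2 M) :
    ∃ c C : ℝ, 0 < c ∧ 0 < C ∧ ∀ a, ∀ z ∈ P.R a,
      c ≤ g.norm z (leafVector P a z) ∧ g.norm z (leafVector P a z) ≤ C := by
  obtain ⟨ε, hε, -, hreg⟩ := hP.exists_regular
  have hpos : ∀ a, ∀ z ∈ P.R a, 0 < g.norm z (leafVector P a z) := fun a z hz =>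
    Real.sqrt_pos.2 (g.pos z _ (hP.leafVector_ne_zero hz))
  have hcont : ∀ a, ContinuousOn (fun p : ℝ × ℝ => g.norm (P.param a p)
      (mfderiv 𝓘(ℝ, ℝ × ℝ) (𝓡 2) (P.param a) p ((0, 1) : ℝ × ℝ))) (P.Is a ×ˢ P.Iu a) := by
    intro a
    refine ContinuousOn.mono ?_ (P.box_subset a)
    have hsm : ContMDiffOn 𝓘(ℝ, ℝ × ℝ) (𝓡 2) 1 (P.param a) (P.param a).source := fun p hp =>
      ((hreg a).contMDiffAt hε hp).contMDiffWithinAt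
    have hT := hsm.continuousOn_tangentMapWithin le_rfl (P.param a).open_source.uniqueMDiffOn
    -- The leaf vectors are the image under the tangent map of the constant field (0, 1), so they
    -- vary continuously in the tangent bundle and the metric can be evaluated on them.
    have hsec : Continuous fun p : ℝ × ℝ =>
        (⟨p, ((0, 1) : ℝ × ℝ)⟩ : TangentBundle 𝓘(ℝ, ℝ × ℝ) (ℝ × ℝ)) := by
      have h1 := (tangentBundleModelSpaceHomeomorph 𝓘(ℝ, ℝ × ℝ)).symm.continuous
      have h2 : Continuous fun p : ℝ × ℝ => ((p, (0, 1)) : ModelProd (ℝ × ℝ) (ℝ × ℝ)) := by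
        exact Continuous.prodMk continuous_id continuous_const
      exact h1.comp h2
    have hv := ContinuousOn.comp (f := fun p : ℝ × ℝ =>
      (⟨p, ((0, 1) : ℝ × ℝ)⟩ : TangentBundle 𝓘(ℝ, ℝ × ℝ) (ℝ × ℝ))) (s := (P.param a).source) hT
      hsec.continuousOn fun p hp => hp
    have hv' : ContinuousOn (fun p : ℝ × ℝ => (⟨P.param a p,
        mfderiv 𝓘(ℝ, ℝ × ℝ) (𝓡 2) (P.param a) p ((0, 1) : ℝ × ℝ)⟩ : TangentBundle (𝓡 2) M))
        (P.param a).source := by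
      refine hv.congr fun p hp => ?_
      simp only [Function.comp_apply, tangentMapWithin]
      rw [mfderivWithin_of_isOpen (P.param a).open_source hp]
    intro p hp
    have hg := g.continuous.continuousAt.comp_continuousWithinAt
      ((P.param a).continuousOn p hp)
    have h1 := ContinuousWithinAt.clm_bundle_apply₂ (F₁ := EuclideanSpace ℝ (Fin 2))
      (F₂ := EuclideanSpace ℝ (Fin 2)) (E₃ := Bundle.Trivial M ℝ) (F₃ := ℝ) hg (hv' p hp) (hv' p hp)
    simp only [FiberBundle.continuousWithinAt_totalSpace] at h1
    exact h1.2.sqrt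
  have hbd : ∀ a, ∃ c C : ℝ, 0 < c ∧ ∀ z ∈ P.R a,
      c ≤ g.norm z (leafVector P a z) ∧ g.norm z (leafVector P a z) ≤ C := by
    intro a
    have hne : (P.Is a ×ˢ P.Iu a).Nonempty :=
      ⟨(P.sLo a, P.uLo a), P.sLo_mem a, left_mem_Icc.2 (P.u_lt a).le⟩
    have hcpt : IsCompact (P.Is a ×ˢ P.Iu a) := isCompact_Icc.prod isCompact_Icc
    obtain ⟨p₁, hp₁, h₁⟩ := hcpt.exists_isMinOn hne (hcont a)
    obtain ⟨p₂, hp₂, h₂⟩ := hcpt.exists_isMaxOn hne (hcont a)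
    refine ⟨g.norm (P.param a p₁) (leafVector P a (P.param a p₁)),
      g.norm (P.param a p₂) (leafVector P a (P.param a p₂)), hpos a _ ⟨p₁, hp₁, rfl⟩, ?_⟩
    rintro _ ⟨p, hp, rfl⟩
    rw [leafVector_param hp, leafVector_param hp₁, leafVector_param hp₂]
    exact ⟨h₁ hp, h₂ hp⟩
  choose c C hc hcC using hbd
  obtain ⟨c₀, hc₀, hc₀le⟩ := exists_pos_forall_le c hc
  obtain ⟨B, hB⟩ := (finite_range C).bddAbove
  exact ⟨c₀, max B 1, hc₀, by positivity, fun a z hz => ⟨(hc₀le a).trans (hcC a z hz).1,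
    (hcC a z hz).2.trans ((hB ⟨a, rfl⟩).trans (le_max_left _ _))⟩⟩

/-- The map `g_u` expands along its infinite orbits. -/
lemma exists_isHyperbolic (hP : IsMarkovPartition φ Λ Es Eu P) [Finite A]
    (hu : IsUnstableDirection φ Λ Eu) :
    ∃ κ ρ : ℝ, 0 < κ ∧ 1 < ρ ∧ (uSystem φ P).IsHyperbolic κ ρ := by
  obtain ⟨m, H, ε, hX⟩ := hP.exists_isMarkov
  obtain ⟨g, C, ρ, hC, hρ, hρ1, hr⟩ := hu.rates
  obtain ⟨c₁, C₁, hc₁, hC₁, hn⟩ := hP.exists_norm_leafVector g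
  -- Contraction of the inverse gives c₁ ≤ |D| C ρ^n C₁, where n is the number of branches. A word
  -- has n + 1 letters, whence the additional factor ρ.
  refine ⟨c₁ / (C * C₁) * ρ, ρ⁻¹, by positivity, (one_lt_inv₀ hρ).2 hρ1, ?_⟩
  intro w h0 hw x hx hinf
  obtain ⟨a, w, rfl⟩ := List.exists_cons_of_ne_nil h0
  obtain ⟨z₀, hz₀⟩ := hP.meets a
  have hxa : x ∈ P.Iu a := BranchedMap.cyl_append_subset [a] w (by simp) hX hw hx
  have hzΛ := hP.mem_of_forall_cyl hz₀ hxa hinf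
  set z := P.param a (P.projU a z₀, x) with hz
  have hza : z ∈ P.R a := P.param_mem (P.projU_mem hz₀.2) hxa
  have hzS : P.projS a z = x := P.projS_param (P.projU_mem hz₀.2) hxa
  have hfol : Follows φ P.R (a :: w) z := by rwa [hP.follows_iff a w hw hza, hzS]
  have h1 := hP.mfderiv_iterate_leafVector hu w a z hzΛ hfol
  rw [hzS] at h1
  set D := (uSystem φ P).dcomp (a :: w) x with hD
  set b := (a :: w).getLast (by simp) with hb
  set n := w.length with hn'
  have hlast : φ^[n] z ∈ P.R b := follows_getLast hfol
  have hlastΛ : φ^[n] z ∈ Λ := by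
    have : ∀ k, φ^[k] z ∈ Λ := fun k => by
      induction k with
      | zero => exact hzΛ
      | succ k ih => rw [Function.iterate_succ_apply']; exact hP.apply_mem ih
    exact this n
  have hinv : Function.LeftInverse φ.symm^[n] φ^[n] :=
    Function.LeftInverse.iterate φ.symm_apply_apply n
  have h2 := mfderiv_apply_of_leftInverse
    ((φ.contMDiff.iterate n).mdifferentiable two_ne_zero)
    ((φ.symm.contMDiff.iterate n).mdifferentiable two_ne_zero) hinv z (leafVector P a z)
  have h3 := hr _ hlastΛ n _ (hP.leafVector_mem hlast hlastΛ)
  have h4 := mul_le_mul_of_nonneg_left h3 (abs_nonneg D)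
  rw [← Metric2.norm_smul] at h4
  have h5 : (D • mfderiv (𝓡 2) (𝓡 2) φ.symm^[n] (φ^[n] z) (leafVector P b (φ^[n] z)) :
      EuclideanSpace ℝ (Fin 2)) = leafVector P a z := by
    rw [← h2, h1]
    exact (map_smul (mfderiv (𝓡 2) (𝓡 2) φ.symm^[n] (φ^[n] z)) D
      (leafVector P b (φ^[n] z))).symm
  have key : ∀ z', z' = z → ∀ v : EuclideanSpace ℝ (Fin 2), v = leafVector P a z →
      g.norm z' v = g.norm z (leafVector P a z) := by
    rintro z' rfl v rfl
    rfl
  rw [key _ (hinv z) _ h5] at h4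
  have h6 := (hn a z hza).1.trans h4
  have h7 : |D| * (C * ρ ^ n * g.norm (φ^[n] z) (leafVector P b (φ^[n] z))) ≤
      |D| * (C * ρ ^ n * C₁) := by
    gcongr
    exact (hn b _ hlast).2
  have h8 := h6.trans h7
  rw [List.length_cons, ← hn']
  calc c₁ / (C * C₁) * ρ * ρ⁻¹ ^ (n + 1) = c₁ / (C * C₁ * ρ ^ n) := by
        rw [pow_succ, inv_pow]
        field_simp
    _ ≤ |D| := by
        rw [div_le_iff₀ (by positivity)]
        linarith

lemma exists_isQuasiAdditive (hP : IsMarkovPartition φ Λ Es Eu P) [Finite A]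
    (hu : IsUnstableDirection φ Λ Eu) :
    ∃ C c : ℝ, IsQuasiAdditive (uSystem φ P).words (uSystem φ P).weight C c := by
  obtain ⟨m, H, ε, hX⟩ := hP.exists_isMarkov
  obtain ⟨κ, ρ, hκ, hρ, hh⟩ := hP.exists_isHyperbolic hu
  exact hX.exists_isQuasiAdditive hκ hρ hh

end IsMarkovPartition

end Hyperbolicity

/-! ### The words of an invariant subset -/

section Language

variable {M A : Type*}

/-- The words that are followed by the points of `Y`. -/
def language (ψ : M → M) (R : A → Set M) (Y : Set M) : Set (List A) :=
  {w | w ≠ [] ∧ ∃ x ∈ Y, Follows ψ R w x}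

variable {ψ : M → M} {R : A → Set M} {Y : Set M}

lemma language_mono {Y' : Set M} (h : Y ⊆ Y') : language ψ R Y ⊆ language ψ R Y' :=
  fun _ ⟨h0, x, hx, hw⟩ => ⟨h0, x, h hx, hw⟩

lemma iterate_mem (hψ : ∀ x ∈ Y, ψ x ∈ Y) {x : M} (hx : x ∈ Y) (n : ℕ) : ψ^[n] x ∈ Y := by
  induction n with
  | zero => exact hx
  | succ n ih => rw [Function.iterate_succ_apply']; exact hψ _ ih

lemma isLanguage_language (hY : Y ⊆ ⋃ a, R a) (hψ : ∀ x ∈ Y, ψ x ∈ Y) :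
    IsLanguage (language ψ R Y) where
  nil_notMem h := h.1 rfl
  of_append_left := by
    rintro α β ⟨-, x, hx, h⟩ hα
    exact ⟨hα, x, hx, ((follows_append α β x).1 h).1⟩
  of_append_right := by
    rintro α β ⟨-, x, hx, h⟩ hβ
    exact ⟨hβ, _, iterate_mem hψ hx _, ((follows_append α β x).1 h).2⟩
  extend := by
    rintro α ⟨-, x, hx, h⟩
    obtain ⟨a, ha⟩ := mem_iUnion.1 (hY (iterate_mem hψ hx α.length))
    exact ⟨a, by simp, x, hx, (follows_append α [a] x).2 ⟨h, ha, trivial⟩⟩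

/-- Following a word forwards is following its reversal backwards from the other end. Hence N_u and
N_s count words of one language by two different weights. -/
lemma setOf_reverse_mem_language {ψ' : M → M} (h : Function.LeftInverse ψ' ψ)
    (h' : Function.LeftInverse ψ ψ') (hψ : ∀ x ∈ Y, ψ x ∈ Y) (hψ' : ∀ x ∈ Y, ψ' x ∈ Y) :
    {w | w.reverse ∈ language ψ' R Y} = language ψ R Y := by
  ext w
  constructor
  · rintro ⟨h0, x, hx, hw⟩
    have := hw.reverse h'
    rw [List.reverse_reverse] at this
    exact ⟨by simpa using h0, _, iterate_mem hψ' hx _, this⟩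
  · rintro ⟨h0, x, hx, hw⟩
    exact ⟨by simpa using h0, _, iterate_mem hψ hx _, hw.reverse h⟩

lemma isClosed_follows [TopologicalSpace M] (hψ : Continuous ψ) (hR : ∀ a, IsClosed (R a))
    (w : List A) : IsClosed {x | Follows ψ R w x} := by
  induction w with
  | nil => exact isClosed_univ
  | cons a w ih => exact (hR a).inter (ih.preimage hψ)

end Language

/-! ### Quasi-additive weights and cylinder covers under reversal of words. -/

section Reverse

variable {A : Type*} {L : Set (List A)} {S : List A → ℝ} {C c : ℝ}

lemma IsQuasiAdditive.reverse (h : IsQuasiAdditive L S C c) :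
    IsQuasiAdditive {w | w.reverse ∈ L} (fun w => S w.reverse) C c where
  pos := h.pos
  nonneg := h.nonneg
  append := by
    intro α β hw hα hβ
    have hw' : β.reverse ++ α.reverse ∈ L := by simpa using hw
    have := h.append hw' (by simpa using hβ) (by simpa using hα)
    rw [List.reverse_append]
    convert this using 2
    ring
  singleton := fun {a} ha => h.singleton ha
  growth := by
    intro α hα
    simpa using h.growth hα

lemma IsCylinderCover.reverse {cyl : List A → Set ℝ} {K : Set ℝ} (h : IsCylinderCover L S cyl K) :
    IsCylinderCover {w | w.reverse ∈ L} (fun w => S w.reverse) (fun w => cyl w.reverse) K where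
  interval α hα := h.interval _ hα
  meets α hα := h.meets _ hα
  cover x hx := by
    obtain ⟨s, hs, hs'⟩ := h.cover x hx
    refine ⟨fun n => (s n).reverse, fun n => ?_, fun n => ?_⟩
    · simpa using hs n
    · obtain ⟨a, ha | ha⟩ := hs' n
      · exact ⟨a, Or.inr (by simp [ha])⟩
      · exact ⟨a, Or.inl (by simp [ha])⟩
  nested α hα β hβ hne hl := by
    rcases h.nested _ hα _ hβ hne (by simpa using hl) with ⟨γ, hγ⟩ | ⟨γ, hγ⟩
    · exact Or.inr ⟨γ.reverse, by simpa using congrArg List.reverse hγ⟩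
    · exact Or.inl ⟨γ.reverse, by simpa using congrArg List.reverse hγ⟩

end Reverse

/-! ### Cylinders over the projection of an invariant set. -/

section Cover

variable {M : Type*} [TopologicalSpace M] [ChartedSpace (EuclideanSpace ℝ (Fin 2)) M] {A : Type*}
  {φ : M ≃ₘ^2⟮𝓡 2, 𝓡 2⟯ M} {P : RectangleFamily M A} {Λ : Set M}
  {Es Eu : ∀ x : M, Submodule ℝ (TangentSpace (𝓡 2) x)} {Y : Set M}

lemma language_subset_words : language φ P.R Y ⊆ (uSystem φ P).words :=
  fun w ⟨h0, x, _, hw⟩ => ⟨h0, IsMarkovPartition.isChain_of_follows w x hw⟩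

namespace IsMarkovPartition

lemma mem_cyl_of_follows (hP : IsMarkovPartition φ Λ Es Eu P) {w : List A} (h0 : w ≠ []) {z : M}
    (hw : Follows φ P.R w z) {a : A} (ha : z ∈ P.R a) :
    P.projS a z ∈ (uSystem φ P).cyl w := by
  have hc := isChain_of_follows w z hw
  cases w with
  | nil => exact absurd rfl h0
  | cons b w =>
    obtain rfl := hP.eq_of_mem_R ha hw.1
    exact (hP.follows_iff a w hc ha).1 hw

/-- A point of the projection that lies in the cylinder comes from a point of Y, and that very point
follows the word because membership is decided on its stable leaf. -/
lemma mem_language_iff (hP : IsMarkovPartition φ Λ Es Eu P) {w : List A}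
    (hw : w ∈ (uSystem φ P).words) : w ∈ language φ P.R (Y ∩ ⋃ a, P.R a) ↔
      ((uSystem φ P).cyl w ∩ ⋃ a, P.projS a '' (Y ∩ P.R a)).Nonempty := by
  constructor
  · rintro ⟨h0, z, ⟨hzY, hz⟩, hf⟩
    obtain ⟨a, ha⟩ := mem_iUnion.1 hz
    exact ⟨P.projS a z, hP.mem_cyl_of_follows h0 hf ha, mem_iUnion.2 ⟨a, z, ⟨hzY, ha⟩, rfl⟩⟩
  · rintro ⟨x, hx, hxK⟩
    obtain ⟨a, z, ⟨hzY, ha⟩, rfl⟩ := mem_iUnion.1 hxK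
    obtain ⟨h0, hc⟩ := hw
    refine ⟨h0, z, ⟨hzY, mem_iUnion.2 ⟨a, ha⟩⟩, ?_⟩
    cases w with
    | nil => exact absurd rfl h0
    | cons b w =>
      have hb : P.projS a z ∈ P.Iu b := by
        rw [hP.cyl_eq_cylU _ hc] at hx
        rw [← P.image_projS b]
        exact hx.1 b (by simp)
      obtain rfl := hP.eq_of_mem_Iu (P.projS_mem ha) hb
      exact (hP.follows_iff a w hc ha).2 hx

/-- The cylinders along the words of an invariant set cover its projection. -/
lemma isCylinderCover (hP : IsMarkovPartition φ Λ Es Eu P) [Finite A] (hY : Y ⊆ ⋃ a, P.R a)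
    (hφ : ∀ x ∈ Y, φ x ∈ Y) :
    IsCylinderCover (language φ P.R Y) (uSystem φ P).weight (uSystem φ P).cyl
      (⋃ a, P.projS a '' (Y ∩ P.R a)) := by
  obtain ⟨m, H, ε, hX⟩ := hP.exists_isMarkov
  refine ⟨fun α hα => ?_, fun α hα => ?_, fun x hx => ?_, fun α hα β hβ hne hl => ?_⟩
  · obtain ⟨p, q, hpq, h⟩ := hX.exists_cyl_eq_Icc (language_subset_words hα)
    refine ⟨p, q, h, ?_⟩
    rw [BranchedMap.weight, h, Real.diam_Icc hpq.le, one_div, Real.log_inv, neg_neg,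
      Real.exp_log (by linarith)]
  · rw [← hP.mem_language_iff (language_subset_words hα), inter_eq_left.2 hY]
    exact hα
  · obtain ⟨a, z, ⟨hzY, ha⟩, rfl⟩ := mem_iUnion.1 hx
    obtain ⟨s, hs, hs'⟩ := exists_follows hY hφ hzY
    have hs0 : ∀ n, s n ≠ [] := fun n => List.length_pos_iff.1 (by have := (hs n).2; omega)
    refine ⟨s, fun n => ⟨⟨hs0 n, z, hzY, (hs n).1⟩, hP.mem_cyl_of_follows (hs0 n) (hs n).1 ha,
      (hs n).2⟩, fun n => ?_⟩
    obtain ⟨b, hb⟩ := hs' n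
    exact ⟨b, Or.inl hb⟩
  · obtain ⟨x, hxα, hxβ⟩ := hne
    exact Or.inl (hX.exists_append_of_inter α β (language_subset_words hα).2
      (language_subset_words hβ).2 hl hxα hxβ)

variable [IsManifold (𝓡 2) ∞ M]

/-- With a single letter all points have the same itinerary, so their coordinates share cylinders of
every length, and these shrink to a point. -/
lemma projS_eq_of_subsingleton (hP : IsMarkovPartition φ Λ Es Eu P) [Finite A] [Subsingleton A]
    (hu : IsUnstableDirection φ Λ Eu) {a : A} {x y : M} (hx : x ∈ Λ) (hy : y ∈ Λ)
    (hxa : x ∈ P.R a) (hya : y ∈ P.R a) : P.projS a x = P.projS a y := by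
  obtain ⟨m, H, ε, hX⟩ := hP.exists_isMarkov
  obtain ⟨κ, ρ, hκ, hρ, hh⟩ := hP.exists_isHyperbolic hu
  obtain ⟨K, θ, hK, hθ0, hθ1, hd⟩ := hX.exists_diam_le hκ hρ hh
  obtain ⟨s, hs, -⟩ := exists_follows hP.subset_R (fun z hz => hP.apply_mem hz) hx
  obtain ⟨s', hs', -⟩ := exists_follows hP.subset_R (fun z hz => hP.apply_mem hz) hy
  have hle : ∀ n, |P.projS a x - P.projS a y| ≤ K * θ ^ (n + 1) := by
    intro n
    have hss : s n = s' n := List.ext_getElem (by rw [(hs n).2, (hs' n).2])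
      fun i _ _ => Subsingleton.elim _ _
    have h0 : s n ≠ [] := List.length_pos_iff.1 (by have := (hs n).2; omega)
    have h1 := hP.mem_cyl_of_follows h0 (hs n).1 hxa
    have h2 := hP.mem_cyl_of_follows h0 (hss ▸ (hs' n).1) hya
    have hw : s n ∈ (uSystem φ P).words := ⟨h0, isChain_of_follows _ _ (hs n).1⟩
    have h3 := (hX.abs_sub_le_diam hw h1 h2).trans (hd _ hw)
    rwa [(hs n).2] at h3
  have hlim : Tendsto (fun n : ℕ => K * θ ^ (n + 1)) atTop (𝓝 (K * 0)) :=
    ((tendsto_pow_atTop_nhds_zero_of_lt_one hθ0.le hθ1).comp (tendsto_add_atTop_nat 1)).const_mul K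
  have := ge_of_tendsto' hlim hle
  rw [mul_zero] at this
  exact sub_eq_zero.1 (abs_eq_zero.1 (le_antisymm this (abs_nonneg _)))

/-- A partition of a horseshoe has at least two rectangles. -/
lemma two_le_card (hP : IsMarkovPartition φ Λ Es Eu P) [Fintype A]
    (hΛ : IsHorseshoe φ Λ Es Eu) : 2 ≤ Fintype.card A := by
  by_contra! hlt
  -- Applied in both directions, the collapse of coordinates makes Λ a single fixed point, against
  -- `not_periodic`. Two letters are needed to bound a constant by a power of the cardinality.
  have : Subsingleton A := Fintype.card_le_one_iff_subsingleton.1 (by omega)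
  obtain ⟨x, hx⟩ := hΛ.nonempty
  have huniq : ∀ y ∈ Λ, y = x := by
    intro y hy
    obtain ⟨a, ha⟩ := mem_iUnion.1 (hP.subset_R hx)
    obtain ⟨b, hb⟩ := mem_iUnion.1 (hP.subset_R hy)
    obtain rfl := Subsingleton.elim a b
    have h1 := hP.projS_eq_of_subsingleton hΛ.isUnstableDirection hx hy ha hb
    have h2 : P.projU a x = P.projU a y :=
      hP.swap.projS_eq_of_subsingleton hΛ.isUnstableDirection_symm hx hy (by simpa using ha)
        (by simpa using hb)
    rw [← P.param_proj ha, ← P.param_proj hb, h1, h2]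
  have hfix : φ x = x := huniq _ (hP.apply_mem hx)
  refine hΛ.not_periodic x (Function.mk_mem_periodicPts one_pos hfix) ?_
  ext y
  constructor
  · intro hy
    exact ⟨0, (huniq y hy).symm⟩
  · rintro ⟨n, rfl⟩
    exact iterate_mem (fun z hz => hP.apply_mem hz) hx n

end IsMarkovPartition

end Cover

/-! ### The sublevel sets -/

section Sublevel

variable {M : Type*} [TopologicalSpace M] [ChartedSpace (EuclideanSpace ℝ (Fin 2)) M] {A : Type*}
  {φ : M ≃ₘ^2⟮𝓡 2, 𝓡 2⟯ M} {P : RectangleFamily M A} {Λ : Set M}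
  {Es Eu : ∀ x : M, Submodule ℝ (TangentSpace (𝓡 2) x)} {f : M → ℝ}

lemma sublevel_mono {t t' : ℝ} (h : t ≤ t') : sublevel φ Λ f t ⊆ sublevel φ Λ f t' :=
  fun _ hx => ⟨hx.1, fun n => (hx.2 n).trans h⟩

lemma sublevel_symm (t : ℝ) : sublevel φ.symm Λ f t = sublevel φ Λ f t := by
  ext x
  exact and_congr_right fun _ => forall_iter_symm φ (p := fun y => f y ≤ t)

lemma scale_eq (w : List A) (X : BranchedMap A) : scale (X.cyl w) = ⌊X.weight w⌋ := rfl

/-- The level r is an integer, so comparing it with the floor of the weight is the same as comparing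
it with the weight itself. -/
lemma sep_minimalWords_eq_firstPassage {L : Set (List A)} {S : List A → ℝ} {I : List A → Set ℝ}
    {Q : List A → Prop} (hS : ∀ w, w ≠ [] → w.IsChain (Admissible φ P) → scale (I w) = ⌊S w⌋)
    (hL : ∀ w, w ∈ L ↔ w ≠ [] ∧ w.IsChain (Admissible φ P) ∧ Q w) (r : ℕ) :
    {α ∈ minimalWords φ P I r | Q α} = firstPassage L S r := by
  have hdrop : ∀ α : List A, α.IsChain (Admissible φ P) → 2 ≤ α.length →
      scale (I α.dropLast) = ⌊S α.dropLast⌋ := fun α hc h2 => by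
    refine hS _ (List.length_pos_iff.1 ?_) hc.dropLast
    rw [List.length_dropLast]
    omega
  ext α
  constructor
  · rintro ⟨⟨h0, hc, h1, h2⟩, hQ⟩
    rw [hS α h0 hc, Int.le_floor] at h1
    refine ⟨(hL α).2 ⟨h0, hc, hQ⟩, by simpa using h1, fun hl => ?_⟩
    have := h2 hl
    rw [hdrop α hc hl, Int.floor_lt] at this
    simpa using this
  · rintro ⟨hα, h1, h2⟩
    obtain ⟨h0, hc, hQ⟩ := (hL α).1 hα
    refine ⟨⟨h0, hc, ?_, fun hl => ?_⟩, hQ⟩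
    · rw [hS α h0 hc, Int.le_floor]
      simpa using h1
    · rw [hdrop α hc hl, Int.floor_lt]
      simpa using h2 hl

namespace IsMarkovPartition

lemma apply_mem_sublevel (hP : IsMarkovPartition φ Λ Es Eu P) {t : ℝ} {x : M}
    (hx : x ∈ sublevel φ Λ f t) : φ x ∈ sublevel φ Λ f t :=
  ⟨hP.apply_mem hx.1, forall_iter_apply φ (p := fun y => f y ≤ t) hx.2⟩

lemma symm_apply_mem_sublevel (hP : IsMarkovPartition φ Λ Es Eu P) {t : ℝ} {x : M}
    (hx : x ∈ sublevel φ Λ f t) : φ.symm x ∈ sublevel φ Λ f t := by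
  rw [← sublevel_symm] at hx ⊢
  exact hP.swap.apply_mem_sublevel hx

lemma sublevel_subset_R (hP : IsMarkovPartition φ Λ Es Eu P) (t : ℝ) :
    sublevel φ Λ f t ⊆ ⋃ a, P.R a := fun _ hx => hP.subset_R hx.1

lemma isLanguage_sublevel (hP : IsMarkovPartition φ Λ Es Eu P) (t : ℝ) :
    IsLanguage (language φ P.R (sublevel φ Λ f t)) :=
  isLanguage_language (hP.sublevel_subset_R t) fun _ hx => hP.apply_mem_sublevel hx

lemma wordsU_eq (hP : IsMarkovPartition φ Λ Es Eu P) (t : ℝ) (r : ℕ) :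
    wordsU φ P Λ f t r =
      firstPassage (language φ P.R (sublevel φ Λ f t)) (uSystem φ P).weight r := by
  refine sep_minimalWords_eq_firstPassage (fun w _ hc => ?_) (fun w => ?_) r
  · rw [← hP.cyl_eq_cylU w hc, scale_eq]
  · have key : ∀ hw : w ∈ (uSystem φ P).words, w ∈ language φ P.R (sublevel φ Λ f t) ↔
        (cylU φ P w ∩ Ku φ P Λ f t).Nonempty := fun hw => by
      rw [← hP.cyl_eq_cylU w hw.2, Ku, ← hP.mem_language_iff hw,
        inter_eq_left.2 (hP.sublevel_subset_R t)]
    constructor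
    · intro hw
      have hw' := language_subset_words hw
      exact ⟨hw'.1, hw'.2, (key hw').1 hw⟩
    · rintro ⟨h0, hc, h⟩
      exact (key ⟨h0, hc⟩).2 h

lemma setOf_reverse_mem_language_symm (hP : IsMarkovPartition φ Λ Es Eu P) (t : ℝ) :
    {w | w.reverse ∈ language φ.symm P.swap.R (sublevel φ.symm Λ f t)} =
      language φ P.R (sublevel φ Λ f t) := by
  rw [sublevel_symm, P.swap_R_eq]
  exact setOf_reverse_mem_language φ.symm_apply_apply φ.apply_symm_apply
    (fun _ hx => hP.apply_mem_sublevel hx) fun _ hx => hP.symm_apply_mem_sublevel hx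

lemma isChain_reverse_iff {w : List A} :
    w.reverse.IsChain (Admissible φ.symm P.swap) ↔ w.IsChain (Admissible φ P) := by
  rw [List.isChain_reverse]
  have : (flip (Admissible φ.symm P.swap)) = Admissible φ P := by
    funext a b
    exact propext admissible_symm_swap
  rw [← this]
  rfl

lemma cylS_eq (w : List A) : cylS φ P w = cylU φ.symm P.swap w.reverse := by
  rw [cylS, cylU, P.swap_R_eq]
  rfl

lemma Ks_eq (t : ℝ) : Ks φ P Λ f t = Ku φ.symm P.swap Λ f t := by
  simp only [Ks, Ku, sublevel_symm, RectangleFamily.swap_R]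
  rfl

lemma wordsS_eq (hP : IsMarkovPartition φ Λ Es Eu P) (t : ℝ) (r : ℕ) :
    wordsS φ P Λ f t r = firstPassage (language φ P.R (sublevel φ Λ f t))
      (fun w => (uSystem φ.symm P.swap).weight w.reverse) r := by
  refine sep_minimalWords_eq_firstPassage (fun w _ hc => ?_) (fun w => ?_) r
  · rw [cylS_eq, ← hP.swap.cyl_eq_cylU _ (isChain_reverse_iff.2 hc), scale_eq]
  · rw [← hP.setOf_reverse_mem_language_symm]
    have key : ∀ hw : w.reverse ∈ (uSystem φ.symm P.swap).words,
        w.reverse ∈ language φ.symm P.swap.R (sublevel φ.symm Λ f t) ↔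
        (cylS φ P w ∩ Ks φ P Λ f t).Nonempty := fun hw => by
      rw [cylS_eq, Ks_eq, ← hP.swap.cyl_eq_cylU _ hw.2, Ku, ← hP.swap.mem_language_iff hw,
        inter_eq_left.2 (hP.swap.sublevel_subset_R t)]
    constructor
    · intro hw
      have hw' := language_subset_words hw
      exact ⟨by simpa using hw'.1, isChain_reverse_iff.1 hw'.2, (key hw').1 hw⟩
    · rintro ⟨h0, hc, h⟩
      exact (key ⟨by simpa using h0, isChain_reverse_iff.2 hc⟩).2 h

/-- A word that is not followed by `Λ_t` is not followed by `Λ_{t'}` for `t'` close to `t`. -/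
lemma eventually_notMem_language [T2Space M] (hc : IsCompact Λ) (hf : Continuous f) {t : ℝ}
    {w : List A} (hw : w ∉ language φ P.R (sublevel φ Λ f t)) :
    ∀ᶠ t' in 𝓝 t, w ∉ language φ P.R (sublevel φ Λ f t') := by
  rcases eq_or_ne w [] with rfl | h0
  · exact Eventually.of_forall fun t' h => h.1 rfl
  obtain ⟨n, hn⟩ : ∃ n : ℕ, w ∉ language φ P.R (sublevel φ Λ f (t + 1 / ((n : ℝ) + 1))) := by
    by_contra! hall
    -- Otherwise the points of Λ that follow w below the levels t + 1/(n + 1) form decreasing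
    -- nonempty compact sets. A common point follows w and stays below t, a contradiction.
    set Z : ℕ → Set M := fun n => Λ ∩ ({x | Follows φ P.R w x} ∩
      ⋂ k : ℤ, {x | f (iter φ k x) ≤ t + 1 / ((n : ℝ) + 1)}) with hZ
    have hclosed : ∀ n, IsClosed (Z n) := fun n => hc.isClosed.inter
      ((isClosed_follows φ.continuous (fun a => (P.isCompact_R a).isClosed) w).inter
        (isClosed_iInter fun k => isClosed_le (hf.comp (continuous_iter φ k)) continuous_const))
    have hmono : ∀ n, Z (n + 1) ⊆ Z n := by
      rintro n x ⟨h1, h2, h3⟩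
      refine ⟨h1, h2, mem_iInter.2 fun k => ?_⟩
      have h4 : f (iter φ k x) ≤ t + 1 / (((n + 1 : ℕ) : ℝ) + 1) := mem_iInter.1 h3 k
      change f (iter φ k x) ≤ t + 1 / ((n : ℝ) + 1)
      refine h4.trans ?_
      gcongr
      simp
    have hne : ∀ n, (Z n).Nonempty := by
      intro n
      obtain ⟨-, x, hx, hxw⟩ := hall n
      exact ⟨x, hx.1, hxw, mem_iInter.2 hx.2⟩
    obtain ⟨x, hx⟩ := IsCompact.nonempty_iInter_of_sequence_nonempty_isCompact_isClosed Z hmono hne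
      (hc.of_isClosed_subset (hclosed 0) inter_subset_left) hclosed
    rw [mem_iInter] at hx
    refine hw ⟨h0, x, ⟨(hx 0).1, fun k => ?_⟩, (hx 0).2.1⟩
    have hlim : Tendsto (fun n : ℕ => t + 1 / ((n : ℝ) + 1)) atTop (𝓝 (t + 0)) :=
      tendsto_one_div_add_atTop_nhds_zero_nat.const_add t
    rw [add_zero] at hlim
    exact ge_of_tendsto' hlim fun n => mem_iInter.1 (hx n).2.2 k
  have hpos : t < t + 1 / ((n : ℝ) + 1) := by
    have : (0 : ℝ) < 1 / ((n : ℝ) + 1) := by positivity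
    linarith
  filter_upwards [Iio_mem_nhds hpos] with t' ht' h
  exact hn (language_mono (sublevel_mono (le_of_lt ht')) h)

/-- For t' < t + 1 only the finitely many words counted for t + 1 can occur, so the neighbourhoods
that exclude single words can be intersected. -/
lemma eventually_ncard_firstPassage_le [T2Space M] [Finite A]
    (hP : IsMarkovPartition φ Λ Es Eu P) (hc : IsCompact Λ) (hf : Continuous f)
    {S : List A → ℝ} {C c : ℝ}
    (hS : ∀ t, IsQuasiAdditive (language φ P.R (sublevel φ Λ f t)) S C c) (t : ℝ) (r : ℕ) :
    ∀ᶠ t' in 𝓝 t, (firstPassage (language φ P.R (sublevel φ Λ f t')) S r).ncard ≤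
      (firstPassage (language φ P.R (sublevel φ Λ f t)) S r).ncard := by
  have hfin := firstPassage_finite (hP.isLanguage_sublevel (f := f) (t + 1)) (hS (t + 1)) r
  have hev : ∀ᶠ t' in 𝓝 t, ∀ w ∈ firstPassage (language φ P.R (sublevel φ Λ f (t + 1))) S r,
      w ∈ language φ P.R (sublevel φ Λ f t') → w ∈ language φ P.R (sublevel φ Λ f t) := by
    rw [Set.Finite.eventually_all hfin]
    intro w _
    by_cases hw : w ∈ language φ P.R (sublevel φ Λ f t)
    · exact Eventually.of_forall fun _ _ => hw
    · exact (eventually_notMem_language hc hf hw).mono fun t' h h' => absurd h' h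
  filter_upwards [hev, Iio_mem_nhds (lt_add_one t)] with t' h ht'
  refine ncard_le_ncard (fun w hw => ⟨?_, hw.2⟩)
    (firstPassage_finite (hP.isLanguage_sublevel t) (hS t) r)
  exact h w ⟨language_mono (sublevel_mono (le_of_lt ht')) hw.1, hw.2⟩ hw.1

end IsMarkovPartition

end Sublevel

lemma le_pow_of_two_le {n E k : ℕ} (hn : 2 ≤ n) (hk : E ≤ k) : E ≤ n ^ k :=
  (hk.trans Nat.lt_two_pow_self.le).trans (Nat.pow_le_pow_left hn k)

end MarkovLagrange

/-! ### The theorem, from the unstable system and its swapped counterpart. -/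

open MarkovLagrange in
theorem propositionp {M : Type*} [TopologicalSpace M] [T2Space M] [SecondCountableTopology M]
    [ChartedSpace (EuclideanSpace ℝ (Fin 2)) M] [IsManifold (𝓡 2) ∞ M]
    (φ : M ≃ₘ^2⟮𝓡 2, 𝓡 2⟯ M) (Λ : Set M)
    (Es Eu : ∀ x : M, Submodule ℝ (TangentSpace (𝓡 2) x))
    (hΛ : MarkovLagrange.IsHorseshoe φ Λ Es Eu)
    {A : Type*} [Fintype A] (P : MarkovLagrange.RectangleFamily M A)
    (hP : MarkovLagrange.IsMarkovPartition φ Λ Es Eu P) :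
    ∃ c₃ : ℕ, ∀ (r : WithTop ℕ∞) (f : M → ℝ), 2 ≤ r → ContMDiff (𝓡 2) 𝓘(ℝ, ℝ) r f →
      ∃ Du Ds : ℝ → ℝ,
        -- the counts are finite and essentially submultiplicative
        (∀ t n, (MarkovLagrange.wordsU φ P Λ f t n).Finite ∧
          (MarkovLagrange.wordsS φ P Λ f t n).Finite) ∧
        (∀ t n m, MarkovLagrange.Nu φ P Λ f t (n + m) ≤
          Fintype.card A ^ c₃ * MarkovLagrange.Nu φ P Λ f t n * MarkovLagrange.Nu φ P Λ f t m) ∧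
        (∀ t n m, MarkovLagrange.Ns φ P Λ f t (n + m) ≤
          Fintype.card A ^ c₃ * MarkovLagrange.Ns φ P Λ f t n * MarkovLagrange.Ns φ P Λ f t m) ∧
        -- the limits exist and coincide with the infima
        (∀ t, Du t = MarkovLagrange.growthInf (Fintype.card A ^ c₃)
          (MarkovLagrange.Nu φ P Λ f t)) ∧
        (∀ t, Ds t = MarkovLagrange.growthInf (Fintype.card A ^ c₃)
          (MarkovLagrange.Ns φ P Λ f t)) ∧
        (∀ t, Tendsto (fun m : ℕ => 1 / (m : ℝ) * Real.log (MarkovLagrange.Nu φ P Λ f t m))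
          atTop (𝓝 (Du t))) ∧
        (∀ t, Tendsto (fun m : ℕ => 1 / (m : ℝ) * Real.log (MarkovLagrange.Ns φ P Λ f t m))
          atTop (𝓝 (Ds t))) ∧
        -- they are the box-counting dimensions
        (∀ t, MarkovLagrange.HasBoxDim (MarkovLagrange.Ku φ P Λ f t) (Du t)) ∧
        (∀ t, MarkovLagrange.HasBoxDim (MarkovLagrange.Ks φ P Λ f t) (Ds t)) ∧
        UpperSemicontinuous Du ∧ UpperSemicontinuous Ds := by
  obtain ⟨Cu, cu, hSu⟩ := hP.exists_isQuasiAdditive hΛ.isUnstableDirection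
  obtain ⟨Cs, cs, hSs⟩ := hP.swap.exists_isQuasiAdditive hΛ.isUnstableDirection_symm
  obtain ⟨E₁, hE₁⟩ := exists_firstPassage_add_le A Cu cu
  obtain ⟨E₂, hE₂⟩ := exists_firstPassage_add_le A Cs cs
  have hcard := hP.two_le_card hΛ
  -- The exponent is fixed before f and t; since there are at least two letters, the power exceeds
  -- both constants.
  refine ⟨E₁ + E₂, fun r f hr hf => ?_⟩
  have hfc : Continuous f := hf.continuous
  have hL := hP.isLanguage_sublevel (f := f)
  have hSu' : ∀ t, IsQuasiAdditive (language φ P.R (sublevel φ Λ f t)) (uSystem φ P).weight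
      Cu cu := fun t => hSu.mono language_subset_words
  -- The stable weight is the unstable weight of the inverse system read on the reversed word, on
  -- the same language.
  have hSs' : ∀ t, IsQuasiAdditive (language φ P.R (sublevel φ Λ f t))
      (fun w => (uSystem φ.symm P.swap).weight w.reverse) Cs cs := fun t => by
    rw [← hP.setOf_reverse_mem_language_symm t]
    exact (hSs.mono language_subset_words).reverse
  have hNu : ∀ t n, Nu φ P Λ f t n = (firstPassage (language φ P.R (sublevel φ Λ f t))
      (uSystem φ P).weight n).ncard := fun t n => by rw [Nu, hP.wordsU_eq]
  have hNs : ∀ t n, Ns φ P Λ f t n = (firstPassage (language φ P.R (sublevel φ Λ f t))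
      (fun w => (uSystem φ.symm P.swap).weight w.reverse) n).ncard :=
    fun t n => by rw [Ns, hP.wordsS_eq]
  have hsubU : ∀ t n m, Nu φ P Λ f t (n + m) ≤
      Fintype.card A ^ (E₁ + E₂) * Nu φ P Λ f t n * Nu φ P Λ f t m := fun t n m => by
    simp only [hNu]
    refine (hE₁ _ _ (hL t) (hSu' t) n m).trans ?_
    gcongr
    exact le_pow_of_two_le hcard (by omega)
  have hsubS : ∀ t n m, Ns φ P Λ f t (n + m) ≤
      Fintype.card A ^ (E₁ + E₂) * Ns φ P Λ f t n * Ns φ P Λ f t m := fun t n m => by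
    simp only [hNs]
    refine (hE₂ _ _ (hL t) (hSs' t) n m).trans ?_
    gcongr
    exact le_pow_of_two_le hcard (by omega)
  have hB : 0 < Fintype.card A ^ (E₁ + E₂) := by positivity
  have hzero : ∀ {S : List A → ℝ} {C c : ℝ} {t : ℝ},
      IsQuasiAdditive (language φ P.R (sublevel φ Λ f t)) S C c →
      (∀ m, (firstPassage (language φ P.R (sublevel φ Λ f t)) S m).ncard = 0) ∨
      ∀ m, 0 < (firstPassage (language φ P.R (sublevel φ Λ f t)) S m).ncard := by
    intro S C c t hS
    rcases (language φ P.R (sublevel φ Λ f t)).eq_empty_or_nonempty with h | h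
    · exact Or.inl fun m => by simp [h, firstPassage]
    · exact Or.inr fun m => (ncard_pos (firstPassage_finite (hL t) hS m)).2
        (firstPassage_nonempty (hL t) hS h m)
  have hlimU : ∀ t, Tendsto (fun m : ℕ => 1 / (m : ℝ) * Real.log (Nu φ P Λ f t m)) atTop
      (𝓝 (growthInf (Fintype.card A ^ (E₁ + E₂)) (Nu φ P Λ f t))) := fun t =>
    tendsto_growthInf hB (by simpa only [hNu] using hzero (hSu' t)) (hsubU t)
  have hlimS : ∀ t, Tendsto (fun m : ℕ => 1 / (m : ℝ) * Real.log (Ns φ P Λ f t m)) atTop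
      (𝓝 (growthInf (Fintype.card A ^ (E₁ + E₂)) (Ns φ P Λ f t))) := fun t =>
    tendsto_growthInf hB (by simpa only [hNs] using hzero (hSs' t)) (hsubS t)
  refine ⟨fun t => growthInf (Fintype.card A ^ (E₁ + E₂)) (Nu φ P Λ f t),
    fun t => growthInf (Fintype.card A ^ (E₁ + E₂)) (Ns φ P Λ f t), fun t n => ⟨?_, ?_⟩, hsubU,
    hsubS, fun t => rfl, fun t => rfl, hlimU, hlimS, fun t => ?_, fun t => ?_,
    upperSemicontinuous_growthInf _ _ fun t m => ?_,
    upperSemicontinuous_growthInf _ _ fun t m => ?_⟩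
  · rw [hP.wordsU_eq]
    exact firstPassage_finite (hL t) (hSu' t) n
  · rw [hP.wordsS_eq]
    exact firstPassage_finite (hL t) (hSs' t) n
  · refine (hP.isCylinderCover (hP.sublevel_subset_R t)
      fun x hx => hP.apply_mem_sublevel hx).hasBoxDim (hL t) (hSu' t) ?_
    simpa only [hNu] using hlimU t
  · have hcov := (hP.swap.isCylinderCover (hP.swap.sublevel_subset_R (f := f) t)
      fun x hx => hP.swap.apply_mem_sublevel hx).reverse
    rw [hP.setOf_reverse_mem_language_symm] at hcov
    rw [IsMarkovPartition.Ks_eq]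
    refine hcov.hasBoxDim (hL t) (hSs' t) ?_
    simpa only [hNs] using hlimS t
  · simp only [hNu]
    exact hP.eventually_ncard_firstPassage_le hΛ.isCompact hfc hSu' t m
  · simp only [hNs]
    exact hP.eventually_ncard_firstPassage_le hΛ.isCompact hfc hSs' t m
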